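/- Let $\Gamma=\mathrm{SL}_2(\mathbb Z)$, $T=\left(\begin{smallmatrix}1&1\\0&1\end{smallmatrix}\right)$, $B=\{\pm T^n:n\in\mathbb Z\}$, let $\mathfrak H$ be the upper half-plane, $z=x+iy$, $q=e^{2\pi i z}$, and $j(\gamma,w)=cw+d$ for $\gamma=\left(\begin{smallmatrix}a&b\\c&d\end{smallmatrix}\right)$. **Modular forms.** $\mathcal R$ is the space of real analytic $f:\mathfrak H\to\mathbb C$ such that, for some $C>0$, $f(z)=O(y^C)$ as $y\to\infty$, uniformly for $x$ in bounded sets. For $r,s\in\mathbb Z$ put $(f|_{r,s}\gamma)(z)=j(\gamma,z)^{-r}j(\gamma,\bar z)^{-s}f(\gamma z)$, and let $H^0_{r,s}(\Gamma,\mathcal R)=\{f\in\mathcal R: f|_{r,s}\gamma=f\ \text{for all }\gamma\in\Gamma\}$. Let $\mathcal M_{r,s}$ be the space of $f\in H^0_{r,s}(\Gamma,\mathcal R)$ that have an expansion $f(z)=\sum_{|j|\le M}y^j\sum_{m,n\ge0}a^{(j)}_{m,n}q^m\bar q^n$ for some $M\in\mathbb N$ (with absolutely convergent inner series), and let $\mathcal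 M=\bigoplus_{r,s\in\mathbb Z}\mathcal M_{r,s}$. Let $\partial$ and $\bar\partial$ be the operators that act on the part of weights $(r,s)$ by $\partial_r=2iy\,\partial/\partial z+r$ (to weights $(r+1,s-1)$) and $\bar\partial_s=-2iy\,\partial/\partial\bar z+s$ (to weights $(r-1,s+1)$). Let $S_k$ be the space of holomorphic cusp forms of weight $k$ for $\Gamma$, $S=\bigoplus_kS_k$, $\bar S$ its complex conjugate, and $\mathcal E_{r,s}(z)=\sum_{\gamma\in B\backslash\Gamma}j(\gamma,z)^{-r}j(\gamma,\bar z)^{-s}$ for $r+s$ even. The space $\mathcal{MI}'_2$ of extended modular iterated integrals of length $2$ is the largest subspace of $\mathcal M$ with $$\partial\,\mathcal{MI}'_2\subset\mathcal{MI}'_2+\bigoplus_{j,a,b}y^j\mathcal E_{a,b}S,\qquad \bar\partial\,\mathcal{MI}'_2\subset\mathcal{MI}'_2+\bigoplus_{j,a,b}y^j\mathcal E_{a,b}\bar S,$$ where $j\in\mathbb Z$, $a,b\ge1$, $a+b\ge4$, $a\equiv b\bmod 2$. **Second-order invariants.** Let $k_1\ge2$ be an even integer and let $P_{k_1-2}$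 be the space of polynomials of degree $\le k_1-2$ in $\mathbb C[X]$. For $F\in\mathcal R\otimes P_{k_1-2}$ put $(F|_{r,s,2-k_1}\gamma)(z,X)=F(\gamma z,\gamma X)\,j(\gamma,z)^{-r}j(\gamma,\bar z)^{-s}j(\gamma,X)^{k_1-2}$. Let $M_c^{(2)}(\mathcal R)$ be the space of $F\in\mathcal R\otimes P_{k_1-2}$ such that $F|_{r,s,2-k_1}\gamma-F\in H^0_{r,s}(\Gamma,\mathcal R)\otimes P_{k_1-2}$ for all $\gamma\in\Gamma$ and $F|_{r,s,2-k_1}\pi=F$ for all $\pi\in B$. **The families.** For $h\in S_{k_1}$ let $$F_h^+(z,X)=\int_{i\infty}^zh(w)(w-X)^{k_1-2}dw,\qquad r_h^+(\gamma;X)=\int_{\gamma^{-1}i\infty}^{i\infty}h(w)(w-X)^{k_1-2}dw,$$ and let $F_h^-$, $r_h^-$ be obtained from these by complex conjugation of the values of the integrals (acting trivially on $X$). Put $$\psi^\pm_{h;r,s}(z,X)=\sum_{\gamma\in B\backslash\Gamma}\frac{r_h^\pm(\gamma;X)}{j(\gamma,z)^rj(\gamma,\bar z)^s},\qquad \phi^\pm_{r,s}(h;z,X)=\sum_{\gamma\in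 B\backslash\Gamma}\big(F_h^\pm|_{r,s,2-k_1}\gamma\big)(z,X).$$ **Proposition.** Let $r,s\in\mathbb Z$ with $r+s$ even and $r+s>k_1$. Then the series $\mathcal E_{r,s}$, $\psi^\pm_{h;r,s}$, $\phi^\pm_{r,s}(h;\cdot)$ are well defined (their terms depend only on the coset $B\gamma$) and converge absolutely, coefficient by coefficient; one has $\phi^\pm_{r,s}(h;\cdot)=\psi^\pm_{h;r,s}+F_h^\pm\mathcal E_{r,s}$; and $\phi^\pm_{r,s}(h;\cdot)$ is $\Gamma$-invariant under $|_{r,s,2-k_1}$. Write $$\phi^\pm_{r,s}(h;z,X)=\sum_{i=0}^{k_1-2}\phi^\pm_{r,s}(h;i,z)(X-z)^i(X-\bar z)^{k_1-2-i}.$$ The subspace generated by the family $\{\psi^\pm_{h;r,s}: h\in S_{k_1}\}$ is contained in $M_c^{(2)}(\mathcal R)$, and there is a well-defined (that is, exactly one) linear map from it to $\bigoplus_{i=0}^{k_1-2}\mathcal{MI}'_2$ such that, for all $h\in S_{k_1}$ and both signs, $$\psi^\pm_{h;r,s}\longmapsto\big(\phi^\pm_{r,s}(h;0,\cdot),\dots,\phi^\pm_{r,s}(h;k_1-2,\cdot)\big),$$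 where $\phi^\pm_{r,s}(h;i,\cdot)$ is placed in weights $(r+i,\,s+k_1-2-i)$. -/

import Mathlib

open UpperHalfPlane Polynomial
open scoped MatrixGroups ComplexConjugate

noncomputable section

namespace RAIter

/-! ### The modular group, automorphy factors, sums over `B \ Γ` -/

/-- The automorphy factor `c w + d` of `γ ∈ SL₂(ℤ)`. -/
def jfac (γ : SL(2, ℤ)) (w : ℂ) : ℂ := (γ 1 0 : ℂ) * w + (γ 1 1 : ℂ)

/-- The weight factor `j(γ, z)^{-r} j(γ, z̄)^{-s}`. -/
def wt (r s : ℤ) (γ : SL(2, ℤ)) (z : ℍ) : ℂ :=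
  jfac γ z ^ (-r) * jfac γ (conj (z : ℂ)) ^ (-s)

/-- The subgroup `B = {± Tⁿ : n ∈ ℤ}`, the stabiliser of the cusp `i∞`. -/
def B : Subgroup SL(2, ℤ) where
  carrier := {β | ∃ n : ℤ, β = ModularGroup.T ^ n ∨ β = -ModularGroup.T ^ n}
  one_mem' := ⟨0, Or.inl (by simp)⟩
  mul_mem' := by
    rintro a b ⟨m, rfl | rfl⟩ ⟨n, rfl | rfl⟩
    · exact ⟨m + n, Or.inl (zpow_add _ _ _).symm⟩
    · exact ⟨m + n, Or.inr (by rw [zpow_add]; simp)⟩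
    · exact ⟨m + n, Or.inr (by rw [zpow_add]; simp)⟩
    · exact ⟨m + n, Or.inl (by rw [zpow_add]; simp)⟩
  inv_mem' := by
    rintro a ⟨m, rfl | rfl⟩
    · exact ⟨-m, Or.inl (zpow_neg _ _).symm⟩
    · refine ⟨-m, Or.inr ?_⟩
      rw [zpow_neg, inv_eq_iff_mul_eq_one]
      simp

/-- The set `B \ Γ` of cosets `B γ`. -/
abbrev BCosets : Type := Quotient (QuotientGroup.rightRel B)

/-- The sum over `B \ Γ` of a term that depends only on the coset of `γ`. -/
def cosetSum (t : SL(2, ℤ) → ℂ) : ℂ := ∑' q : BCosets, t q.out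

/-- The same sum, taken coefficient by coefficient, for terms that are polynomials of degree at
most `K`. -/
def cosetSumPoly (K : ℕ) (t : SL(2, ℤ) → ℂ[X]) : ℂ[X] :=
  ∑ n ∈ Finset.range (K + 1), monomial n (cosetSum fun γ => (t γ).coeff n)

/-! ### Real analytic functions and real analytic modular forms -/

/-- `f : ℍ → ℂ` is real analytic. -/
def IsRealAnalytic (f : ℍ → ℂ) : Prop :=
  AnalyticOnNhd ℝ (fun w : ℂ => f (ofComplex w)) {w : ℂ | 0 < w.im}

/-- `f(z) = O(y^C)` for some `C > 0` as `y → ∞`, uniformly for `x` in bounded sets. -/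
def PolyGrowth (f : ℍ → ℂ) : Prop :=
  ∃ C : ℝ, 0 < C ∧ ∀ b : ℝ, ∃ A D : ℝ, ∀ z : ℍ, |z.re| ≤ b → A ≤ z.im →
    ‖f z‖ ≤ D * z.im ^ C

theorem PolyGrowth.add {f g : ℍ → ℂ} (hf : PolyGrowth f) (hg : PolyGrowth g) :
    PolyGrowth (f + g) := by
  obtain ⟨C, hC, hf⟩ := hf
  obtain ⟨C', hC', hg⟩ := hg
  refine ⟨max C C', lt_max_of_lt_left hC, fun b => ?_⟩
  obtain ⟨A, D, h⟩ := hf b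
  obtain ⟨A', D', h'⟩ := hg b
  refine ⟨max 1 (max A A'), |D| + |D'|, fun z hz hy => ?_⟩
  have h1 : 1 ≤ z.im := le_trans (le_max_left _ _) hy
  have h2 : A ≤ z.im := le_trans ((le_max_left _ _).trans (le_max_right _ _)) hy
  have h3 : A' ≤ z.im := le_trans ((le_max_right _ _).trans (le_max_right _ _)) hy
  have e1 : D * z.im ^ C ≤ |D| * z.im ^ max C C' :=
    mul_le_mul (le_abs_self D) (Real.rpow_le_rpow_of_exponent_le h1 (le_max_left _ _))
      (by positivity) (abs_nonneg D)
  have e2 : D' * z.im ^ C' ≤ |D'| * z.im ^ max C C' :=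
    mul_le_mul (le_abs_self D') (Real.rpow_le_rpow_of_exponent_le h1 (le_max_right _ _))
      (by positivity) (abs_nonneg D')
  have e3 := h z hz h2
  have e4 := h' z hz h3
  calc ‖(f + g) z‖ ≤ ‖f z‖ + ‖g z‖ := norm_add_le _ _
    _ ≤ (|D| + |D'|) * z.im ^ max C C' := by rw [add_mul]; linarith

theorem PolyGrowth.smul {f : ℍ → ℂ} (c : ℂ) (hf : PolyGrowth f) : PolyGrowth (c • f) := by
  obtain ⟨C, hC, hf⟩ := hf
  refine ⟨C, hC, fun b => ?_⟩
  obtain ⟨A, D, h⟩ := hf b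
  refine ⟨A, ‖c‖ * D, fun z hz hy => ?_⟩
  have := mul_le_mul_of_nonneg_left (h z hz hy) (norm_nonneg c)
  simpa [mul_assoc] using this

/-- The space `𝓡` of real analytic functions on `ℍ` of polynomial growth at `i∞`. -/
def RR : Submodule ℂ (ℍ → ℂ) where
  carrier := {f | IsRealAnalytic f ∧ PolyGrowth f}
  zero_mem' := ⟨fun _ _ => analyticAt_const, 1, one_pos, fun _ => ⟨0, 0, fun z _ _ => by simp⟩⟩
  add_mem' := fun hf hg => ⟨fun w hw => (hf.1 w hw).add (hg.1 w hw), hf.2.add hg.2⟩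
  smul_mem' := fun c _ hf =>
    ⟨fun w hw => analyticAt_const.mul (hf.1 w hw), hf.2.smul c⟩

/-- The action `(f |_{r,s} γ)(z) = j(γ, z)^{-r} j(γ, z̄)^{-s} f(γ z)`. -/
def slashRS (r s : ℤ) (γ : SL(2, ℤ)) (f : ℍ → ℂ) : ℍ → ℂ :=
  fun z => wt r s γ z * f (γ • z)

/-- `H⁰(Γ, 𝓡)` for the action `|_{r,s}`. -/
def invRR (r s : ℤ) : Submodule ℂ (ℍ → ℂ) where
  carrier := {f | f ∈ RR ∧ ∀ γ : SL(2, ℤ), slashRS r s γ f = f}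
  zero_mem' := ⟨RR.zero_mem, fun γ => by ext z; simp [slashRS]⟩
  add_mem' := by
    rintro f g ⟨hf, hf'⟩ ⟨hg, hg'⟩
    refine ⟨RR.add_mem hf hg, fun γ => ?_⟩
    ext z
    have h1 := congrFun (hf' γ) z
    have h2 := congrFun (hg' γ) z
    simp only [slashRS, Pi.add_apply, mul_add] at *
    rw [h1, h2]
  smul_mem' := by
    rintro c f ⟨hf, hf'⟩
    refine ⟨RR.smul_mem c hf, fun γ => ?_⟩
    ext z
    have h1 := congrFun (hf' γ) z
    simp only [slashRS, Pi.smul_apply, smul_eq_mul] at *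
    rw [mul_left_comm, h1]

/-- `q = exp(2 π i z)`. -/
def qpar (z : ℍ) : ℂ := Complex.exp (2 * Real.pi * Complex.I * z)

/-- The expansion condition `f(z) = ∑_{|j| ≤ M} y^j ∑_{m,n ≥ 0} a_{m,n}^{(j)} q^m q̄^n`, the inner
series being (absolutely) convergent. -/
def HasFE (f : ℍ → ℂ) : Prop :=
  ∃ (M : ℕ) (a : ℤ → ℕ × ℕ → ℂ), ∀ z : ℍ,
    (∀ j ∈ Finset.Icc (-(M : ℤ)) M,
      Summable fun p : ℕ × ℕ => a j p * qpar z ^ p.1 * conj (qpar z) ^ p.2) ∧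
    f z = ∑ j ∈ Finset.Icc (-(M : ℤ)) M,
      (z.im : ℂ) ^ j * ∑' p : ℕ × ℕ, a j p * qpar z ^ p.1 * conj (qpar z) ^ p.2

theorem HasFE.mono {f : ℍ → ℂ} (hf : HasFE f) :
    ∃ M₀ : ℕ, ∀ M : ℕ, M₀ ≤ M → ∃ a : ℤ → ℕ × ℕ → ℂ, ∀ z : ℍ,
      (∀ j ∈ Finset.Icc (-(M : ℤ)) M,
        Summable fun p : ℕ × ℕ => a j p * qpar z ^ p.1 * conj (qpar z) ^ p.2) ∧
      f z = ∑ j ∈ Finset.Icc (-(M : ℤ)) M,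
        (z.im : ℂ) ^ j * ∑' p : ℕ × ℕ, a j p * qpar z ^ p.1 * conj (qpar z) ^ p.2 := by
  obtain ⟨M₀, a, h⟩ := hf
  refine ⟨M₀, fun M hM => ⟨fun j => if j ∈ Finset.Icc (-(M₀ : ℤ)) M₀ then a j else 0,
    fun z => ⟨fun j _ => ?_, ?_⟩⟩⟩
  · by_cases hj : j ∈ Finset.Icc (-(M₀ : ℤ)) M₀
    · simpa only [if_pos hj] using (h z).1 j hj
    · simp only [if_neg hj, Pi.zero_apply, zero_mul]
      exact summable_zero
  · rw [(h z).2]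
    have hsub : Finset.Icc (-(M₀ : ℤ)) M₀ ⊆ Finset.Icc (-(M : ℤ)) M :=
      Finset.Icc_subset_Icc (by omega) (by omega)
    rw [← Finset.sum_subset hsub]
    · exact Finset.sum_congr rfl fun j hj => by simp only [if_pos hj]
    · intro j _ hj
      simp only [if_neg hj, Pi.zero_apply, zero_mul, tsum_zero, mul_zero]

/-- The space `𝓜_{r,s}` of real analytic modular forms of weights `(r, s)`, for `r, s ∈ ℤ`. -/
def MM (r s : ℤ) : Submodule ℂ (ℍ → ℂ) where
  carrier := {f | f ∈ invRR r s ∧ HasFE f}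
  zero_mem' := ⟨(invRR r s).zero_mem, 0, 0, fun z => by simp [summable_zero]⟩
  add_mem' := by
    rintro f g ⟨hf, hf'⟩ ⟨hg, hg'⟩
    refine ⟨(invRR r s).add_mem hf hg, ?_⟩
    obtain ⟨M, hM⟩ := hf'.mono
    obtain ⟨M', hM'⟩ := hg'.mono
    obtain ⟨a, ha⟩ := hM (max M M') (le_max_left _ _)
    obtain ⟨b, hb⟩ := hM' (max M M') (le_max_right _ _)
    refine ⟨max M M', a + b, fun z => ⟨fun j hj => ?_, ?_⟩⟩
    · simpa only [Pi.add_apply, add_mul] using ((ha z).1 j hj).add ((hb z).1 j hj)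
    · rw [Pi.add_apply, (ha z).2, (hb z).2, ← Finset.sum_add_distrib]
      refine Finset.sum_congr rfl fun j hj => ?_
      rw [← mul_add, ← ((ha z).1 j hj).tsum_add ((hb z).1 j hj)]
      simp only [Pi.add_apply, add_mul]
  smul_mem' := by
    rintro c f ⟨hf, M, a, ha⟩
    refine ⟨(invRR r s).smul_mem c hf, M, c • a, fun z => ⟨fun j hj => ?_, ?_⟩⟩
    · simpa only [Pi.smul_apply, smul_eq_mul, mul_assoc] using ((ha z).1 j hj).mul_left c
    · rw [Pi.smul_apply, (ha z).2, Finset.smul_sum]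
      refine Finset.sum_congr rfl fun j hj => ?_
      simp only [Pi.smul_apply, smul_eq_mul, mul_assoc, tsum_mul_left]
      ring

/-! ### The bigraded space `𝓜 = ⨁ 𝓜_{r,s}` and the operators `∂`, `∂̄` -/

/-- Finitely supported families `(f_{r,s})_{(r,s) ∈ ℤ²}` of functions on `ℍ`. -/
abbrev Bigraded : Type := (ℤ × ℤ) →₀ (ℍ → ℂ)

/-- `𝓜 = ⨁_{r,s ∈ ℤ} 𝓜_{r,s}`. -/
def MMtot : Submodule ℂ Bigraded where
  carrier := {F | ∀ p : ℤ × ℤ, F p ∈ MM p.1 p.2}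
  zero_mem' := fun p => (MM p.1 p.2).zero_mem
  add_mem' := fun hF hG p => (MM p.1 p.2).add_mem (hF p) (hG p)
  smul_mem' := fun c _ hF p => (MM p.1 p.2).smul_mem c (hF p)

/-- The Wirtinger derivative `∂f/∂z = (∂f/∂x - i ∂f/∂y) / 2`. -/
def dz (f : ℍ → ℂ) (z : ℍ) : ℂ :=
  (1 / 2 : ℂ) * (fderiv ℝ (fun w : ℂ => f (ofComplex w)) z 1 -
    Complex.I * fderiv ℝ (fun w : ℂ => f (ofComplex w)) z Complex.I)

/-- The Wirtinger derivative `∂f/∂z̄ = (∂f/∂x + i ∂f/∂y) / 2`. -/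
def dzbar (f : ℍ → ℂ) (z : ℍ) : ℂ :=
  (1 / 2 : ℂ) * (fderiv ℝ (fun w : ℂ => f (ofComplex w)) z 1 +
    Complex.I * fderiv ℝ (fun w : ℂ => f (ofComplex w)) z Complex.I)

/-- The Maass operator `∂_r = 2 i y ∂/∂z + r`. -/
def maass (r : ℤ) (f : ℍ → ℂ) : ℍ → ℂ :=
  fun z => 2 * Complex.I * z.im * dz f z + r * f z

/-- The Maass operator `∂̄_s = -2 i y ∂/∂z̄ + s`. -/
def maassBar (s : ℤ) (f : ℍ → ℂ) : ℍ → ℂ :=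
  fun z => -2 * Complex.I * z.im * dzbar f z + s * f z

/-- `∂` on bigraded families: `∂_r` on the part of weights `(r, s)`, with values in the part of
weights `(r + 1, s - 1)`. -/
def del (F : Bigraded) : Bigraded :=
  F.sum fun p f => Finsupp.single (p.1 + 1, p.2 - 1) (maass p.1 f)

/-- `∂̄` on bigraded families: `∂̄_s` on the part of weights `(r, s)`, with values in the part of
weights `(r - 1, s + 1)`. -/
def delBar (F : Bigraded) : Bigraded :=
  F.sum fun p f => Finsupp.single (p.1 - 1, p.2 + 1) (maassBar p.2 f)

/-! ### Eisenstein series and extended modular iterated integrals of length 2 -/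

/-- `𝓔_{r,s}(z) = ∑_{γ ∈ B \ Γ} j(γ, z)^{-r} j(γ, z̄)^{-s}`. -/
def eis (r s : ℤ) (z : ℍ) : ℂ := cosetSum fun γ => wt r s γ z

/-- `⨁_{j ∈ ℤ; a, b ≥ 1, a + b ≥ 4} y^j 𝓔_{a,b} S` (with `a, b` of the same parity and `S` the
space of holomorphic cusp forms of all weights), as a bigraded space: `y`, `𝓔_{a,b}` and `g ∈ S_k`
have the weights `(-1, -1)`, `(a, b)` and `(k, 0)`. -/
def eisCusp : Submodule ℂ Bigraded :=
  Submodule.span ℂ {F | ∃ (j a b k : ℤ) (g : CuspForm 𝒮ℒ k),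
    1 ≤ a ∧ 1 ≤ b ∧ 4 ≤ a + b ∧ Even (a + b) ∧
    F = Finsupp.single (a + k - j, b - j) fun z => (z.im : ℂ) ^ j * eis a b z * g z}

/-- `⨁_{j ∈ ℤ; a, b ≥ 1, a + b ≥ 4} y^j 𝓔_{a,b} S̄`, where the conjugate of `g ∈ S_k` has the
weights `(0, k)`. -/
def eisCuspBar : Submodule ℂ Bigraded :=
  Submodule.span ℂ {F | ∃ (j a b k : ℤ) (g : CuspForm 𝒮ℒ k),
    1 ≤ a ∧ 1 ≤ b ∧ 4 ≤ a + b ∧ Even (a + b) ∧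
    F = Finsupp.single (a - j, b + k - j) fun z => (z.im : ℂ) ^ j * eis a b z * conj (g z)}

/-- The subspaces `N ⊆ 𝓜` with `∂ N ⊆ N + ⨁ y^j 𝓔_{a,b} S` and `∂̄ N ⊆ N + ⨁ y^j 𝓔_{a,b} S̄`. -/
def MICond (N : Submodule ℂ Bigraded) : Prop :=
  N ≤ MMtot ∧ (∀ F ∈ N, del F ∈ N ⊔ eisCusp) ∧ (∀ F ∈ N, delBar F ∈ N ⊔ eisCuspBar)

/-- The space `𝓜𝓘'₂` of extended modular iterated integrals of length 2: the largest subspace of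
`𝓜` that satisfies `MICond`. -/
def MI2' : Submodule ℂ Bigraded := sSup {N | MICond N}

theorem IsRealAnalytic.differentiableAt {f : ℍ → ℂ} (hf : IsRealAnalytic f) (z : ℍ) :
    DifferentiableAt ℝ (fun w : ℂ => f (ofComplex w)) z :=
  (hf z z.im_pos).differentiableAt

theorem fderiv_add_comp {f g : ℍ → ℂ} (hf : IsRealAnalytic f) (hg : IsRealAnalytic g) (z : ℍ) :
    fderiv ℝ (fun w : ℂ => (f + g) (ofComplex w)) z =
      fderiv ℝ (fun w : ℂ => f (ofComplex w)) z + fderiv ℝ (fun w : ℂ => g (ofComplex w)) z :=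
  fderiv_add (hf.differentiableAt z) (hg.differentiableAt z)

theorem maass_zero (r : ℤ) : maass r 0 = 0 := by
  ext z
  simp [maass, dz]

theorem maassBar_zero (r : ℤ) : maassBar r 0 = 0 := by
  ext z
  simp [maassBar, dzbar]

theorem del_apply (F : Bigraded) (p : ℤ × ℤ) :
    del F p = maass (p.1 - 1) (F (p.1 - 1, p.2 + 1)) := by
  classical
  rw [del, Finsupp.sum, Finsupp.finsetSum_apply, Finset.sum_eq_single (p.1 - 1, p.2 + 1)]
  · simp
  · intro q _ hq
    refine Finsupp.single_eq_of_ne fun h => hq ?_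
    rw [h]
    simp
  · intro h
    rw [Finsupp.notMem_support_iff.mp h, maass_zero]
    simp

theorem delBar_apply (F : Bigraded) (p : ℤ × ℤ) :
    delBar F p = maassBar (p.2 - 1) (F (p.1 + 1, p.2 - 1)) := by
  classical
  rw [delBar, Finsupp.sum, Finsupp.finsetSum_apply, Finset.sum_eq_single (p.1 + 1, p.2 - 1)]
  · simp
  · intro q _ hq
    refine Finsupp.single_eq_of_ne fun h => hq ?_
    rw [h]
    simp
  · intro h
    rw [Finsupp.notMem_support_iff.mp h, maassBar_zero]
    simp

theorem del_add {F G : Bigraded} (hF : F ∈ MMtot) (hG : G ∈ MMtot) :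
    del (F + G) = del F + del G := by
  ext p z
  have h := fderiv_add_comp (hF (p.1 - 1, p.2 + 1)).1.1.1 (hG (p.1 - 1, p.2 + 1)).1.1.1 z
  rw [Finsupp.add_apply, del_apply, del_apply, del_apply, Finsupp.add_apply, Pi.add_apply]
  simp only [maass, dz]
  rw [h]
  simp only [Pi.add_apply, add_apply]
  ring

theorem delBar_add {F G : Bigraded} (hF : F ∈ MMtot) (hG : G ∈ MMtot) :
    delBar (F + G) = delBar F + delBar G := by
  ext p z
  have h := fderiv_add_comp (hF (p.1 + 1, p.2 - 1)).1.1.1 (hG (p.1 + 1, p.2 - 1)).1.1.1 z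
  rw [Finsupp.add_apply, delBar_apply, delBar_apply, delBar_apply, Finsupp.add_apply, Pi.add_apply]
  simp only [maassBar, dzbar]
  rw [h]
  simp only [Pi.add_apply, add_apply]
  ring

/-- `MI2'` is indeed the largest subspace of `𝓜` that satisfies the two inclusions. -/
theorem isGreatest_MI2' : IsGreatest {N | MICond N} MI2' := by
  refine ⟨?_, fun N hN => le_sSup hN⟩
  have hle : MI2' ≤ MMtot := sSup_le fun N hN => hN.1
  have key : ∀ F ∈ MI2', del F ∈ MI2' ⊔ eisCusp ∧ delBar F ∈ MI2' ⊔ eisCuspBar := by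
    intro F hF
    have hF' : F ∈ ⨆ N : {N | MICond N}, (N : Submodule ℂ Bigraded) := by
      rwa [MI2', sSup_eq_iSup'] at hF
    have : F ∈ MI2' ∧ del F ∈ MI2' ⊔ eisCusp ∧ delBar F ∈ MI2' ⊔ eisCuspBar := by
      refine Submodule.iSup_induction _
        (motive := fun F => F ∈ MI2' ∧ del F ∈ MI2' ⊔ eisCusp ∧ delBar F ∈ MI2' ⊔ eisCuspBar)
        hF' ?_ ?_ ?_
      · intro N G hG
        have hN : (N : Submodule ℂ Bigraded) ≤ MI2' := le_sSup N.2
        exact ⟨hN hG, sup_le_sup_right hN _ (N.2.2.1 G hG), sup_le_sup_right hN _ (N.2.2.2 G hG)⟩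
      · refine ⟨MI2'.zero_mem, ?_, ?_⟩
        · simp [del]
        · simp [delBar]
      · rintro G H ⟨hG, hG1, hG2⟩ ⟨hH, hH1, hH2⟩
        refine ⟨MI2'.add_mem hG hH, ?_, ?_⟩
        · rw [del_add (hle hG) (hle hH)]
          exact Submodule.add_mem _ hG1 hH1
        · rw [delBar_add (hle hG) (hle hH)]
          exact Submodule.add_mem _ hG2 hH2
    exact this.2
  exact ⟨hle, fun F hF => (key F hF).1, fun F hF => (key F hF).2⟩

/-! ### Polynomial-valued functions and second-order iterated invariants

An element of `A ⊗ P_K`, where `A` is a space of functions on `ℍ` and `P_K` is the space of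
polynomials in `X` of degree at most `K`, is a function `ℍ → ℂ[X]`. -/

/-- `A ⊗ P_K`. -/
def tensorPoly (A : Submodule ℂ (ℍ → ℂ)) (K : ℕ) : Submodule ℂ (ℍ → ℂ[X]) where
  carrier := {F | (∀ z, F z ∈ degreeLE ℂ K) ∧ ∀ n : ℕ, (fun z => (F z).coeff n) ∈ A}
  zero_mem' := ⟨fun _ => Submodule.zero_mem _, fun n => by
    simp only [Pi.zero_apply, coeff_zero]; exact A.zero_mem⟩
  add_mem' := fun hF hG => ⟨fun z => Submodule.add_mem _ (hF.1 z) (hG.1 z), fun n => by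
    simp only [Pi.add_apply, coeff_add]; exact A.add_mem (hF.2 n) (hG.2 n)⟩
  smul_mem' := fun c F hF => ⟨fun z => Submodule.smul_mem _ c (hF.1 z), fun n => by
    simp only [Pi.smul_apply, coeff_smul]; exact A.smul_mem c (hF.2 n)⟩

/-- The action on polynomials of degree at most `K`: `P ↦ P(γ X) j(γ, X)^K`. -/
def polyAct (K : ℕ) (γ : SL(2, ℤ)) (P : ℂ[X]) : ℂ[X] :=
  ∑ n ∈ Finset.range (K + 1), C (P.coeff n) * (C (γ 0 0 : ℂ) * X + C (γ 0 1 : ℂ)) ^ n *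
    (C (γ 1 0 : ℂ) * X + C (γ 1 1 : ℂ)) ^ (K - n)

theorem polyAct_add (K : ℕ) (γ : SL(2, ℤ)) (P Q : ℂ[X]) :
    polyAct K γ (P + Q) = polyAct K γ P + polyAct K γ Q := by
  simp only [polyAct, coeff_add, C_add, add_mul, Finset.sum_add_distrib]

theorem polyAct_smul (K : ℕ) (γ : SL(2, ℤ)) (c : ℂ) (P : ℂ[X]) :
    polyAct K γ (c • P) = c • polyAct K γ P := by
  simp only [polyAct, coeff_smul, smul_eq_mul, C_mul, mul_assoc]
  rw [← Finset.mul_sum, smul_eq_C_mul]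

/-- The action
`(F |_{r,s,-K} γ)(z, X) = F(γ z, γ X) j(γ, z)^{-r} j(γ, z̄)^{-s} j(γ, X)^K`. -/
def slashPoly (r s : ℤ) (K : ℕ) (γ : SL(2, ℤ)) : (ℍ → ℂ[X]) →ₗ[ℂ] (ℍ → ℂ[X]) where
  toFun F := fun z => C (wt r s γ z) * polyAct K γ (F (γ • z))
  map_add' F G := by
    ext1 z
    simp only [Pi.add_apply, polyAct_add, mul_add]
  map_smul' c F := by
    ext1 z
    simp only [Pi.smul_apply, polyAct_smul, RingHom.id_apply, mul_smul_comm]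

/-- `M^{(2)}(𝓡)`: the `F ∈ 𝓡 ⊗ P_K` with `F.(γ - 1) ∈ H⁰(Γ, 𝓡) ⊗ P_K` for all `γ ∈ Γ`. -/
def M2 (r s : ℤ) (K : ℕ) : Submodule ℂ (ℍ → ℂ[X]) :=
  tensorPoly RR K ⊓
    ⨅ γ : SL(2, ℤ), (tensorPoly (invRR r s) K).comap (slashPoly r s K γ - LinearMap.id)

/-- `M_c^{(2)}(𝓡)`: the `F ∈ M^{(2)}(𝓡)` that are invariant under the parabolic subgroup `B`
attached to the cusp `i∞`. -/
def Mc2 (r s : ℤ) (K : ℕ) : Submodule ℂ (ℍ → ℂ[X]) :=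
  M2 r s K ⊓ ⨅ β ∈ B, LinearMap.ker (slashPoly r s K β - LinearMap.id)

/-! ### Eichler integrals and the families `ψ`, `φ` -/

/-- The sign `±` of the two families. -/
inductive Sgn
  | plus
  | minus

/-- The identity for the sign `+`, complex conjugation of the coefficients for the sign `-`. -/
def Sgn.act : Sgn → ℂ[X] → ℂ[X]
  | .plus, P => P
  | .minus, P => P.map (starRingEnd ℂ)

/-- `∫_{i∞}^z h(w) (w - X)^K dw`, coefficient by coefficient, along the vertical half-line
`w = z + i t`, `t ≥ 0`. -/
def eichler {k : ℤ} (K : ℕ) (h : CuspForm 𝒮ℒ k) (z : ℍ) : ℂ[X] :=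
  ∑ n ∈ Finset.range (K + 1), monomial n (-∫ t : ℝ in Set.Ioi 0,
    h (ofComplex ((z : ℂ) + Complex.I * t)) *
      ((C ((z : ℂ) + Complex.I * t) - X : ℂ[X]) ^ K).coeff n * Complex.I)

/-- `r_h(γ; X) = ∫_{γ⁻¹ i∞}^{i∞} h(w) (w - X)^K dw`, coefficient by coefficient: it is `0` if `γ`
fixes `i∞`, and otherwise the path is the vertical half-line above `γ⁻¹ i∞ = -d / c`. -/
def period {k : ℤ} (K : ℕ) (h : CuspForm 𝒮ℒ k) (γ : SL(2, ℤ)) : ℂ[X] :=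
  if γ 1 0 = 0 then 0 else
    ∑ n ∈ Finset.range (K + 1), monomial n (∫ t : ℝ in Set.Ioi 0,
      h (ofComplex (-(γ 1 1 : ℂ) / (γ 1 0 : ℂ) + Complex.I * t)) *
        ((C (-(γ 1 1 : ℂ) / (γ 1 0 : ℂ) + Complex.I * t) - X : ℂ[X]) ^ K).coeff n * Complex.I)

/-- `F^±_h(z, X)`. -/
def eichlerPM {k : ℤ} (K : ℕ) (ε : Sgn) (h : CuspForm 𝒮ℒ k) (z : ℍ) : ℂ[X] :=
  ε.act (eichler K h z)

/-- The term `r^±_h(γ; X) j(γ, z)^{-r} j(γ, z̄)^{-s}` of the series `ψ^±_{h;r,s}`. -/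
def psiTerm {k : ℤ} (r s : ℤ) (K : ℕ) (ε : Sgn) (h : CuspForm 𝒮ℒ k) (z : ℍ) (γ : SL(2, ℤ)) :
    ℂ[X] :=
  C (wt r s γ z) * ε.act (period K h γ)

/-- `ψ^±_{h;r,s}(z, X) = ∑_{γ ∈ B \ Γ} r^±_h(γ; X) j(γ, z)^{-r} j(γ, z̄)^{-s}`. -/
def psi {k : ℤ} (r s : ℤ) (K : ℕ) (ε : Sgn) (h : CuspForm 𝒮ℒ k) : ℍ → ℂ[X] :=
  fun z => cosetSumPoly K (psiTerm r s K ε h z)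

/-- The term `F^±_h |_{r,s,-K} γ` of the series `φ^±_{r,s}(h)`. -/
def phiTerm {k : ℤ} (r s : ℤ) (K : ℕ) (ε : Sgn) (h : CuspForm 𝒮ℒ k) (z : ℍ) (γ : SL(2, ℤ)) :
    ℂ[X] :=
  slashPoly r s K γ (eichlerPM K ε h) z

/-- `φ^±_{r,s}(h; z, X) = ∑_{γ ∈ B \ Γ} (F^±_h |_{r,s,-K} γ)(z, X)`. -/
def phi {k : ℤ} (r s : ℤ) (K : ℕ) (ε : Sgn) (h : CuspForm 𝒮ℒ k) : ℍ → ℂ[X] :=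
  fun z => cosetSumPoly K (phiTerm r s K ε h z)

/-- The space generated by the family `ψ^±_{h;r,s}`, where `h` runs through `S_k`. -/
def psiSpan (k : ℤ) (r s : ℤ) (K : ℕ) : Submodule ℂ (ℍ → ℂ[X]) :=
  Submodule.span ℂ (Set.range fun p : Sgn × CuspForm 𝒮ℒ k => psi r s K p.1 p.2)

theorem psi_mem_psiSpan {k : ℤ} (r s : ℤ) (K : ℕ) (ε : Sgn) (h : CuspForm 𝒮ℒ k) :
    psi r s K ε h ∈ psiSpan k r s K :=
  Submodule.subset_span ⟨(ε, h), rfl⟩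

/-! ### Expansion in the basis `(X - z)^i (X - z̄)^{K-i}` of `P_K` -/

/-- The polynomial `∑_n p_n (z - z̄ U)^n (1 - U)^{K-n}` in `U`, for `P = ∑_n p_n X^n`. -/
def biPoly (K : ℕ) (P : ℂ[X]) (z : ℍ) : ℂ[X] :=
  ∑ n ∈ Finset.range (K + 1), C (P.coeff n) * (C (z : ℂ) - C (conj (z : ℂ)) * X) ^ n *
    (1 - X) ^ (K - n)

/-- The coefficient of `(X - z)^i (X - z̄)^{K-i}` in the polynomial `P` of degree at most `K`;
see `biCoeff_expansion`. -/
def biCoeff (K : ℕ) (P : ℂ[X]) (i : ℕ) (z : ℍ) : ℂ :=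
  (biPoly K P z).coeff i / ((z : ℂ) - conj (z : ℂ)) ^ K

theorem sub_conj_ne_zero (z : ℍ) : (z : ℂ) - conj (z : ℂ) ≠ 0 := by
  intro h
  have := congrArg Complex.im h
  simp at this
  have := z.im_pos
  linarith [show (z : ℂ).im = z.im from rfl]

theorem natDegree_biPoly_le (K : ℕ) (P : ℂ[X]) (z : ℍ) : (biPoly K P z).natDegree ≤ K := by
  refine natDegree_sum_le_of_forall_le _ _ fun n hn => ?_
  have hn' : n ≤ K := Nat.lt_succ_iff.mp (Finset.mem_range.mp hn)
  have h1 : ((C (z : ℂ) - C (conj (z : ℂ)) * X : ℂ[X]) ^ n).natDegree ≤ n := by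
    refine (natDegree_pow_le_of_le n (m := 1) ?_).trans (by simp)
    compute_degree
  have h2 : ((1 - X : ℂ[X]) ^ (K - n)).natDegree ≤ K - n := by
    refine (natDegree_pow_le_of_le (K - n) (m := 1) ?_).trans (by simp)
    compute_degree
  calc _ ≤ (0 + n) + (K - n) := by
        refine natDegree_mul_le_of_le (natDegree_mul_le_of_le ?_ h1) h2
        simp
    _ = K := by omega

theorem biCoeff_expansion (K : ℕ) (P : ℂ[X]) (hP : P.natDegree ≤ K) (z : ℍ) :
    P = ∑ i ∈ Finset.range (K + 1), C (biCoeff K P i z) * (X - C (z : ℂ)) ^ i *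
      (X - C (conj (z : ℂ))) ^ (K - i) := by
  have hz := sub_conj_ne_zero z
  refine eq_of_infinite_eval_eq _ _ (Set.Infinite.mono (s := {x | x ≠ conj (z : ℂ)}) ?_ ?_)
  · intro x hx
    have hx' : x - conj (z : ℂ) ≠ 0 := sub_ne_zero.mpr hx
    set w : ℂ := conj (z : ℂ) with hw
    have e1 : (biPoly K P z).eval ((x - z) / (x - w)) * (x - w) ^ K =
        P.eval x * ((z : ℂ) - w) ^ K := by
      rw [eval_eq_sum_range' (Nat.lt_succ_of_le hP), biPoly, eval_finsetSum, Finset.sum_mul,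
        Finset.sum_mul]
      refine Finset.sum_congr rfl fun n hn => ?_
      have hn' : n ≤ K := Nat.lt_succ_iff.mp (Finset.mem_range.mp hn)
      have hK : K = n + (K - n) := by omega
      have a1 : ((z : ℂ) - w * ((x - z) / (x - w))) * (x - w) = x * ((z : ℂ) - w) := by
        field_simp
        ring
      have a2 : (1 - (x - z) / (x - w)) * (x - w) = (z : ℂ) - w := by
        field_simp
        ring
      simp only [eval_mul, eval_C, eval_pow, eval_sub, eval_X, eval_one]
      rw [← hw]
      calc P.coeff n * ((z : ℂ) - w * ((x - z) / (x - w))) ^ n *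
            (1 - (x - z) / (x - w)) ^ (K - n) * (x - w) ^ K
          = P.coeff n * (((z : ℂ) - w * ((x - z) / (x - w))) * (x - w)) ^ n *
            ((1 - (x - z) / (x - w)) * (x - w)) ^ (K - n) := by
            conv_lhs => rw [hK, pow_add]
            simp only [Nat.add_sub_cancel_left]
            rw [mul_pow, mul_pow]
            ring
        _ = P.coeff n * x ^ n * ((z : ℂ) - w) ^ K := by
            rw [a1, a2, mul_pow]
            conv_rhs => rw [hK, pow_add]
            ring
    have e2 : (biPoly K P z).eval ((x - z) / (x - w)) * (x - w) ^ K =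
        ∑ i ∈ Finset.range (K + 1), (biPoly K P z).coeff i * (x - z) ^ i * (x - w) ^ (K - i) := by
      rw [eval_eq_sum_range' (Nat.lt_succ_of_le (natDegree_biPoly_le K P z)), Finset.sum_mul]
      refine Finset.sum_congr rfl fun n hn => ?_
      have hn' : n ≤ K := Nat.lt_succ_iff.mp (Finset.mem_range.mp hn)
      have hK : K = n + (K - n) := by omega
      have hsplit : (x - w) ^ K = (x - w) ^ n * (x - w) ^ (K - n) := by
        rw [← pow_add, ← hK]
      rw [div_pow, hsplit]
      field_simp
    show P.eval x = _
    rw [eval_finsetSum]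
    simp only [eval_mul, eval_C, eval_pow, eval_sub, eval_X, biCoeff]
    have e3 := e1.symm.trans e2
    rw [← mul_left_inj' (pow_ne_zero K hz), e3, Finset.sum_mul]
    refine Finset.sum_congr rfl fun n _ => ?_
    rw [← hw]
    have := pow_ne_zero K hz
    field_simp
  · exact (Set.finite_singleton (conj (z : ℂ))).infinite_compl

end RAIter

end

/-! Let K = k₁ - 2. The target space is controlled by maximality: `MI2'` contains every subspace of
𝓜 that ∂ and ∂̄ map into itself. Let `QA` be the algebra of finite sums of y^j g₁(q)
\overline{g₂(q)} with g₁, g₂ holomorphic on the unit disc. Its elements have the required growth and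
expansions, it is closed under ∂/∂z and ∂/∂z̄, and the Maass operators carry invariant functions to
invariant functions of shifted weights. The invariant elements of `QA` thus form such a subspace
(`mICond_QAFormsTot`), and it suffices that the adapted coefficients of φ are invariant and lie in
`QA`.

Convergence and expansions come from unfolding. The cosets other than B have lower rows (c, d + nc)
with 0 ≤ d < c and d prime to c. The sum over n is a sum of (z + d/c + n)^{-α} (z̄ + d/c + n)^{-β};
Lipschitz' formula, the cotangent series and partial fractions based on z - z̄ = 2iy express it
through y^j g(q) and y^j \overline{g(q)} (`latSum_mem_QL`). The sum over (c, d) then only averages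
over rotations of q (`average_mem_QL`). The period polynomial at (c, d + nc) is a polynomial in X +
d/c + n whose coefficients depend on (c, d) alone and are O(c^{K+1})
(`exists_bound_moment_cuspLine`). With c residues d for each c, convergence needs r + s ≥ K + 4,
which is r + s > k₁ by parity. In the basis (X - z)^i (X - z̄)^{K-i} the powers of X + d/c + n
become powers of z + d/c + n and of its conjugate, which merely shift α and β.

The cocycle relation `polyAct_eichler` says that F_h changes under γ by the period polynomial
r_h(γ). Summed over cosets it gives φ = ψ + F𝓔. The series φ is invariant by reindexing, so ψ|γ - ψ
= -𝓔 r_h(γ): this has coefficients in H⁰ and vanishes for γ in B.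

The linear map is well defined because of Eichler–Shimura injectivity. A linear relation among the ψ
gives, through γ - 1 and a point where 𝓔 ≠ 0, the same relation among the period polynomials; hence
the corresponding combination of Eichler integrals, which is F_h^+ + F_{h'}^- for some h and h', is
Γ-invariant. If p is its coefficient of (X - z)^K, then y^K |p|² is invariant and tends to 0 at the
cusp, so it has a maximum unless p = 0. But its ∂²/∂z∂z̄ is a sum of squares, positive where p ≠ 0
(`dz_dzbar_topNorm`). So p = 0 when K > 0, and therefore h = h' = 0
(`eq_zero_of_eichlerPair_invariant`); for K = 0 there are no cusp forms. The combination of the F is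
then 0, and the relation passes from ψ to φ = ψ + F𝓔. -/

noncomputable section

namespace RAIter

/-! ### Wirtinger derivatives -/

/-- `f` is real differentiable at `z`, with Wirtinger derivatives `a = ∂f/∂z`, `b = ∂f/∂z̄`. -/
def HasWirtinger (f : ℂ → ℂ) (a b z : ℂ) : Prop :=
  HasFDerivAt f (a • ContinuousLinearMap.id ℝ ℂ + b • (Complex.conjCLE : ℂ →L[ℝ] ℂ)) z

namespace HasWirtinger

variable {f g : ℂ → ℂ} {a b c d z : ℂ}

theorem congr_coeff (h : HasWirtinger f a b z) (ha : a = c) (hb : b = d) :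
    HasWirtinger f c d z := by
  subst ha hb; exact h

theorem congr_of_eventuallyEq (h : HasWirtinger f a b z) (hg : g =ᶠ[nhds z] f) :
    HasWirtinger g a b z :=
  HasFDerivAt.congr_of_eventuallyEq h hg

theorem const (w z : ℂ) : HasWirtinger (fun _ => w) 0 0 z :=
  (hasFDerivAt_const (𝕜 := ℝ) w z).congr_fderiv (by ext w; simp)

theorem id (z : ℂ) : HasWirtinger (fun w => w) 1 0 z :=
  (hasFDerivAt_id (𝕜 := ℝ) z).congr_fderiv (by ext w; simp)

theorem add (hf : HasWirtinger f a b z) (hg : HasWirtinger g c d z) :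
    HasWirtinger (fun w => f w + g w) (a + c) (b + d) z := by
  refine (HasFDerivAt.add hf hg).congr_fderiv ?_
  ext w
  simp [add_mul]
  ring

theorem mul (hf : HasWirtinger f a b z) (hg : HasWirtinger g c d z) :
    HasWirtinger (fun w => f w * g w) (a * g z + f z * c) (b * g z + f z * d) z := by
  refine (HasFDerivAt.mul hf hg).congr_fderiv ?_
  ext w
  simp [add_mul]
  ring

theorem conjugate (hf : HasWirtinger f a b z) :
    HasWirtinger (fun w => (starRingEnd ℂ) (f w)) ((starRingEnd ℂ) b) ((starRingEnd ℂ) a) z := by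
  have h : HasFDerivAt (fun w => (starRingEnd ℂ) w) (Complex.conjCLE : ℂ →L[ℝ] ℂ) (f z) :=
    (Complex.conjCLE : ℂ →L[ℝ] ℂ).hasFDerivAt
  refine (HasFDerivAt.comp z h hf).congr_fderiv ?_
  ext w
  simp [add_comm]

theorem comp_hasDerivAt {p : ℂ → ℂ} {p' : ℂ} (hp : HasDerivAt p p' (f z))
    (hf : HasWirtinger f a b z) : HasWirtinger (fun w => p (f w)) (p' * a) (p' * b) z := by
  have h : HasFDerivAt p _ (f z) := hp.hasFDerivAt.restrictScalars ℝ
  refine (HasFDerivAt.comp z h hf).congr_fderiv ?_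
  ext w
  simp
  ring

theorem of_hasDerivAt {p' : ℂ} (hf : HasDerivAt f p' z) : HasWirtinger f p' 0 z := by
  simpa using comp_hasDerivAt (f := fun w => w) hf (HasWirtinger.id z)

theorem comp {w : ℂ → ℂ} {u v : ℂ} (hf : HasWirtinger f a b (w z)) (hw : HasWirtinger w u v z) :
    HasWirtinger (fun x => f (w x)) (a * u + b * (starRingEnd ℂ) v)
      (a * v + b * (starRingEnd ℂ) u) z := by
  refine (HasFDerivAt.comp z hf hw).congr_fderiv ?_
  ext w
  simp
  ring

theorem fderiv_one (h : HasWirtinger f a b z) : fderiv ℝ f z 1 = a + b := by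
  rw [HasFDerivAt.fderiv h]; simp

theorem fderiv_I (h : HasWirtinger f a b z) :
    fderiv ℝ f z Complex.I = Complex.I * (a - b) := by
  rw [HasFDerivAt.fderiv h]; simp; ring

/-- The values of the differential at 1 and i give a + b and i(a - b). The transformation laws below
come from comparing two computations of one derivative. -/
theorem unique (h : HasWirtinger f a b z) (h' : HasWirtinger f c d z) : a = c ∧ b = d := by
  have h1 : a + b = c + d := by rw [← h.fderiv_one, ← h'.fderiv_one]
  have h2 : a - b = c - d := by
    have := h.fderiv_I.symm.trans h'.fderiv_I
    exact mul_left_cancel₀ Complex.I_ne_zero this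
  constructor
  · linear_combination (h1 + h2) / 2
  · linear_combination (h1 - h2) / 2

theorem im (z : ℂ) :
    HasWirtinger (fun w => (w.im : ℂ)) (1 / (2 * Complex.I)) (-1 / (2 * Complex.I)) z := by
  have h : (fun w : ℂ => (w.im : ℂ)) = fun w => (w + (-1) * (starRingEnd ℂ) w) *
      (1 / (2 * Complex.I)) := by
    ext w
    have := Complex.sub_conj w
    push_cast at this
    field_simp
    linear_combination -this
  rw [h]
  refine (((HasWirtinger.id z).add ((const (-1) z).mul (HasWirtinger.id z).conjugate)).mul
    (const _ z)).congr_coeff ?_ ?_ <;> simp [neg_div]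

end HasWirtinger

theorem HasWirtinger.dz_eq {f : ℍ → ℂ} {a b : ℂ} {z : ℍ}
    (h : HasWirtinger (fun w => f (ofComplex w)) a b z) : dz f z = a := by
  rw [dz, h.fderiv_one, h.fderiv_I]
  linear_combination (-1 / 2 : ℂ) * (a - b) * Complex.I_mul_I

theorem HasWirtinger.dzbar_eq {f : ℍ → ℂ} {a b : ℂ} {z : ℍ}
    (h : HasWirtinger (fun w => f (ofComplex w)) a b z) : dzbar f z = b := by
  rw [dzbar, h.fderiv_one, h.fderiv_I]
  linear_combination (1 / 2 : ℂ) * (a - b) * Complex.I_mul_I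

/-- Every real linear map ℂ → ℂ is a combination of the identity and conjugation. -/
theorem hasWirtinger_of_differentiableAt {f : ℍ → ℂ} {z : ℍ}
    (h : DifferentiableAt ℝ (fun w : ℂ => f (ofComplex w)) z) :
    HasWirtinger (fun w => f (ofComplex w)) (dz f z) (dzbar f z) z := by
  refine h.hasFDerivAt.congr_fderiv ?_
  ext w
  have hw : w = w.re • (1 : ℂ) + w.im • Complex.I := by simp
  set D := fderiv ℝ (fun w : ℂ => f (ofComplex w)) z with hD
  have h1 : D w = w.re * D 1 + w.im * D Complex.I := by
    conv_lhs => rw [hw]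
    rw [map_add, map_smul, map_smul, Complex.real_smul, Complex.real_smul]
  have h2 : w = w.re + w.im * Complex.I := (Complex.re_add_im w).symm
  have h3 : (starRingEnd ℂ) w = w.re - w.im * Complex.I := by
    apply Complex.ext <;> simp
  simp only [dz, dzbar, ← hD, add_apply, smul_apply, smul_eq_mul, ContinuousLinearMap.id_apply,
    ContinuousLinearEquiv.coe_coe, Complex.conjCLE_apply, h3, h1]
  linear_combination (-(1 / 2 : ℂ) * (D 1 - Complex.I * D Complex.I)) * h2 +
    (w.im * D Complex.I) * Complex.I_mul_I

/-! ### The algebra generated by `y`, `y⁻¹`, power series in `q` and power series in `q̄` -/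

/-- Holomorphic functions on the open unit disc. -/
abbrev DiscHol (g : ℂ → ℂ) : Prop := DifferentiableOn ℂ g (Metric.ball 0 1)

theorem DiscHol.differentiableAt {g : ℂ → ℂ} (hg : DiscHol g) {q : ℂ} (hq : ‖q‖ < 1) :
    DifferentiableAt ℂ g q :=
  DifferentiableOn.differentiableAt hg (Metric.isOpen_ball.mem_nhds (by simpa using hq))

theorem DiscHol.deriv {g : ℂ → ℂ} (hg : DiscHol g) : DiscHol (deriv g) :=
  DifferentiableOn.deriv hg Metric.isOpen_ball

theorem norm_qpar (z : ℍ) : ‖qpar z‖ = Real.exp (-2 * Real.pi * z.im) := by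
  rw [qpar, Complex.norm_exp]
  congr 1
  simp

theorem norm_qpar_lt_one (z : ℍ) : ‖qpar z‖ < 1 := by
  rw [norm_qpar, Real.exp_lt_one_iff]
  have := mul_pos Real.pi_pos z.im_pos
  linarith

theorem im_ne_zero' (z : ℍ) : (z.im : ℂ) ≠ 0 := by
  exact_mod_cast z.im_pos.ne'

/-- The function `y^j g₁(q) \overline{g₂(q)}`. -/
def qTerm (j : ℤ) (g₁ g₂ : ℂ → ℂ) : ℍ → ℂ :=
  fun z => (z.im : ℂ) ^ j * g₁ (qpar z) * conj (g₂ (qpar z))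

/-- The span of the functions `y^j g₁(q) \overline{g₂(q)}`. -/
def qSpan : Submodule ℂ (ℍ → ℂ) :=
  Submodule.span ℂ {f | ∃ (j : ℤ) (g₁ g₂ : ℂ → ℂ), DiscHol g₁ ∧ DiscHol g₂ ∧ f = qTerm j g₁ g₂}

theorem qTerm_mem_qSpan {j : ℤ} {g₁ g₂ : ℂ → ℂ} (h₁ : DiscHol g₁) (h₂ : DiscHol g₂) :
    qTerm j g₁ g₂ ∈ qSpan :=
  Submodule.subset_span ⟨j, g₁, g₂, h₁, h₂, rfl⟩

theorem qSpan_mul_mem {f g : ℍ → ℂ} (hf : f ∈ qSpan) (hg : g ∈ qSpan) : f * g ∈ qSpan := by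
  refine Submodule.span_induction₂ (p := fun f g _ _ => f * g ∈ qSpan) ?_ ?_ ?_ ?_ ?_ ?_ ?_ hf hg
  · rintro _ _ ⟨j, g₁, g₂, h₁, h₂, rfl⟩ ⟨j', g₁', g₂', h₁', h₂', rfl⟩
    have : qTerm j g₁ g₂ * qTerm j' g₁' g₂' = qTerm (j + j') (g₁ * g₁') (g₂ * g₂') := by
      ext z
      simp only [qTerm, Pi.mul_apply, map_mul, zpow_add₀ (im_ne_zero' z)]
      ring
    rw [this]
    exact qTerm_mem_qSpan (DifferentiableOn.mul h₁ h₁') (DifferentiableOn.mul h₂ h₂')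
  · intro y _; rw [zero_mul]; exact qSpan.zero_mem
  · intro y _; rw [mul_zero]; exact qSpan.zero_mem
  · intro x y z _ _ _ h h'; rw [add_mul]; exact qSpan.add_mem h h'
  · intro x y z _ _ _ h h'; rw [mul_add]; exact qSpan.add_mem h h'
  · intro c x y _ _ h; rw [smul_mul_assoc]; exact qSpan.smul_mem c h
  · intro c x y _ _ h; rw [mul_smul_comm]; exact qSpan.smul_mem c h

/-- The algebra of functions on `ℍ` generated by `y`, `y⁻¹` and the (convergent) power series in
`q` and in `q̄`. -/
def QA : Subalgebra ℂ (ℍ → ℂ) :=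
  qSpan.toSubalgebra
    (by
      have : (1 : ℍ → ℂ) = qTerm 0 1 1 := by ext z; simp [qTerm]
      rw [this]
      exact qTerm_mem_qSpan (differentiableOn_const 1) (differentiableOn_const 1))
    fun _ _ => qSpan_mul_mem

theorem qTerm_mem_QA {j : ℤ} {g₁ g₂ : ℂ → ℂ} (h₁ : DiscHol g₁) (h₂ : DiscHol g₂) :
    qTerm j g₁ g₂ ∈ QA :=
  qTerm_mem_qSpan h₁ h₂

theorem const_mem_QA (c : ℂ) : (fun _ : ℍ => c) ∈ QA := QA.algebraMap_mem c

theorem im_zpow_mem_QA (j : ℤ) : (fun z : ℍ => (z.im : ℂ) ^ j) ∈ QA := by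
  have : (fun z : ℍ => (z.im : ℂ) ^ j) = qTerm j 1 1 := by ext z; simp [qTerm]
  rw [this]
  exact qTerm_mem_QA (differentiableOn_const 1) (differentiableOn_const 1)

theorem im_mem_QA : (fun z : ℍ => (z.im : ℂ)) ∈ QA := by
  simpa using im_zpow_mem_QA 1

theorem comp_qpar_mem_QA {g : ℂ → ℂ} (hg : DiscHol g) : (fun z => g (qpar z)) ∈ QA := by
  have : (fun z : ℍ => g (qpar z)) = qTerm 0 g 1 := by ext z; simp [qTerm]
  rw [this]
  exact qTerm_mem_QA hg (differentiableOn_const 1)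

theorem conj_comp_qpar_mem_QA {g : ℂ → ℂ} (hg : DiscHol g) :
    (fun z => conj (g (qpar z))) ∈ QA := by
  have : (fun z : ℍ => conj (g (qpar z))) = qTerm 0 1 g := by ext z; simp [qTerm]
  rw [this]
  exact qTerm_mem_QA (differentiableOn_const 1) hg

theorem sum_mem_QA {ι : Type*} (t : Finset ι) {f : ι → ℍ → ℂ} (h : ∀ i ∈ t, f i ∈ QA) :
    (fun z => ∑ i ∈ t, f i z) ∈ QA := by
  have : (fun z => ∑ i ∈ t, f i z) = ∑ i ∈ t, f i := by ext z; simp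
  rw [this]
  exact QA.sum_mem h

/-! ### Regularity, growth and derivatives -/

theorem eventually_ofComplex (z : ℍ) :
    ∀ᶠ w : ℂ in nhds (z : ℂ), ((ofComplex w : ℍ) : ℂ) = w := by
  filter_upwards [isOpen_upperHalfPlaneSet.mem_nhds z.im_pos] with w hw
  exact ofComplex_apply_of_im_pos hw ▸ rfl

theorem qTerm_ofComplex_eventuallyEq (j : ℤ) (g₁ g₂ : ℂ → ℂ) (z : ℍ) :
    (fun w : ℂ => qTerm j g₁ g₂ (ofComplex w)) =ᶠ[nhds (z : ℂ)] fun w : ℂ => (w.im : ℂ) ^ j *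
      g₁ (Complex.exp (2 * Real.pi * Complex.I * w)) *
      conj (g₂ (Complex.exp (2 * Real.pi * Complex.I * w))) := by
  filter_upwards [eventually_ofComplex z] with w hw
  simp only [qTerm, qpar, ← coe_im, hw]

theorem isRealAnalytic_of_analyticAt {f : ℍ → ℂ}
    (h : ∀ z : ℍ, AnalyticAt ℝ (fun w : ℂ => f (ofComplex w)) z) : IsRealAnalytic f :=
  fun w hw => h ⟨w, hw⟩

theorem analyticAt_im (z : ℂ) : AnalyticAt ℝ (fun w : ℂ => (w.im : ℂ)) z :=
  (Complex.ofRealCLM.comp Complex.imCLM).analyticAt z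

theorem analyticAt_conj {f : ℂ → ℂ} {z : ℂ} (h : AnalyticAt ℝ f z) :
    AnalyticAt ℝ (fun w => conj (f w)) z :=
  ((Complex.conjCLE : ℂ →L[ℝ] ℂ).analyticAt (f z)).comp h

theorem isRealAnalytic_qTerm {j : ℤ} {g₁ g₂ : ℂ → ℂ} (h₁ : DiscHol g₁) (h₂ : DiscHol g₂) :
    IsRealAnalytic (qTerm j g₁ g₂) := by
  refine isRealAnalytic_of_analyticAt fun z => ?_
  refine AnalyticAt.congr ?_ (qTerm_ofComplex_eventuallyEq j g₁ g₂ z).symm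
  have key : ∀ g : ℂ → ℂ, DiscHol g →
      AnalyticAt ℝ (fun w : ℂ => g (Complex.exp (2 * Real.pi * Complex.I * w))) z := by
    intro g hg
    have h : AnalyticAt ℂ g (Complex.exp (2 * Real.pi * Complex.I * z)) :=
      DifferentiableOn.analyticAt hg
        (Metric.isOpen_ball.mem_nhds (by simpa using! norm_qpar_lt_one z))
    have h2 : AnalyticAt ℂ (fun w : ℂ => Complex.exp (2 * Real.pi * Complex.I * w)) z := by
      fun_prop
    exact (h.comp_of_eq h2 rfl).restrictScalars
  exact (((analyticAt_im z).zpow (im_ne_zero' z)).mul (key g₁ h₁)).mul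
    (analyticAt_conj (key g₂ h₂))

theorem DiscHol.exists_bound {g : ℂ → ℂ} (hg : DiscHol g) {ρ : ℝ} (hρ : ρ < 1) :
    ∃ M : ℝ, 0 ≤ M ∧ ∀ q : ℂ, ‖q‖ ≤ ρ → ‖g q‖ ≤ M := by
  obtain ⟨M, hM⟩ := (isCompact_closedBall (0 : ℂ) ρ).exists_bound_of_continuousOn
    (f := g) (hg.continuousOn.mono (Metric.closedBall_subset_ball hρ))
  exact ⟨max M 0, le_max_right _ _, fun q hq => (hM q (by simpa using hq)).trans (le_max_left _ _)⟩

theorem norm_qpar_le_of_one_le {z : ℍ} {c : ℝ} (hz : c ≤ z.im) :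
    ‖qpar z‖ ≤ Real.exp (-2 * Real.pi * c) := by
  rw [norm_qpar, Real.exp_le_exp]
  nlinarith [Real.pi_pos]

theorem exp_neg_two_pi_mul_lt_one {c : ℝ} (hc : 0 < c) : Real.exp (-2 * Real.pi * c) < 1 := by
  rw [Real.exp_lt_one_iff]
  have := mul_pos Real.pi_pos hc
  linarith

theorem polyGrowth_qTerm {j : ℤ} {g₁ g₂ : ℂ → ℂ} (h₁ : DiscHol g₁) (h₂ : DiscHol g₂) :
    PolyGrowth (qTerm j g₁ g₂) := by
  have hρ := exp_neg_two_pi_mul_lt_one one_pos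
  obtain ⟨M₁, hM₁, hb₁⟩ := h₁.exists_bound hρ
  obtain ⟨M₂, hM₂, hb₂⟩ := h₂.exists_bound hρ
  refine ⟨|(j : ℝ)| + 1, by positivity, fun b => ⟨1, M₁ * M₂, fun z _ hz => ?_⟩⟩
  have hq := norm_qpar_le_of_one_le hz
  have e : z.im ^ j ≤ z.im ^ (|(j : ℝ)| + 1) := by
    rw [← Real.rpow_intCast]
    exact Real.rpow_le_rpow_of_exponent_le hz (by linarith [le_abs_self (j : ℝ)])
  have e0 : 0 ≤ z.im ^ j := zpow_nonneg z.im_pos.le _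
  rw [qTerm, norm_mul, norm_mul, norm_zpow, Complex.norm_real, Real.norm_of_nonneg z.im_pos.le,
    RCLike.norm_conj]
  calc z.im ^ j * ‖g₁ (qpar z)‖ * ‖g₂ (qpar z)‖ ≤ z.im ^ (|(j : ℝ)| + 1) * M₁ * M₂ := by
        gcongr
        · exact hb₁ _ hq
        · exact hb₂ _ hq
    _ = _ := by ring

theorem hasFE_qTerm {j : ℤ} {g₁ g₂ : ℂ → ℂ} (h₁ : DiscHol g₁) (h₂ : DiscHol g₂) :
    HasFE (qTerm j g₁ g₂) := by
  have key : ∀ g : ℂ → ℂ, DiscHol g → ∃ t : ℕ → ℂ, ∀ z : ℍ,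
      HasSum (fun n => t n * qpar z ^ n) (g (qpar z)) := by
    intro g hg
    refine ⟨fun n => (n.factorial : ℂ)⁻¹ * iteratedDeriv n g 0, fun z => ?_⟩
    have := Complex.hasSum_taylorSeries_on_ball hg
      (z := qpar z) (by simpa using norm_qpar_lt_one z)
    refine this.congr_fun ?_
    intro n
    simp only [sub_zero, smul_eq_mul]
    ring
  obtain ⟨t₁, ht₁⟩ := key g₁ h₁
  obtain ⟨t₂, ht₂⟩ := key g₂ h₂
  have hprod : ∀ z : ℍ, HasSum (fun p : ℕ × ℕ => t₁ p.1 * conj (t₂ p.2) * qpar z ^ p.1 *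
      conj (qpar z) ^ p.2) (g₁ (qpar z) * conj (g₂ (qpar z))) := by
    intro z
    have e₂ : HasSum (fun n => conj (t₂ n) * conj (qpar z) ^ n) (conj (g₂ (qpar z))) := by
      have := (Complex.conjCLE : ℂ →L[ℝ] ℂ).hasSum (ht₂ z)
      simpa using this
    have s := summable_mul_of_summable_norm (ht₁ z).summable.norm e₂.summable.norm
    have := (ht₁ z).mul e₂ s
    refine this.congr_fun ?_
    intro p
    ring
  classical
  -- Only the exponent j carries coefficients, and |j| is the least bound that admits it.
  refine ⟨j.natAbs, fun i p => if i = j then t₁ p.1 * conj (t₂ p.2) else 0, fun z => ⟨?_, ?_⟩⟩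
  · intro i _
    by_cases hi : i = j
    · simpa only [if_pos hi] using (hprod z).summable
    · simp only [if_neg hi, zero_mul]
      exact summable_zero
  · rw [Finset.sum_eq_single j]
    · simp only [if_true, (hprod z).tsum_eq, qTerm]
      ring
    · intro i _ hi
      simp [if_neg hi]
    · intro h
      exact absurd (Finset.mem_Icc.mpr ⟨by omega, by omega⟩) h

theorem HasFE.add {f g : ℍ → ℂ} (hf : HasFE f) (hg : HasFE g) : HasFE (f + g) := by
  obtain ⟨M, hM⟩ := hf.mono
  obtain ⟨M', hM'⟩ := hg.mono
  obtain ⟨a, ha⟩ := hM (max M M') (le_max_left _ _)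
  obtain ⟨b, hb⟩ := hM' (max M M') (le_max_right _ _)
  refine ⟨max M M', a + b, fun z => ⟨fun j hj => ?_, ?_⟩⟩
  · simpa only [Pi.add_apply, add_mul] using ((ha z).1 j hj).add ((hb z).1 j hj)
  · rw [Pi.add_apply, (ha z).2, (hb z).2, ← Finset.sum_add_distrib]
    refine Finset.sum_congr rfl fun j hj => ?_
    rw [← mul_add, ← ((ha z).1 j hj).tsum_add ((hb z).1 j hj)]
    simp only [Pi.add_apply, add_mul]

theorem HasFE.smul {f : ℍ → ℂ} (c : ℂ) (hf : HasFE f) : HasFE (c • f) := by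
  obtain ⟨M, a, ha⟩ := hf
  refine ⟨M, c • a, fun z => ⟨fun j hj => ?_, ?_⟩⟩
  · simpa only [Pi.smul_apply, smul_eq_mul, mul_assoc] using ((ha z).1 j hj).mul_left c
  · rw [Pi.smul_apply, (ha z).2, Finset.smul_sum]
    refine Finset.sum_congr rfl fun j hj => ?_
    simp only [Pi.smul_apply, smul_eq_mul, mul_assoc, tsum_mul_left]
    ring

theorem QA_induction {p : (ℍ → ℂ) → Prop}
    (hgen : ∀ (j : ℤ) (g₁ g₂ : ℂ → ℂ), DiscHol g₁ → DiscHol g₂ → p (qTerm j g₁ g₂))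
    (hadd : ∀ f g, p f → p g → p (f + g)) (hsmul : ∀ (c : ℂ) f, p f → p (c • f))
    {f : ℍ → ℂ} (hf : f ∈ QA) : p f := by
  refine Submodule.span_induction (p := fun f _ => p f) ?_ ?_ (fun f g _ _ => hadd f g)
    (fun c f _ => hsmul c f) hf
  · rintro _ ⟨j, g₁, g₂, h₁, h₂, rfl⟩
    exact hgen j g₁ g₂ h₁ h₂
  · have := hsmul 0 _ (hgen 0 1 1 (differentiableOn_const 1) (differentiableOn_const 1))
    rwa [zero_smul] at this

theorem hasFE_of_mem_QA {f : ℍ → ℂ} (hf : f ∈ QA) : HasFE f :=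
  QA_induction (fun _ _ _ => hasFE_qTerm) (fun _ _ => HasFE.add) (fun c _ => HasFE.smul c) hf

theorem mem_RR_of_mem_QA {f : ℍ → ℂ} (hf : f ∈ QA) : f ∈ RR :=
  QA_induction (p := fun f => f ∈ RR)
    (fun _ _ _ h₁ h₂ => ⟨isRealAnalytic_qTerm h₁ h₂, polyGrowth_qTerm h₁ h₂⟩)
    (fun _ _ => RR.add_mem) (fun c _ => RR.smul_mem c) hf

theorem hasWirtinger_of_mem_RR {f : ℍ → ℂ} (hf : f ∈ RR) (z : ℍ) :
    HasWirtinger (fun w => f (ofComplex w)) (dz f z) (dzbar f z) z :=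
  hasWirtinger_of_differentiableAt (hf.1.differentiableAt z)

theorem hasDerivAt_exp_two_pi_I (w : ℂ) :
    HasDerivAt (fun w => Complex.exp (2 * Real.pi * Complex.I * w))
      (2 * Real.pi * Complex.I * Complex.exp (2 * Real.pi * Complex.I * w)) w := by
  have h := ((hasDerivAt_id w).const_mul (2 * Real.pi * Complex.I)).cexp
  refine h.congr_deriv ?_
  simp
  ring

theorem hasDerivAt_comp_qpar {g : ℂ → ℂ} (hg : DiscHol g) (z : ℍ) :
    HasDerivAt (fun w : ℂ => g (Complex.exp (2 * Real.pi * Complex.I * w)))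
      (deriv g (qpar z) * (2 * Real.pi * Complex.I * qpar z)) z := by
  have h := (hg.differentiableAt (norm_qpar_lt_one z)).hasDerivAt
  exact HasDerivAt.comp (z : ℂ) h (hasDerivAt_exp_two_pi_I (z : ℂ))

/-- The factor y^j contributes an exponent j - 1, and each function of q is acted on by the Euler
operator q d/dq. Both operations stay among the generators, which is why `QA` is closed under the
two derivatives. -/
theorem hasWirtinger_qTerm {j : ℤ} {g₁ g₂ : ℂ → ℂ} (h₁ : DiscHol g₁) (h₂ : DiscHol g₂) (z : ℍ) :
    HasWirtinger (fun w => qTerm j g₁ g₂ (ofComplex w))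
      (j / (2 * Complex.I) * qTerm (j - 1) g₁ g₂ z +
        2 * Real.pi * Complex.I * qTerm j (fun q => q * deriv g₁ q) g₂ z)
      (-j / (2 * Complex.I) * qTerm (j - 1) g₁ g₂ z -
        2 * Real.pi * Complex.I * qTerm j g₁ (fun q => q * deriv g₂ q) z) z := by
  have hy : HasWirtinger (fun w : ℂ => (w.im : ℂ) ^ j) _ _ z :=
    HasWirtinger.comp_hasDerivAt (p := fun x => x ^ j)
      (hasDerivAt_zpow j ((z : ℂ).im : ℂ) (Or.inl (im_ne_zero' z))) (HasWirtinger.im z)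
  have H := (hy.mul (HasWirtinger.of_hasDerivAt (hasDerivAt_comp_qpar h₁ z))).mul
    (HasWirtinger.of_hasDerivAt (hasDerivAt_comp_qpar h₂ z)).conjugate
  refine (H.congr_of_eventuallyEq (qTerm_ofComplex_eventuallyEq j g₁ g₂ z)).congr_coeff
    ?_ ?_
  · simp only [qTerm, qpar, map_zero, coe_im]
    ring
  · simp only [qTerm, qpar, map_mul, Complex.conj_I, Complex.conj_ofReal, map_ofNat, coe_im]
    ring

theorem dz_add {f g : ℍ → ℂ} (hf : f ∈ RR) (hg : g ∈ RR) :
    dz (f + g) = dz f + dz g ∧ dzbar (f + g) = dzbar f + dzbar g := by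
  have h := fun z : ℍ => (hasWirtinger_of_mem_RR hf z).add (hasWirtinger_of_mem_RR hg z)
  exact ⟨funext fun z => (h z).dz_eq (f := f + g), funext fun z => (h z).dzbar_eq (f := f + g)⟩

theorem dz_smul (c : ℂ) {f : ℍ → ℂ} (hf : f ∈ RR) :
    dz (c • f) = c • dz f ∧ dzbar (c • f) = c • dzbar f := by
  have h := fun z : ℍ => (HasWirtinger.const c (z : ℂ)).mul (hasWirtinger_of_mem_RR hf z)
  exact ⟨funext fun z => ((h z).dz_eq (f := c • f)).trans (by simp),
    funext fun z => ((h z).dzbar_eq (f := c • f)).trans (by simp)⟩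

theorem DiscHol.euler {g : ℂ → ℂ} (hg : DiscHol g) : DiscHol fun q => q * _root_.deriv g q :=
  DifferentiableOn.mul differentiableOn_id hg.deriv

theorem dz_qTerm {j : ℤ} {g₁ g₂ : ℂ → ℂ} (h₁ : DiscHol g₁) (h₂ : DiscHol g₂) :
    dz (qTerm j g₁ g₂) = ((j : ℂ) / (2 * Complex.I)) • qTerm (j - 1) g₁ g₂ +
        (2 * Real.pi * Complex.I) • qTerm j (fun q => q * deriv g₁ q) g₂ ∧
      dzbar (qTerm j g₁ g₂) = (-(j : ℂ) / (2 * Complex.I)) • qTerm (j - 1) g₁ g₂ +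
        (-(2 * Real.pi * Complex.I)) • qTerm j g₁ (fun q => q * deriv g₂ q) := by
  refine ⟨funext fun z => (hasWirtinger_qTerm h₁ h₂ z).dz_eq, funext fun z => ?_⟩
  refine (hasWirtinger_qTerm h₁ h₂ z).dzbar_eq.trans ?_
  simp only [Pi.add_apply, Pi.smul_apply, smul_eq_mul]
  ring

theorem dz_mem_QA_and {f : ℍ → ℂ} (hf : f ∈ QA) : dz f ∈ QA ∧ dzbar f ∈ QA := by
  -- Membership in `RR` is carried along because additivity of the derivatives requires
  -- differentiability of the summands.
  have key : f ∈ RR ∧ dz f ∈ QA ∧ dzbar f ∈ QA := by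
    refine QA_induction (p := fun f => f ∈ RR ∧ dz f ∈ QA ∧ dzbar f ∈ QA) ?_ ?_ ?_ hf
    · intro j g₁ g₂ h₁ h₂
      refine ⟨mem_RR_of_mem_QA (qTerm_mem_QA h₁ h₂), ?_, ?_⟩
      · rw [(dz_qTerm h₁ h₂).1]
        exact QA.add_mem (QA.smul_mem (qTerm_mem_QA h₁ h₂) _)
          (QA.smul_mem (qTerm_mem_QA h₁.euler h₂) _)
      · rw [(dz_qTerm h₁ h₂).2]
        exact QA.add_mem (QA.smul_mem (qTerm_mem_QA h₁ h₂) _)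
          (QA.smul_mem (qTerm_mem_QA h₁ h₂.euler) _)
    · rintro f g ⟨hf, hf1, hf2⟩ ⟨hg, hg1, hg2⟩
      refine ⟨RR.add_mem hf hg, ?_, ?_⟩
      · rw [(dz_add hf hg).1]; exact QA.add_mem hf1 hg1
      · rw [(dz_add hf hg).2]; exact QA.add_mem hf2 hg2
    · rintro c f ⟨hf, hf1, hf2⟩
      refine ⟨RR.smul_mem c hf, ?_, ?_⟩
      · rw [(dz_smul c hf).1]; exact QA.smul_mem hf1 c
      · rw [(dz_smul c hf).2]; exact QA.smul_mem hf2 c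
  exact key.2

/-- On generators both derivatives are explicit, and the two orders give the same combination of
four terms; linearity does the rest. -/
theorem dz_dzbar_comm {f : ℍ → ℂ} (hf : f ∈ QA) : dz (dzbar f) = dzbar (dz f) := by
  have key : f ∈ QA ∧ dz (dzbar f) = dzbar (dz f) := by
    refine QA_induction (p := fun f => f ∈ QA ∧ dz (dzbar f) = dzbar (dz f)) ?_ ?_ ?_ hf
    · intro j g₁ g₂ h₁ h₂
      refine ⟨qTerm_mem_QA h₁ h₂, ?_⟩
      have m : ∀ {i : ℤ} {f₁ f₂ : ℂ → ℂ}, DiscHol f₁ → DiscHol f₂ → qTerm i f₁ f₂ ∈ RR :=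
        fun h h' => mem_RR_of_mem_QA (qTerm_mem_QA h h')
      rw [(dz_qTerm h₁ h₂).1, (dz_qTerm h₁ h₂).2,
        (dz_add (RR.smul_mem _ (m h₁ h₂)) (RR.smul_mem _ (m h₁ h₂.euler))).1,
        (dz_add (RR.smul_mem _ (m h₁ h₂)) (RR.smul_mem _ (m h₁.euler h₂))).2,
        (dz_smul _ (m h₁ h₂)).1, (dz_smul _ (m h₁ h₂.euler)).1, (dz_smul _ (m h₁ h₂)).2,
        (dz_smul _ (m h₁.euler h₂)).2, (dz_qTerm h₁ h₂).1, (dz_qTerm h₁ h₂.euler).1,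
        (dz_qTerm h₁ h₂).2, (dz_qTerm h₁.euler h₂).2]
      module
    · rintro f g ⟨hf, hf1⟩ ⟨hg, hg1⟩
      have a := dz_mem_QA_and hf
      have b := dz_mem_QA_and hg
      refine ⟨QA.add_mem hf hg, ?_⟩
      rw [(dz_add (mem_RR_of_mem_QA hf) (mem_RR_of_mem_QA hg)).1,
        (dz_add (mem_RR_of_mem_QA hf) (mem_RR_of_mem_QA hg)).2,
        (dz_add (mem_RR_of_mem_QA a.2) (mem_RR_of_mem_QA b.2)).1,
        (dz_add (mem_RR_of_mem_QA a.1) (mem_RR_of_mem_QA b.1)).2, hf1, hg1]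
    · rintro c f ⟨hf, hf1⟩
      have a := dz_mem_QA_and hf
      refine ⟨QA.smul_mem hf c, ?_⟩
      rw [(dz_smul c (mem_RR_of_mem_QA hf)).1, (dz_smul c (mem_RR_of_mem_QA hf)).2,
        (dz_smul c (mem_RR_of_mem_QA a.2)).1, (dz_smul c (mem_RR_of_mem_QA a.1)).2, hf1]
  exact key.2

/-! ### Automorphy factors -/

theorem det_eq_one (γ : SL(2, ℤ)) :
    (γ 0 0 : ℂ) * (γ 1 1 : ℂ) - (γ 0 1 : ℂ) * (γ 1 0 : ℂ) = 1 := by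
  have := γ.det_coe
  rw [Matrix.det_fin_two] at this
  exact_mod_cast this

theorem jfac_conj (γ : SL(2, ℤ)) (w : ℂ) : jfac γ (conj w) = conj (jfac γ w) := by
  simp [jfac]

theorem jfac_ne_zero (γ : SL(2, ℤ)) (z : ℍ) : jfac γ z ≠ 0 := by
  intro h
  have him := congrArg Complex.im h
  have hre := congrArg Complex.re h
  simp only [jfac, Complex.add_im, Complex.mul_im, Complex.intCast_re, Complex.intCast_im,
    Complex.zero_im, zero_mul, add_zero, coe_im] at him
  have hc : γ 1 0 = 0 := by
    have := (mul_eq_zero.mp him).resolve_right z.im_pos.ne'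
    exact_mod_cast this
  have hd : γ 1 1 = 0 := by
    simp only [jfac, hc, Int.cast_zero, zero_mul, zero_add, Complex.intCast_re,
      Complex.zero_re] at hre
    exact_mod_cast hre
  have := det_eq_one γ
  simp [hc, hd] at this

theorem jfac_conj_ne_zero (γ : SL(2, ℤ)) (z : ℍ) : jfac γ (conj (z : ℂ)) ≠ 0 := by
  rw [jfac_conj]
  exact (_root_.map_ne_zero _).mpr (jfac_ne_zero γ z)

theorem coe_smul_eq (γ : SL(2, ℤ)) (z : ℍ) :
    ((γ • z : ℍ) : ℂ) = ((γ 0 0 : ℂ) * z + (γ 0 1 : ℂ)) / jfac γ z := by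
  rw [UpperHalfPlane.specialLinearGroup_apply]
  simp [jfac]

theorem coe_smul_mul_jfac (γ : SL(2, ℤ)) (z : ℍ) :
    ((γ • z : ℍ) : ℂ) * jfac γ z = (γ 0 0 : ℂ) * z + (γ 0 1 : ℂ) := by
  rw [coe_smul_eq, div_mul_cancel₀ _ (jfac_ne_zero γ z)]

theorem jfac_mul (γ' γ : SL(2, ℤ)) (z : ℍ) :
    jfac (γ' * γ) z = jfac γ' (γ • z : ℍ) * jfac γ z := by
  have h := coe_smul_mul_jfac γ z
  have e : jfac γ' (γ • z : ℍ) * jfac γ z =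
      (γ' 1 0 : ℂ) * (((γ • z : ℍ) : ℂ) * jfac γ z) + (γ' 1 1 : ℂ) * jfac γ z := by
    simp only [jfac]; ring
  rw [e, h]
  simp only [jfac, Matrix.SpecialLinearGroup.coe_mul, Matrix.mul_apply, Fin.sum_univ_two]
  push_cast
  ring

theorem wt_mul (r s : ℤ) (γ' γ : SL(2, ℤ)) (z : ℍ) :
    wt r s (γ' * γ) z = wt r s γ' (γ • z) * wt r s γ z := by
  simp only [wt, jfac_conj, jfac_mul, map_mul, mul_zpow]
  ring

theorem wt_one (r s : ℤ) (z : ℍ) : wt r s 1 z = 1 := by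
  simp [wt, jfac]

theorem sub_conj_eq (z : ℍ) : (z : ℂ) - conj (z : ℂ) = 2 * Complex.I * z.im := by
  rw [Complex.sub_conj, coe_im]
  push_cast
  ring

theorem coe_im_smul (γ : SL(2, ℤ)) (z : ℍ) :
    ((γ • z : ℍ).im : ℂ) = z.im / (jfac γ z * jfac γ (conj (z : ℂ))) := by
  have h := sub_conj_eq (γ • z)
  have hz := sub_conj_eq z
  have hj := jfac_ne_zero γ z
  have hj' := jfac_conj_ne_zero γ z
  have hdet := det_eq_one γ
  rw [coe_smul_eq, map_div₀, ← jfac_conj, div_sub_div _ _ hj hj'] at h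
  have e : 2 * Complex.I * ((γ • z : ℍ).im : ℂ) =
      2 * Complex.I * (z.im / (jfac γ z * jfac γ (conj (z : ℂ)))) := by
    rw [← h, mul_div_assoc', ← hz]
    congr 1
    simp only [map_add, map_mul, map_intCast, jfac]
    linear_combination ((z : ℂ) - conj (z : ℂ)) * hdet
  exact mul_left_cancel₀ (by simp) e

/-- This identity absorbs the non-automorphic term that differentiation of the weight factor
produces in the Maass operators. -/
theorem jfac_sub_jfac_conj (γ : SL(2, ℤ)) (z : ℍ) :
    jfac γ z - jfac γ (conj (z : ℂ)) = 2 * Complex.I * z.im * (γ 1 0 : ℂ) := by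
  have := sub_conj_eq z
  simp only [jfac]
  linear_combination (γ 1 0 : ℂ) * this

/-- The identity (γz - γX) j(γ,z) j(γ,X) = z - X, in a form without division by j(γ,X). -/
theorem smul_sub_eq (γ : SL(2, ℤ)) (z : ℍ) (X : ℂ) :
    (((γ • z : ℍ) : ℂ) * jfac γ X - ((γ 0 0 : ℂ) * X + (γ 0 1 : ℂ))) * jfac γ z = z - X := by
  have h := coe_smul_mul_jfac γ z
  have hdet := det_eq_one γ
  simp only [jfac] at *
  linear_combination ((γ 1 0 : ℂ) * X + (γ 1 1 : ℂ)) * h + ((z : ℂ) - X) * hdet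

theorem hasDerivAt_jfac (γ : SL(2, ℤ)) (w : ℂ) : HasDerivAt (jfac γ) (γ 1 0 : ℂ) w :=
  (((hasDerivAt_id w).const_mul (γ 1 0 : ℂ)).add_const (γ 1 1 : ℂ)).congr_deriv (mul_one _)

theorem hasDerivAt_moebius (γ : SL(2, ℤ)) (z : ℍ) :
    HasDerivAt (fun w : ℂ => ((γ 0 0 : ℂ) * w + (γ 0 1 : ℂ)) / jfac γ w)
      (jfac γ z ^ (-2 : ℤ)) z := by
  have hj := jfac_ne_zero γ z
  have h1 : HasDerivAt (fun w : ℂ => (γ 0 0 : ℂ) * w + (γ 0 1 : ℂ)) (γ 0 0 : ℂ) z := by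
    exact (((hasDerivAt_id (z : ℂ)).const_mul (γ 0 0 : ℂ)).add_const (γ 0 1 : ℂ)).congr_deriv
      (mul_one _)
  refine (h1.div (hasDerivAt_jfac γ z) hj).congr_deriv ?_
  have hdet := det_eq_one γ
  rw [zpow_neg, zpow_ofNat, div_eq_iff (pow_ne_zero 2 hj), inv_mul_cancel₀ (pow_ne_zero 2 hj)]
  simp only [jfac]
  linear_combination hdet

theorem eventually_coe_smul_ofComplex (γ : SL(2, ℤ)) (z : ℍ) :
    ∀ᶠ w : ℂ in nhds (z : ℂ), ((γ • (ofComplex w) : ℍ) : ℂ) =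
      ((γ 0 0 : ℂ) * w + (γ 0 1 : ℂ)) / jfac γ w := by
  filter_upwards [eventually_ofComplex z] with w hw
  rw [coe_smul_eq, hw]

/-! ### Equivariance of the Maass operators -/

theorem slashRS_eq_iff {r s : ℤ} {γ : SL(2, ℤ)} {f : ℍ → ℂ} :
    slashRS r s γ f = f ↔
      ∀ z : ℍ, f (γ • z) = jfac γ z ^ r * conj (jfac γ z) ^ s * f z := by
  have hj := jfac_ne_zero γ
  have hj' := jfac_conj_ne_zero γ
  constructor
  · intro h z
    rw [← jfac_conj]
    conv_rhs => rw [← h]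
    simp only [slashRS, wt, zpow_neg]
    have h1 := zpow_ne_zero r (hj z)
    have h2 := zpow_ne_zero s (hj' z)
    field_simp
  · intro h
    ext z
    simp only [slashRS, wt, zpow_neg, h z, jfac_conj]
    have h1 := zpow_ne_zero r (hj z)
    have h2 := zpow_ne_zero s (hj' z)
    rw [jfac_conj] at h2
    field_simp

/-- The functional equation f(γz) = j^r j̄^s f(z) is differentiated on both sides. On the left the
Möbius map is holomorphic with derivative j^{-2}, so the two Wirtinger derivatives do not mix. -/
theorem dz_dzbar_smul {r s : ℤ} {γ : SL(2, ℤ)} {f : ℍ → ℂ} (hf : f ∈ RR)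
    (h : slashRS r s γ f = f) (z : ℍ) :
    dz f (γ • z) * jfac γ z ^ (-2 : ℤ) = r * jfac γ z ^ (r - 1) * (γ 1 0 : ℂ) *
        conj (jfac γ z) ^ s * f z + jfac γ z ^ r * conj (jfac γ z) ^ s * dz f z ∧
    dzbar f (γ • z) * conj (jfac γ z) ^ (-2 : ℤ) = jfac γ z ^ r *
        (s * conj (jfac γ z) ^ (s - 1) * (γ 1 0 : ℂ)) * f z +
        jfac γ z ^ r * conj (jfac γ z) ^ s * dzbar f z := by
  have h' := slashRS_eq_iff.mp h
  have hj := jfac_ne_zero γ z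
  have hj' := (_root_.map_ne_zero (starRingEnd ℂ)).mpr hj
  set M : ℂ → ℂ := fun w => ((γ 0 0 : ℂ) * w + (γ 0 1 : ℂ)) / jfac γ w with hM
  have hMz : M z = ((γ • z : ℍ) : ℂ) := (coe_smul_eq γ z).symm
  have h1 : HasWirtinger (fun w => f (ofComplex (M w)))
      (dz f (γ • z) * jfac γ z ^ (-2 : ℤ) + dzbar f (γ • z) * conj 0)
      (dz f (γ • z) * 0 + dzbar f (γ • z) * conj (jfac γ z ^ (-2 : ℤ))) z := by
    refine HasWirtinger.comp (w := M) (f := fun w => f (ofComplex w)) (a := dz f (γ • z))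
      (b := dzbar f (γ • z)) ?_ (HasWirtinger.of_hasDerivAt (hasDerivAt_moebius γ z))
    rw [hMz]
    exact hasWirtinger_of_mem_RR hf (γ • z)
  have hjW := HasWirtinger.of_hasDerivAt (hasDerivAt_jfac γ (z : ℂ))
  have h2 := ((HasWirtinger.comp_hasDerivAt (p := fun x => x ^ r)
    (hasDerivAt_zpow r (jfac γ z) (Or.inl hj)) hjW).mul
    (HasWirtinger.comp_hasDerivAt (p := fun x => x ^ s)
    (hasDerivAt_zpow s (conj (jfac γ z)) (Or.inl hj')) hjW.conjugate)).mul
    (hasWirtinger_of_mem_RR hf z)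
  have heq : (fun w => f (ofComplex (M w))) =ᶠ[nhds (z : ℂ)]
      fun w => jfac γ w ^ r * conj (jfac γ w) ^ s * f (ofComplex w) := by
    filter_upwards [eventually_ofComplex z, eventually_coe_smul_ofComplex γ z] with w hw hw'
    have : ofComplex (M w) = γ • ofComplex w := by
      have e : M w = ((γ • ofComplex w : ℍ) : ℂ) := hw'.symm
      rw [e, ofComplex_apply]
    rw [this, h', hw]
  obtain ⟨e1, e2⟩ := h1.unique (h2.congr_of_eventuallyEq heq)
  constructor
  · simpa using e1
  · simpa [map_zpow₀] using e2

/-- Beyond the expected term, 2iy ∂f/∂z picks up r f times j^r j̄^{s-1} · 2iyc at γz. Together with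
the summand r f this makes r f j^r j̄^{s-1} (2iyc + j̄), and 2iyc + j̄ = j. -/
theorem maass_slash {r s : ℤ} {γ : SL(2, ℤ)} {f : ℍ → ℂ} (hf : f ∈ RR)
    (h : slashRS r s γ f = f) : slashRS (r + 1) (s - 1) γ (maass r f) = maass r f := by
  refine slashRS_eq_iff.mpr fun z => ?_
  have h1 := (dz_dzbar_smul hf h z).1
  have h2 := slashRS_eq_iff.mp h z
  have hj := jfac_ne_zero γ z
  have hj' := (_root_.map_ne_zero (starRingEnd ℂ)).mpr hj
  have h3 := jfac_sub_jfac_conj γ z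
  rw [jfac_conj] at h3
  simp only [maass, h2, coe_im_smul, jfac_conj]
  set J := jfac γ z
  set J' := conj J
  have e1 : dz f (γ • z) = J ^ 2 * (r * J ^ (r - 1) * (γ 1 0 : ℂ) *
        J' ^ s * f z + J ^ r * J' ^ s * dz f z) := by
    rw [← h1, zpow_neg, zpow_ofNat]
    field_simp
  rw [e1, zpow_add_one₀ hj, zpow_sub_one₀ hj, zpow_sub_one₀ hj']
  have hr := zpow_ne_zero r hj
  have hs := zpow_ne_zero s hj'
  field_simp
  linear_combination (-(r : ℂ) * f z) * h3

theorem maassBar_slash {r s : ℤ} {γ : SL(2, ℤ)} {f : ℍ → ℂ} (hf : f ∈ RR)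
    (h : slashRS r s γ f = f) : slashRS (r - 1) (s + 1) γ (maassBar s f) = maassBar s f := by
  refine slashRS_eq_iff.mpr fun z => ?_
  have h1 := (dz_dzbar_smul hf h z).2
  have h2 := slashRS_eq_iff.mp h z
  have hj := jfac_ne_zero γ z
  have hj' := (_root_.map_ne_zero (starRingEnd ℂ)).mpr hj
  have h3 := jfac_sub_jfac_conj γ z
  rw [jfac_conj] at h3
  simp only [maassBar, h2, coe_im_smul, jfac_conj]
  set J := jfac γ z
  set J' := conj J
  have e1 : dzbar f (γ • z) = J' ^ 2 * (J ^ r * (s * J' ^ (s - 1) * (γ 1 0 : ℂ)) * f z +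
      J ^ r * J' ^ s * dzbar f z) := by
    rw [← h1, zpow_neg, zpow_ofNat]
    field_simp
  rw [e1, zpow_add_one₀ hj', zpow_sub_one₀ hj, zpow_sub_one₀ hj']
  have hr := zpow_ne_zero r hj
  have hs := zpow_ne_zero s hj'
  field_simp
  linear_combination ((s : ℂ) * f z) * h3

/-! ### A subspace of `𝓜` stable under `∂` and `∂̄` -/

/-- The modular forms in the algebra `QA`. -/
def QAForms (r s : ℤ) : Submodule ℂ (ℍ → ℂ) := QA.toSubmodule ⊓ invRR r s

theorem QAForms_le_MM (r s : ℤ) : QAForms r s ≤ MM r s :=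
  fun _ hf => ⟨hf.2, hasFE_of_mem_QA hf.1⟩

theorem maass_mem_QAForms {r s : ℤ} {f : ℍ → ℂ} (hf : f ∈ QAForms r s) :
    maass r f ∈ QAForms (r + 1) (s - 1) := by
  have hQ : maass r f ∈ QA := by
    have : maass r f = ((2 * Complex.I) • fun z : ℍ => (z.im : ℂ)) * dz f + (r : ℂ) • f := by
      ext z; simp [maass, mul_assoc]
    rw [this]
    exact QA.add_mem (QA.mul_mem (QA.smul_mem im_mem_QA _) (dz_mem_QA_and hf.1).1)
      (QA.smul_mem hf.1 _)
  exact ⟨hQ, mem_RR_of_mem_QA hQ, fun γ => maass_slash hf.2.1 (hf.2.2 γ)⟩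

theorem maassBar_mem_QAForms {r s : ℤ} {f : ℍ → ℂ} (hf : f ∈ QAForms r s) :
    maassBar s f ∈ QAForms (r - 1) (s + 1) := by
  have hQ : maassBar s f ∈ QA := by
    have : maassBar s f = ((-2 * Complex.I) • fun z : ℍ => (z.im : ℂ)) * dzbar f +
        (s : ℂ) • f := by
      ext z; simp [maassBar, mul_assoc]
    rw [this]
    exact QA.add_mem (QA.mul_mem (QA.smul_mem im_mem_QA _) (dz_mem_QA_and hf.1).2)
      (QA.smul_mem hf.1 _)
  exact ⟨hQ, mem_RR_of_mem_QA hQ, fun γ => maassBar_slash hf.2.1 (hf.2.2 γ)⟩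

/-- The bigraded families of modular forms in the algebra `QA`. -/
def QAFormsTot : Submodule ℂ Bigraded where
  carrier := {F | ∀ p : ℤ × ℤ, F p ∈ QAForms p.1 p.2}
  zero_mem' := fun p => (QAForms p.1 p.2).zero_mem
  add_mem' := fun hF hG p => (QAForms p.1 p.2).add_mem (hF p) (hG p)
  smul_mem' := fun c _ hF p => (QAForms p.1 p.2).smul_mem c (hF p)

/-- The subspace is stable under ∂ and ∂̄ on the nose, so the Eisenstein–cusp summands allowed in
the two inclusions are not called upon. -/
theorem mICond_QAFormsTot : MICond QAFormsTot := by
  refine ⟨fun F hF p => QAForms_le_MM _ _ (hF p), fun F hF => ?_, fun F hF => ?_⟩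
  · refine Submodule.mem_sup_left fun p => ?_
    rw [del_apply]
    simpa using maass_mem_QAForms (hF (p.1 - 1, p.2 + 1))
  · refine Submodule.mem_sup_left fun p => ?_
    rw [delBar_apply]
    simpa using maassBar_mem_QAForms (hF (p.1 + 1, p.2 - 1))

theorem single_mem_MI2' {r s : ℤ} {f : ℍ → ℂ} (hf : f ∈ QAForms r s) :
    (Finsupp.single (r, s) f : Bigraded) ∈ MI2' := by
  classical
  refine isGreatest_MI2'.2 mICond_QAFormsTot fun p => ?_
  rw [Finsupp.single_apply]
  split_ifs with h
  · subst h; exact hf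
  · exact (QAForms p.1 p.2).zero_mem

/-! ### Averages over translates -/

/-- The span of the functions `y^j g(q)` and `y^j \overline{g(q)}`. -/
def QL : Submodule ℂ (ℍ → ℂ) :=
  Submodule.span ℂ {f | ∃ (j : ℤ) (g : ℂ → ℂ), DiscHol g ∧ (f = qTerm j g 1 ∨ f = qTerm j 1 g)}

theorem discHol_one : DiscHol 1 := differentiableOn_const 1

theorem QL_le_QA {f : ℍ → ℂ} (hf : f ∈ QL) : f ∈ QA := by
  refine (Submodule.span_le (p := QA.toSubmodule)).mpr ?_ hf
  rintro _ ⟨j, g, hg, rfl | rfl⟩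
  · exact qTerm_mem_QA hg discHol_one
  · exact qTerm_mem_QA discHol_one hg

theorem qTerm_left_mem_QL {j : ℤ} {g : ℂ → ℂ} (hg : DiscHol g) : qTerm j g 1 ∈ QL :=
  Submodule.subset_span ⟨j, g, hg, Or.inl rfl⟩

theorem qTerm_right_mem_QL {j : ℤ} {g : ℂ → ℂ} (hg : DiscHol g) : qTerm j 1 g ∈ QL :=
  Submodule.subset_span ⟨j, g, hg, Or.inr rfl⟩

theorem QL_induction {p : (ℍ → ℂ) → Prop}
    (hl : ∀ (j : ℤ) (g : ℂ → ℂ), DiscHol g → p (qTerm j g 1))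
    (hr : ∀ (j : ℤ) (g : ℂ → ℂ), DiscHol g → p (qTerm j 1 g))
    (hadd : ∀ f g, p f → p g → p (f + g)) (hsmul : ∀ (c : ℂ) f, p f → p (c • f))
    {f : ℍ → ℂ} (hf : f ∈ QL) : p f := by
  refine Submodule.span_induction (p := fun f _ => p f) ?_ ?_ (fun f g _ _ => hadd f g)
    (fun c f _ => hsmul c f) hf
  · rintro _ ⟨j, g, hg, rfl | rfl⟩
    · exact hl j g hg
    · exact hr j g hg
  · have := hsmul 0 _ (hl 0 1 discHol_one)
    rwa [zero_smul] at this

theorem im_zpow_mul_mem_QL (k : ℤ) {f : ℍ → ℂ} (hf : f ∈ QL) :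
    (fun z => (z.im : ℂ) ^ k * f z) ∈ QL := by
  refine QL_induction (p := fun f => (fun z => (z.im : ℂ) ^ k * f z) ∈ QL) ?_ ?_ ?_ ?_ hf
  · intro j g hg
    have : (fun z => (z.im : ℂ) ^ k * qTerm j g 1 z) = qTerm (k + j) g 1 := by
      ext z; simp only [qTerm, zpow_add₀ (im_ne_zero' z)]; ring
    rw [this]; exact qTerm_left_mem_QL hg
  · intro j g hg
    have : (fun z => (z.im : ℂ) ^ k * qTerm j 1 g z) = qTerm (k + j) 1 g := by
      ext z; simp only [qTerm, zpow_add₀ (im_ne_zero' z)]; ring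
    rw [this]; exact qTerm_right_mem_QL hg
  · intro f g hf hg
    have : (fun z => (z.im : ℂ) ^ k * (f + g) z) =
        (fun z => (z.im : ℂ) ^ k * f z) + fun z => (z.im : ℂ) ^ k * g z := by
      ext z; simp [mul_add]
    rw [this]; exact QL.add_mem hf hg
  · intro c f hf
    have : (fun z => (z.im : ℂ) ^ k * (c • f) z) = c • fun z => (z.im : ℂ) ^ k * f z := by
      ext z; simp only [Pi.smul_apply, smul_eq_mul]; ring
    rw [this]; exact QL.smul_mem c hf

theorem conj_mem_QL {f : ℍ → ℂ} (hf : f ∈ QL) : (fun z => conj (f z)) ∈ QL := by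
  refine QL_induction (p := fun f => (fun z => conj (f z)) ∈ QL) ?_ ?_ ?_ ?_ hf
  · intro j g hg
    have : (fun z => conj (qTerm j g 1 z)) = qTerm j 1 g := by
      ext z; simp [qTerm, map_zpow₀]
    rw [this]; exact qTerm_right_mem_QL hg
  · intro j g hg
    have : (fun z => conj (qTerm j 1 g z)) = qTerm j g 1 := by
      ext z; simp [qTerm, map_zpow₀]
    rw [this]; exact qTerm_left_mem_QL hg
  · intro f g hf hg
    have : (fun z => conj ((f + g) z)) = (fun z => conj (f z)) + fun z => conj (g z) := by
      ext z; simp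
    rw [this]; exact QL.add_mem hf hg
  · intro c f hf
    have : (fun z => conj ((c • f) z)) = (conj c) • fun z => conj (f z) := by
      ext z; simp
    rw [this]; exact QL.smul_mem _ hf

/-- The series below are dominated only on smaller discs; holomorphy is local, so this is enough. -/
theorem discHol_of_forall_lt {g : ℂ → ℂ}
    (h : ∀ ρ : ℝ, ρ < 1 → DifferentiableOn ℂ g (Metric.ball 0 ρ)) : DiscHol g := by
  intro q hq
  have hq' : ‖q‖ < 1 := by simpa using hq
  obtain ⟨ρ, h1, h2⟩ := exists_between hq'
  exact ((h ρ h2).differentiableAt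
    (Metric.isOpen_ball.mem_nhds (by simpa using h1))).differentiableWithinAt

theorem discHol_pow_mul_geometric (k : ℕ) :
    DiscHol fun q : ℂ => ∑' n : ℕ, (n : ℂ) ^ k * q ^ n := by
  refine discHol_of_forall_lt fun ρ hρ => ?_
  rcases le_or_gt ρ 0 with h0 | h0
  · rw [Metric.ball_eq_empty.mpr h0]; exact differentiableOn_empty
  refine Complex.differentiableOn_tsum_of_summable_norm
    (u := fun n : ℕ => (n : ℝ) ^ k * ρ ^ n)
    (summable_pow_mul_geometric_of_norm_lt_one k (by rwa [Real.norm_of_nonneg h0.le]))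
    (fun n => by fun_prop) Metric.isOpen_ball fun n w hw => ?_
  have hw' : ‖w‖ ≤ ρ := by simpa using (le_of_lt (by simpa using hw))
  rw [norm_mul, norm_pow, norm_pow, Complex.norm_natCast]
  gcongr

section average

variable {ι : Type*}

/-- A rotation preserves each smaller disc, so one bound for g serves all terms and the Weierstrass
test applies. -/
theorem discHol_average {ρ : ι → ℂ} (hρ : Summable fun i => ‖ρ i‖) {e : ι → ℂ}
    (he : ∀ i, ‖e i‖ = 1) {g : ℂ → ℂ} (hg : DiscHol g) :
    DiscHol fun q => ∑' i, ρ i * g (e i * q) := by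
  refine discHol_of_forall_lt fun r hr => ?_
  obtain ⟨M, hM0, hM⟩ := hg.exists_bound hr
  refine Complex.differentiableOn_tsum_of_summable_norm (u := fun i => ‖ρ i‖ * M)
    (hρ.mul_right M) (fun i => ?_) Metric.isOpen_ball fun i w hw => ?_
  · refine (differentiableOn_const _).mul (hg.comp (by fun_prop) fun w hw => ?_)
    have hw' : ‖w‖ < r := by simpa using hw
    simpa [he i] using hw'.trans hr
  · have hw' : ‖w‖ < r := by simpa using hw
    rw [norm_mul]
    gcongr
    exact hM _ (by rw [norm_mul, he i, one_mul]; exact hw'.le)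

theorem summable_average {ρ : ι → ℂ} (hρ : Summable fun i => ‖ρ i‖) {e : ι → ℂ}
    (he : ∀ i, ‖e i‖ = 1) {g : ℂ → ℂ} (hg : DiscHol g) {q : ℂ} (hq : ‖q‖ < 1) :
    Summable fun i => ρ i * g (e i * q) := by
  obtain ⟨M, hM0, hM⟩ := hg.exists_bound hq
  refine Summable.of_norm_bounded (hρ.mul_right M) fun i => ?_
  rw [norm_mul]
  gcongr
  exact hM _ (by rw [norm_mul, he i, one_mul])

theorem qpar_vadd (x : ℝ) (z : ℍ) :
    qpar (x +ᵥ z) = Complex.exp (2 * Real.pi * Complex.I * x) * qpar z := by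
  rw [qpar, qpar, coe_vadd, ← Complex.exp_add]
  congr 1
  ring

theorem norm_exp_two_pi_I_mul (x : ℝ) : ‖Complex.exp (2 * Real.pi * Complex.I * x)‖ = 1 := by
  rw [Complex.norm_exp]
  simp

/-- A real translation multiplies q by a phase and fixes y. A series of rotated functions g(q) is
again one function of q, and likewise for conjugates. A series of rotated products g₁(q)
\overline{g₂(q)} need not be a finite sum of products; this is the reason for working in `QL` rather
than in `QA`. -/
theorem average_mem_QL {ρ : ι → ℂ} (hρ : Summable fun i => ‖ρ i‖) (x : ι → ℝ) {f : ℍ → ℂ}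
    (hf : f ∈ QL) :
    (∀ z : ℍ, Summable fun i => ρ i * f (x i +ᵥ z)) ∧
      (fun z : ℍ => ∑' i, ρ i * f (x i +ᵥ z)) ∈ QL := by
  have he : ∀ i, ‖Complex.exp (2 * Real.pi * Complex.I * x i)‖ = 1 := fun i =>
    norm_exp_two_pi_I_mul (x i)
  have hρ' : Summable fun i => ‖conj (ρ i)‖ := by simpa only [RCLike.norm_conj] using hρ
  refine QL_induction (p := fun f => (∀ z : ℍ, Summable fun i => ρ i * f (x i +ᵥ z)) ∧
      (fun z : ℍ => ∑' i, ρ i * f (x i +ᵥ z)) ∈ QL) ?_ ?_ ?_ ?_ hf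
  · intro j g hg
    have e : ∀ (z : ℍ) (i : ι), ρ i * qTerm j g 1 (x i +ᵥ z) = (z.im : ℂ) ^ j *
        (ρ i * g (Complex.exp (2 * Real.pi * Complex.I * x i) * qpar z)) := by
      intro z i
      simp only [qTerm, vadd_im, qpar_vadd, Pi.one_apply, map_one]
      ring
    simp only [e]
    refine ⟨fun z => (summable_average hρ he hg (norm_qpar_lt_one z)).mul_left _, ?_⟩
    convert qTerm_left_mem_QL (j := j) (discHol_average hρ he hg) using 1
    ext z
    simp [qTerm, tsum_mul_left]
  · intro j g hg
    have e : ∀ (z : ℍ) (i : ι), ρ i * qTerm j 1 g (x i +ᵥ z) = (z.im : ℂ) ^ j *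
        conj (conj (ρ i) * g (Complex.exp (2 * Real.pi * Complex.I * x i) * qpar z)) := by
      intro z i
      simp only [qTerm, vadd_im, qpar_vadd, Pi.one_apply, map_mul, Complex.conj_conj]
      ring
    simp only [e]
    have hs := fun z => (summable_average hρ' he hg (norm_qpar_lt_one z))
    refine ⟨fun z => ((Complex.conjCLE : ℂ →L[ℝ] ℂ).summable (hs z)).mul_left _, ?_⟩
    convert qTerm_right_mem_QL (j := j) (discHol_average hρ' he hg) using 1
    ext z
    simp only [qTerm, tsum_mul_left, Pi.one_apply, mul_one, Complex.conj_tsum]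
  · rintro f g ⟨hf1, hf2⟩ ⟨hg1, hg2⟩
    simp only [Pi.add_apply, mul_add]
    refine ⟨fun z => (hf1 z).add (hg1 z), ?_⟩
    convert QL.add_mem hf2 hg2 using 1
    ext z
    exact (hf1 z).tsum_add (hg1 z)
  · rintro c f ⟨hf1, hf2⟩
    simp only [Pi.smul_apply, smul_eq_mul, mul_left_comm _ c]
    refine ⟨fun z => (hf1 z).mul_left c, ?_⟩
    convert QL.smul_mem c hf2 using 1
    ext z
    simp [tsum_mul_left]

end average

/-! ### Sums over translates of `z^{-α} z̄^{-β}` -/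

/-- The terms of the series `∑_n (z + n)^{-α} (z̄ + n)^{-β}`. -/
def latTerm (α β : ℤ) (z : ℍ) (n : ℤ) : ℂ :=
  ((z : ℂ) + n) ^ (-α) * (conj (z : ℂ) + n) ^ (-β)

/-- `∑_n (z + n)^{-α} (z̄ + n)^{-β}`. -/
def latSum (α β : ℤ) (z : ℍ) : ℂ := ∑' n : ℤ, latTerm α β z n

theorem conj_add_int (z : ℍ) (n : ℤ) : conj (z : ℂ) + n = conj ((z : ℂ) + n) := by simp

theorem coe_add_int_ne_zero (z : ℍ) (n : ℤ) : (z : ℂ) + n ≠ 0 := by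
  intro h
  have := congrArg Complex.im h
  simp at this
  exact z.im_ne_zero this

theorem conj_add_int_ne_zero (z : ℍ) (n : ℤ) : conj (z : ℂ) + n ≠ 0 := by
  rw [conj_add_int]
  exact (_root_.map_ne_zero _).mpr (coe_add_int_ne_zero z n)

theorem norm_latTerm (α β : ℤ) (z : ℍ) (n : ℤ) :
    ‖latTerm α β z n‖ = ‖(z : ℂ) + n‖ ^ (-(α + β)) := by
  rw [latTerm, norm_mul, norm_zpow, norm_zpow, conj_add_int, RCLike.norm_conj,
    ← zpow_add₀ (norm_ne_zero_iff.mpr (coe_add_int_ne_zero z n))]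
  congr 1
  ring

theorem summable_latTerm {α β : ℤ} (h : 2 ≤ α + β) (z : ℍ) : Summable (latTerm α β z) := by
  refine Summable.of_norm ?_
  have := (EisensteinSeries.linear_right_summable (z : ℂ) 1 h).norm
  refine this.congr fun n => ?_
  rw [norm_latTerm, norm_inv, norm_zpow, zpow_neg, Int.cast_one, one_mul]

theorem conj_latTerm (α β : ℤ) (z : ℍ) (n : ℤ) : conj (latTerm α β z n) = latTerm β α z n := by
  simp only [latTerm, map_mul, map_zpow₀, conj_add_int, Complex.conj_conj]
  ring

theorem latSum_conj (α β : ℤ) (z : ℍ) : conj (latSum α β z) = latSum β α z := by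
  rw [latSum, Complex.conj_tsum]
  exact tsum_congr fun n => conj_latTerm α β z n

theorem latSum_mem_QL_swap {α β : ℤ} (h : latSum α β ∈ QL) : latSum β α ∈ QL := by
  convert conj_mem_QL h using 1
  ext z
  exact (latSum_conj α β z).symm

/-- This is Lipschitz' formula for ∑ (z + n)^{-a}. -/
theorem latSum_zero_right_mem_QL {a : ℤ} (ha : 2 ≤ a) : latSum a 0 ∈ QL := by
  obtain ⟨k, hk, rfl⟩ : ∃ k : ℕ, 1 ≤ k ∧ a = k + 1 := ⟨(a - 1).toNat, by omega, by omega⟩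
  set c : ℂ := (-2 * Real.pi * Complex.I) ^ (k + 1) / (k.factorial : ℂ)
  have hg : DiscHol fun q : ℂ => c * ∑' n : ℕ, (n : ℂ) ^ k * q ^ n :=
    (differentiableOn_const c).mul (discHol_pow_mul_geometric k)
  convert qTerm_left_mem_QL (j := 0) hg using 1
  ext z
  have := EisensteinSeries.qExpansion_identity hk z
  simp only [qTerm, zpow_zero, one_mul, Pi.one_apply, map_one, mul_one, qpar]
  rw [← this, latSum]
  refine tsum_congr fun n => ?_
  simp only [latTerm, neg_zero, zpow_zero, mul_one, zpow_neg, one_div]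
  norm_cast

/-- By partial fractions, 2iy times the sum is π cot(πz̄) - π cot(πz), and the cotangent is a
rational function of q without pole in the unit disc. -/
theorem latSum_one_one_mem_QL : latSum 1 1 ∈ QL := by
  set g : ℂ → ℂ := fun q => Real.pi * ((q + 1) / (Complex.I * (1 - q))) with hgdef
  have hg : DiscHol g := by
    intro q hq
    have hq' : 1 - q ≠ 0 := by
      intro h
      have : q = 1 := (sub_eq_zero.mp h).symm
      simp [this] at hq
    have h2 : Complex.I * (1 - q) ≠ 0 := mul_ne_zero Complex.I_ne_zero hq'
    refine DifferentiableAt.differentiableWithinAt ?_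
    fun_prop (disch := assumption)
  have key : ∀ z : ℍ, 2 * Complex.I * z.im * latSum 1 1 z =
      conj (g (qpar z)) - g (qpar z) := by
    intro z
    have hz : (z : ℂ) ∈ Complex.integerComplement := z.coe_mem_integerComplement
    have hz' : conj (z : ℂ) ∈ Complex.integerComplement := by
      rintro ⟨n, hn⟩
      have := congrArg Complex.im hn
      simp at this
      exact z.im_ne_zero this
    have hcot : (Real.pi : ℂ) * Complex.cot (Real.pi * z) = g (qpar z) := by
      rw [Complex.cot_pi_eq_exp_ratio]; rfl
    have hcot' : (Real.pi : ℂ) * Complex.cot (Real.pi * conj (z : ℂ)) = conj (g (qpar z)) := by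
      rw [← hcot, map_mul, ← Complex.cot_conj, map_mul, Complex.conj_ofReal]
    have hsum : ∀ x ∈ Complex.integerComplement,
        Summable fun n : ℕ+ => (1 / (x - n) + 1 / (x + n)) := by
      intro x hx
      rw [summable_pnat_iff_summable_succ (f := fun n : ℕ => 1 / (x - n) + 1 / (x + n))]
      exact (summable_cotTerm hx).congr fun n => by simp [cotTerm]
    rw [← hcot', ← hcot, cot_series_rep hz, cot_series_rep hz', latSum, ← tsum_mul_left]
    have hD : ∀ n : ℤ, 2 * Complex.I * z.im * latTerm 1 1 z n =
        1 / (conj (z : ℂ) + n) - 1 / ((z : ℂ) + n) := by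
      intro n
      have h1 := coe_add_int_ne_zero z n
      have h2 := conj_add_int_ne_zero z n
      simp only [latTerm, zpow_neg, zpow_one]
      rw [← sub_conj_eq]
      field_simp
      ring
    have hs : Summable fun n : ℤ => 2 * Complex.I * z.im * latTerm 1 1 z n :=
      (summable_latTerm (by norm_num) z).mul_left _
    -- The terms n and -n are paired because the cotangent series for z and z̄ separately converge
    -- absolutely only after this grouping.
    rw [tsum_int_eq_zero_add_tsum_pnat hs, add_assoc]
    have hs1 : Summable fun n : ℕ+ => 2 * Complex.I * z.im * latTerm 1 1 z (n : ℕ) :=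
      hs.comp_injective (i := fun n : ℕ+ => ((n : ℕ) : ℤ))
        fun a b h => by simpa using h
    have hs2 : Summable fun n : ℕ+ => 2 * Complex.I * z.im * latTerm 1 1 z (-(n : ℕ)) :=
      hs.comp_injective (i := fun n : ℕ+ => (-((n : ℕ) : ℤ)))
        fun a b h => by simpa using h
    rw [← hs1.tsum_add hs2, hD 0, add_sub_add_comm, ← (hsum _ hz').tsum_sub (hsum _ hz)]
    congr 1
    · simp
    · refine tsum_congr fun n => ?_
      rw [hD, hD]
      push_cast
      ring
  have h1 : latSum 1 1 = (1 / (2 * Complex.I)) • (qTerm (-1) 1 g - qTerm (-1) g 1) := by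
    ext z
    have hy := im_ne_zero' z
    have := key z
    simp only [Pi.smul_apply, Pi.sub_apply, smul_eq_mul, qTerm, Pi.one_apply, map_one, mul_one,
      zpow_neg, zpow_one]
    have hI := Complex.I_ne_zero
    field_simp
    linear_combination this
  rw [h1]
  exact QL.smul_mem _ (QL.sub_mem (qTerm_right_mem_QL hg) (qTerm_left_mem_QL hg))

/-- Writing one factor z + n as (z̄ + n) + 2iy reduces the positive power of z + n by one; the
recursion ends at Lipschitz' formula. Each step keeps the total exponent at least 2. -/
theorem latSum_mem_QL_of_nonpos (m : ℕ) : ∀ β : ℤ, 2 ≤ -(m : ℤ) + β → latSum (-m) β ∈ QL := by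
  induction m with
  | zero =>
    intro β hβ
    simpa using latSum_mem_QL_swap (latSum_zero_right_mem_QL (a := β) (by simpa using hβ))
  | succ m ih =>
    intro β hβ
    push_cast at hβ
    have h1 := ih (β - 1) (by omega)
    have h2 := im_zpow_mul_mem_QL 1 (ih β (by omega))
    have : latSum (-((m + 1 : ℕ) : ℤ)) β = latSum (-(m : ℤ)) (β - 1) +
        (2 * Complex.I) • fun z : ℍ => (z.im : ℂ) ^ (1 : ℤ) * latSum (-(m : ℤ)) β z := by
      ext z
      have s1 := summable_latTerm (α := -(m : ℤ)) (β := β - 1) (by omega) z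
      have s2 := summable_latTerm (α := -(m : ℤ)) (β := β) (by omega) z
      simp only [Pi.add_apply, Pi.smul_apply, smul_eq_mul, latSum, zpow_one]
      rw [← mul_assoc, ← tsum_mul_left, ← s1.tsum_add (s2.mul_left _)]
      refine tsum_congr fun n => ?_
      have h1 := coe_add_int_ne_zero z n
      have h2 := conj_add_int_ne_zero z n
      have e := sub_conj_eq z
      simp only [latTerm, neg_neg, neg_sub]
      rw [sub_eq_add_neg, zpow_add₀ h2, zpow_one, ← e]
      push_cast
      rw [zpow_add₀ h1, zpow_one]
      ring
    rw [this]
    exact QL.add_mem h1 (QL.smul_mem _ h2)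

/-- With u = z + n and v = z̄ + n one has (u - v) u^{-α} v^{-β} = u^{1-α} v^{-β} - u^{-α} v^{1-β},
and u - v = 2iy is independent of n. The total exponent drops by one, down to the base case (1, 1)
or to a pair with a zero exponent. -/
theorem latSum_mem_QL_of_pos (N : ℕ) :
    ∀ α β : ℤ, 1 ≤ α → 1 ≤ β → α + β = N + 2 → latSum α β ∈ QL := by
  induction N with
  | zero =>
    intro α β hα hβ h
    obtain rfl : α = 1 := by omega
    obtain rfl : β = 1 := by omega
    exact latSum_one_one_mem_QL
  | succ N ih =>
    intro α β hα hβ h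
    push_cast at h
    have h1 : latSum (α - 1) β ∈ QL := by
      rcases hα.lt_or_eq with h' | h'
      · exact ih _ _ (by omega) hβ (by omega)
      · subst h'
        simpa using latSum_mem_QL_of_nonpos 0 β (by push_cast; omega)
    have h2 : latSum α (β - 1) ∈ QL := by
      rcases hβ.lt_or_eq with h' | h'
      · exact ih _ _ hα (by omega) (by omega)
      · subst h'
        exact latSum_mem_QL_swap (by simpa using latSum_mem_QL_of_nonpos 0 α (by push_cast; omega))
    have : latSum α β = (1 / (2 * Complex.I)) • fun z : ℍ => (z.im : ℂ) ^ (-1 : ℤ) *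
        (latSum (α - 1) β - latSum α (β - 1)) z := by
      ext z
      have s1 := summable_latTerm (α := α - 1) (β := β) (by omega) z
      have s2 := summable_latTerm (α := α) (β := β - 1) (by omega) z
      simp only [Pi.sub_apply, Pi.smul_apply, smul_eq_mul, latSum]
      rw [← s1.tsum_sub s2, ← mul_assoc, ← tsum_mul_left]
      refine tsum_congr fun n => ?_
      have h1 := coe_add_int_ne_zero z n
      have h2 := conj_add_int_ne_zero z n
      have e := sub_conj_eq z
      have hy := im_ne_zero' z
      simp only [latTerm, neg_sub]
      rw [sub_eq_add_neg 1 α, sub_eq_add_neg 1 β, zpow_add₀ h2, zpow_add₀ h1, zpow_one, zpow_one,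
        zpow_neg (z.im : ℂ), zpow_one]
      have hI := Complex.I_ne_zero
      field_simp
      linear_combination -e
    rw [this]
    exact QL.smul_mem _ (im_zpow_mul_mem_QL _ (QL.sub_mem h1 h2))

theorem latSum_mem_QL {α β : ℤ} (h : 2 ≤ α + β) : latSum α β ∈ QL := by
  rcases le_or_gt α 0 with hα | hα
  · have := latSum_mem_QL_of_nonpos (-α).toNat β (by omega)
    rwa [show (-(((-α).toNat : ℕ) : ℤ)) = α by omega] at this
  rcases le_or_gt β 0 with hβ | hβ
  · have := latSum_mem_QL_of_nonpos (-β).toNat α (by omega)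
    rw [show (-(((-β).toNat : ℕ) : ℤ)) = β by omega] at this
    exact latSum_mem_QL_swap this
  · exact latSum_mem_QL_of_pos (α + β - 2).toNat α β hα hβ (by omega)

/-- The surplus α + β - 2 of the exponent is estimated by |z + n| ≥ y. This reduces all questions of
absolute convergence to the exponents (1, 1). -/
theorem norm_latTerm_le {α β : ℤ} (h : 2 ≤ α + β) (z : ℍ) (n : ℤ) :
    ‖latTerm α β z n‖ ≤ z.im ^ (2 - (α + β)) * ‖latTerm 1 1 z n‖ := by
  have h0 : 0 < ‖(z : ℂ) + n‖ := norm_pos_iff.mpr (coe_add_int_ne_zero z n)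
  have him : z.im ≤ ‖(z : ℂ) + n‖ := by
    have := Complex.abs_im_le_norm ((z : ℂ) + n)
    simp only [Complex.add_im, coe_im, Complex.intCast_im, add_zero] at this
    exact (le_abs_self _).trans this
  rw [norm_latTerm, norm_latTerm]
  have e : ‖(z : ℂ) + n‖ ^ (-(α + β)) =
      ‖(z : ℂ) + n‖ ^ (2 - (α + β)) * ‖(z : ℂ) + n‖ ^ (-(1 + 1) : ℤ) := by
    rw [← zpow_add₀ h0.ne']
    congr 1
    ring
  rw [e]
  refine mul_le_mul_of_nonneg_right ?_ (zpow_nonneg h0.le _)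
  obtain ⟨m, hm⟩ : ∃ m : ℕ, 2 - (α + β) = -(m : ℤ) := ⟨(α + β - 2).toNat, by omega⟩
  rw [hm, zpow_neg, zpow_neg, zpow_natCast, zpow_natCast]
  have := z.im_pos
  gcongr

theorem latTerm_one_one_eq (z : ℍ) (n : ℤ) : latTerm 1 1 z n = (‖latTerm 1 1 z n‖ : ℂ) := by
  rw [norm_latTerm, latTerm, ← mul_zpow, conj_add_int, Complex.mul_conj, Complex.normSq_eq_norm_sq,
    ← Complex.ofReal_zpow, ← zpow_natCast, ← zpow_mul]
  norm_num

/-- Absolute convergence of double series of translates, and their `q`-expansions. -/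
theorem summable_double_and_mem_QL {ι : Type*} {ρ : ι → ℂ} (hρ : Summable fun i => ‖ρ i‖)
    (x : ι → ℝ) {α β : ℤ} (h : 2 ≤ α + β) :
    (∀ z : ℍ, Summable fun p : ι × ℤ => ρ p.1 * latTerm α β (x p.1 +ᵥ z) p.2) ∧
      (fun z : ℍ => ∑' p : ι × ℤ, ρ p.1 * latTerm α β (x p.1 +ᵥ z) p.2) ∈ QL := by
  have hs : ∀ z : ℍ, Summable fun p : ι × ℤ => ρ p.1 * latTerm α β (x p.1 +ᵥ z) p.2 := by
    intro z
    -- For exponents (1, 1) the terms are positive reals, so the sum of norms over n is `latSum 1 1`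
    -- itself; this lies in `QL`, and its average is already known to converge.
    have h11 : Summable fun p : ι × ℤ => ‖ρ p.1‖ * ‖latTerm 1 1 (x p.1 +ᵥ z) p.2‖ := by
      refine (summable_prod_of_nonneg fun p => by positivity).mpr ⟨fun i => ?_, ?_⟩
      · have := (summable_latTerm (α := 1) (β := 1) (by norm_num) (x i +ᵥ z)).norm
        exact this.mul_left ‖ρ i‖
      · refine ((average_mem_QL hρ x latSum_one_one_mem_QL).1 z).norm.congr fun i => ?_
        simp only []
        rw [tsum_mul_left, norm_mul, latSum]
        congr 1
        rw [tsum_congr fun n => latTerm_one_one_eq (x i +ᵥ z) n, ← Complex.ofReal_tsum,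
          Complex.norm_real, Real.norm_of_nonneg (tsum_nonneg fun n => norm_nonneg _)]
    refine Summable.of_norm_bounded (h11.mul_left (z.im ^ (2 - (α + β)))) fun p => ?_
    rw [norm_mul, mul_left_comm]
    have := norm_latTerm_le h (x p.1 +ᵥ z) p.2
    rw [vadd_im] at this
    gcongr
  refine ⟨hs, ?_⟩
  convert (average_mem_QL hρ x (latSum_mem_QL h)).2 using 1
  ext z
  rw [(hs z).tsum_prod]
  refine tsum_congr fun i => ?_
  simp only []
  rw [tsum_mul_left, latSum]

/-! ### The cosets `B \ Γ` -/

theorem T_zpow_apply (n : ℤ) :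
    (ModularGroup.T ^ n) 0 0 = 1 ∧ (ModularGroup.T ^ n) 0 1 = n ∧
    (ModularGroup.T ^ n) 1 0 = 0 ∧ (ModularGroup.T ^ n) 1 1 = 1 := by
  rw [ModularGroup.coe_T_zpow]
  simp

theorem mem_B_iff {γ : SL(2, ℤ)} : γ ∈ B ↔ γ 1 0 = 0 := by
  constructor
  · rintro ⟨n, rfl | rfl⟩
    · exact (T_zpow_apply n).2.2.1
    · simp [(T_zpow_apply n).2.2.1]
  · intro h
    have hdet := γ.det_coe
    rw [Matrix.det_fin_two, h, mul_zero, sub_zero] at hdet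
    rcases Int.eq_one_or_neg_one_of_mul_eq_one' hdet with ⟨h0, h1⟩ | ⟨h0, h1⟩
    · refine ⟨γ 0 1, Or.inl ?_⟩
      obtain ⟨t1, t2, t3, t4⟩ := T_zpow_apply (γ 0 1)
      ext i j
      fin_cases i <;> fin_cases j <;> simp_all
    · refine ⟨-γ 0 1, Or.inr ?_⟩
      obtain ⟨t1, t2, t3, t4⟩ := T_zpow_apply (-γ 0 1)
      ext i j
      fin_cases i <;> fin_cases j <;> simp_all

/-- The coset `B γ`. -/
def bmk (γ : SL(2, ℤ)) : BCosets := Quotient.mk _ γ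

theorem bmk_eq_iff_mul_inv_mem {γ γ' : SL(2, ℤ)} : bmk γ = bmk γ' ↔ γ' * γ⁻¹ ∈ B := by
  rw [bmk, bmk, Quotient.eq, QuotientGroup.rightRel_apply]

/-- The difference of the two sides is the lower left entry of γ'γ⁻¹, and B is defined by the
vanishing of that entry. -/
theorem bmk_eq_iff {γ γ' : SL(2, ℤ)} :
    bmk γ = bmk γ' ↔ γ' 1 0 * γ 1 1 = γ' 1 1 * γ 1 0 := by
  rw [bmk_eq_iff_mul_inv_mem, mem_B_iff, Matrix.SpecialLinearGroup.coe_mul,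
    Matrix.SpecialLinearGroup.coe_inv, Matrix.adjugate_fin_two, Matrix.mul_apply,
    Fin.sum_univ_two]
  simp [sub_eq_zero, ← sub_eq_add_neg]

theorem bmk_out (q : BCosets) : bmk q.out = q := Quotient.out_eq q

/-- A term that depends only on the coset `B γ`. -/
def BInvariant (t : SL(2, ℤ) → ℂ) : Prop := ∀ β ∈ B, ∀ γ, t (β * γ) = t γ

theorem BInvariant.eq_of_bmk_eq {t : SL(2, ℤ) → ℂ} (ht : BInvariant t) {γ γ' : SL(2, ℤ)}
    (h : bmk γ = bmk γ') : t γ = t γ' := by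
  have := ht _ (bmk_eq_iff_mul_inv_mem.mp h) γ
  rw [inv_mul_cancel_right] at this
  exact this.symm

theorem BInvariant.out_bmk {t : SL(2, ℤ) → ℂ} (ht : BInvariant t) (γ : SL(2, ℤ)) :
    t (bmk γ).out = t γ :=
  ht.eq_of_bmk_eq (bmk_out _)

/-- Right multiplication on `B \ Γ`. -/
def bmulRight (δ : SL(2, ℤ)) : BCosets ≃ BCosets :=
  Quotient.congr (Equiv.mulRight δ) fun a b => by
    change QuotientGroup.rightRel B a b ↔ QuotientGroup.rightRel B (a * δ) (b * δ)
    rw [QuotientGroup.rightRel_apply, QuotientGroup.rightRel_apply]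
    simp [mul_assoc]

theorem bmulRight_bmk (δ γ : SL(2, ℤ)) : bmulRight δ (bmk γ) = bmk (γ * δ) := rfl

theorem BInvariant.out_bmulRight {t : SL(2, ℤ) → ℂ} (ht : BInvariant t) (δ : SL(2, ℤ))
    (q : BCosets) : t (bmulRight δ q).out = t (q.out * δ) := by
  conv_lhs => rw [← bmk_out q, bmulRight_bmk]
  exact ht.out_bmk _

theorem BInvariant.cosetSum_mul_right {t : SL(2, ℤ) → ℂ} (ht : BInvariant t) (δ : SL(2, ℤ)) :
    cosetSum (fun γ => t (γ * δ)) = cosetSum t := by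
  rw [cosetSum, cosetSum, ← (bmulRight δ).tsum_eq fun q => t q.out]
  exact tsum_congr fun q => (ht.out_bmulRight δ q).symm

/-- The pairs `(c, d)` with `0 ≤ d < c` and `d` prime to `c`: they parametrise the non-trivial
double cosets in `B \ Γ / ⟨T⟩`. -/
abbrev DIdx : Type := {p : Σ c : ℕ, Fin c // IsCoprime (p.1 : ℤ) ((p.2 : ℕ) : ℤ)}

namespace DIdx

/-- The lower left entry. -/
def c (i : DIdx) : ℕ := i.1.1

/-- The lower right entry. -/
def d (i : DIdx) : ℕ := i.1.2

theorem c_pos (i : DIdx) : 0 < i.c := i.1.2.pos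

theorem c_ne_zero (i : DIdx) : (i.c : ℂ) ≠ 0 := by exact_mod_cast i.c_pos.ne'

theorem d_lt_c (i : DIdx) : i.d < i.c := i.1.2.isLt

theorem isCoprime (i : DIdx) : IsCoprime (i.c : ℤ) (i.d : ℤ) := i.2

theorem ext' {i j : DIdx} (h1 : i.c = j.c) (h2 : i.d = j.d) : i = j := by
  obtain ⟨⟨c, d⟩, hi⟩ := i
  obtain ⟨⟨c', d'⟩, hj⟩ := j
  change c = c' at h1
  subst h1
  have : d = d' := Fin.ext h2
  subst this
  rfl

theorem exists_rep (i : DIdx) : ∃ γ : SL(2, ℤ), γ 1 0 = i.c ∧ γ 1 1 = i.d := by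
  obtain ⟨a, b, h⟩ := i.isCoprime
  refine ⟨⟨!![b, -a; (i.c : ℤ), (i.d : ℤ)], ?_⟩, ?_, ?_⟩
  · rw [Matrix.det_fin_two_of]
    linear_combination h
  · simp
  · simp

/-- A matrix with lower row `(c, d)`. -/
def rep (i : DIdx) : SL(2, ℤ) := i.exists_rep.choose

theorem rep_c (i : DIdx) : i.rep 1 0 = i.c := i.exists_rep.choose_spec.1

theorem rep_d (i : DIdx) : i.rep 1 1 = i.d := i.exists_rep.choose_spec.2

/-- The quotient `d / c`. -/
def x (i : DIdx) : ℝ := i.d / i.c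

/-- The matrix with lower row `(c, d + n c)`. -/
def mat (p : DIdx × ℤ) : SL(2, ℤ) := p.1.rep * ModularGroup.T ^ p.2

theorem mat_c (p : DIdx × ℤ) : mat p 1 0 = p.1.c := by
  obtain ⟨t1, t2, t3, t4⟩ := T_zpow_apply p.2
  rw [mat, Matrix.SpecialLinearGroup.coe_mul, Matrix.mul_apply, Fin.sum_univ_two, t1, t3, rep_c]
  simp

theorem mat_d (p : DIdx × ℤ) : mat p 1 1 = p.1.d + p.1.c * p.2 := by
  obtain ⟨t1, t2, t3, t4⟩ := T_zpow_apply p.2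
  rw [mat, Matrix.SpecialLinearGroup.coe_mul, Matrix.mul_apply, Fin.sum_univ_two, t2, t4, rep_c,
    rep_d]
  ring

/-- The cosets in `B \ Γ` other than `B`, and the coset `B` itself. -/
def coset : Option (DIdx × ℤ) → BCosets
  | none => bmk 1
  | some p => bmk (mat p)

theorem coset_bijective : Function.Bijective coset := by
  constructor
  · have key : ∀ p : DIdx × ℤ, bmk (mat p) ≠ bmk 1 := by
      intro p h
      rw [bmk_eq_iff, mat_c] at h
      simp at h
      exact p.1.c_pos.ne (by exact_mod_cast h)
    rintro (_ | p) (_ | p') h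
    · rfl
    · exact absurd h.symm (key p')
    · exact absurd h (key p)
    · have h' : bmk (mat p) = bmk (mat p') := h
      rw [bmk_eq_iff, mat_c, mat_c, mat_d, mat_d] at h'
      obtain ⟨i, n⟩ := p
      obtain ⟨j, m⟩ := p'
      simp only at h'
      have hi : IsCoprime (i.c : ℤ) (i.d + i.c * n) := by
        simpa using i.isCoprime.add_mul_left_right n
      have hj : IsCoprime (j.c : ℤ) (j.d + j.c * m) := by
        simpa using j.isCoprime.add_mul_left_right m
      -- The two lower rows are proportional and primitive, so the positive entries c divide each
      -- other. The entries d are then recovered as remainders modulo c.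
      have d1 : (i.c : ℤ) ∣ j.c := hi.dvd_of_dvd_mul_right (Dvd.intro_left _ h'.symm)
      have d2 : (j.c : ℤ) ∣ i.c := by
        refine hj.dvd_of_dvd_mul_left (Dvd.intro _ h')
      have hc : i.c = j.c := Nat.dvd_antisymm (by exact_mod_cast d1) (by exact_mod_cast d2)
      rw [hc, mul_comm] at h'
      have hcj : (j.c : ℤ) ≠ 0 := by exact_mod_cast j.c_pos.ne'
      have h2 := mul_right_cancel₀ hcj h'
      have hi' : (i.d : ℤ) < j.c := by exact_mod_cast hc ▸ i.d_lt_c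
      have hj' : (j.d : ℤ) < j.c := by exact_mod_cast j.d_lt_c
      have e1 : (i.d : ℤ) = (i.d + j.c * n) % j.c := by
        rw [Int.add_mul_emod_self_left, Int.emod_eq_of_lt (by positivity) hi']
      have e2 : (j.d : ℤ) = (j.d + j.c * m) % j.c := by
        rw [Int.add_mul_emod_self_left, Int.emod_eq_of_lt (by positivity) hj']
      have hd : (i.d : ℤ) = j.d := by rw [e1, e2, h2]
      have hn : n = m := by
        rw [hd] at h2
        exact mul_left_cancel₀ hcj (add_left_cancel h2)
      rw [DIdx.ext' hc (by exact_mod_cast hd), hn]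
  · intro q
    obtain ⟨γ, rfl⟩ : ∃ γ, bmk γ = q := ⟨q.out, bmk_out q⟩
    by_cases hc : γ 1 0 = 0
    · refine ⟨none, ?_⟩
      change bmk 1 = bmk γ
      rw [bmk_eq_iff, hc]
      simp
    · have key : ∀ c d : ℤ, 0 < c → IsCoprime c d → ∃ p : DIdx × ℤ, mat p 1 0 = c ∧
          mat p 1 1 = d := by
        intro c d hc hcd
        have h0 := Int.emod_nonneg d hc.ne'
        have h1 := Int.emod_lt_of_pos d hc
        have hc' : ((c.toNat : ℕ) : ℤ) = c := Int.toNat_of_nonneg hc.le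
        have hd' : (((d % c).toNat : ℕ) : ℤ) = d % c := Int.toNat_of_nonneg h0
        have hlt : (d % c).toNat < c.toNat := by omega
        have hco : IsCoprime ((c.toNat : ℕ) : ℤ) (((d % c).toNat : ℕ) : ℤ) := by
          rw [hc', hd']
          have e : d = d % c + c * (d / c) := (Int.emod_add_mul_ediv d c).symm
          rw [e] at hcd
          exact (IsCoprime.add_mul_left_right_iff).mp hcd
        refine ⟨(⟨⟨c.toNat, ⟨(d % c).toNat, hlt⟩⟩, hco⟩, d / c), ?_, ?_⟩
        · rw [mat_c]; exact hc'
        · rw [mat_d]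
          change ((((d % c).toNat : ℕ) : ℤ)) + ((c.toNat : ℕ) : ℤ) * (d / c) = d
          rw [hc', hd']
          exact Int.emod_add_mul_ediv d c
      have hco : IsCoprime (γ 1 0) (γ 1 1) := ModularGroup.bottom_row_coprime γ
      -- If c < 0, the lower row of -γ is used instead; it defines the same coset since -1 lies in
      -- B.
      rcases lt_or_gt_of_ne hc with h | h
      · obtain ⟨p, h1, h2⟩ := key (-γ 1 0) (-γ 1 1) (by omega) hco.neg_neg
        refine ⟨some p, ?_⟩
        change bmk (mat p) = bmk γ
        rw [bmk_eq_iff, h1, h2]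
        ring
      · obtain ⟨p, h1, h2⟩ := key (γ 1 0) (γ 1 1) h hco
        refine ⟨some p, ?_⟩
        change bmk (mat p) = bmk γ
        rw [bmk_eq_iff, h1, h2]
        ring

end DIdx

theorem hasSum_option {α : Type*} {f : Option α → ℂ} {a : ℂ}
    (h : HasSum (fun x => f (some x)) a) : HasSum f (f none + a) := by
  classical
  have h0 : HasSum (Function.update f none 0) a := by
    refine ((Option.some_injective α).hasSum_iff ?_).mp ?_
    · rintro (_ | x) hx
      · simp
      · exact absurd ⟨x, rfl⟩ hx
    · exact h
  have := h0.update none (f none)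
  simpa using this

/-- Unfolding of a sum over `B \ Γ`. -/
theorem BInvariant.hasSum_coset {t : SL(2, ℤ) → ℂ} (ht : BInvariant t) {a : ℂ}
    (h : HasSum (fun p : DIdx × ℤ => t (DIdx.mat p)) a) :
    HasSum (fun q : BCosets => t q.out) (t 1 + a) := by
  have h1 : HasSum (fun o : Option (DIdx × ℤ) => t (DIdx.coset o).out) (t 1 + a) := by
    have e1 : t (DIdx.coset none).out = t 1 := ht.out_bmk 1
    rw [← e1]
    refine hasSum_option ?_
    refine h.congr_fun fun p => ?_
    exact ht.out_bmk (DIdx.mat p)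
  exact (Equiv.ofBijective _ DIdx.coset_bijective).hasSum_iff.mp h1

/-- Each c occurs for at most c values of d, so the series is dominated by ∑ c^{-2}. -/
theorem DIdx.summable_inv_pow_three : Summable fun i : DIdx => ((i.c : ℝ) ^ 3)⁻¹ := by
  have h : Summable fun p : Σ c : ℕ, Fin c => ((p.1 : ℝ) ^ 3)⁻¹ := by
    refine (summable_sigma_of_nonneg fun p => by positivity).mpr ⟨fun c => ?_, ?_⟩
    · exact (hasSum_fintype _).summable
    · refine (Real.summable_nat_pow_inv.mpr one_lt_two).congr fun c => ?_
      simp only [tsum_fintype, Finset.sum_const, Finset.card_univ, Fintype.card_fin,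
        nsmul_eq_mul]
      rcases eq_or_ne c 0 with rfl | hc
      · simp
      · have : (c : ℝ) ≠ 0 := by exact_mod_cast hc
        field_simp
  exact h.comp_injective Subtype.val_injective

theorem jfac_mat (p : DIdx × ℤ) (w : ℂ) :
    jfac (DIdx.mat p) w = p.1.c * ((p.1.x + w) + p.2) := by
  have := p.1.c_ne_zero
  simp only [jfac, DIdx.mat_c, DIdx.mat_d, DIdx.x]
  push_cast
  field_simp
  ring

/-- Since j(γ, z) = c (z + d/c + n), the weight factor is a power of c times a term of the lattice
sum at a translate of z. -/
theorem wt_mat (r s : ℤ) (p : DIdx × ℤ) (z : ℍ) :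
    wt r s (DIdx.mat p) z = (p.1.c : ℂ) ^ (-(r + s)) * latTerm r s (p.1.x +ᵥ z) p.2 := by
  have := p.1.c_ne_zero
  rw [wt, jfac_mat, jfac_mat, latTerm, coe_vadd, map_add, Complex.conj_ofReal, mul_zpow, mul_zpow,
    neg_add, zpow_add₀ this]
  ring

theorem BInvariant_wt {r s : ℤ} (h : Even (r + s)) (z : ℍ) : BInvariant fun γ => wt r s γ z := by
  rintro β ⟨n, hβ⟩ γ
  simp only [wt_mul]
  have h1 : wt r s β (γ • z) = 1 := by
    obtain ⟨t1, t2, t3, t4⟩ := T_zpow_apply n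
    rcases hβ with rfl | rfl
    · simp [wt, jfac, t3, t4]
    · have e : ∀ w, jfac (-ModularGroup.T ^ n) w = -1 := by
        intro w
        simp [jfac, t3, t4]
      rw [wt, e, e, ← zpow_add₀ (by norm_num), ← neg_add]
      exact h.neg.neg_one_zpow
  rw [h1, one_mul]

theorem summable_c_zpow {k : ℤ} (hk : 3 ≤ k) : Summable fun i : DIdx => ‖(i.c : ℂ) ^ (-k)‖ := by
  refine Summable.of_nonneg_of_le (fun i => norm_nonneg _) (fun i => ?_)
    DIdx.summable_inv_pow_three
  have h1 : (1 : ℝ) ≤ i.c := by exact_mod_cast i.c_pos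
  rw [norm_zpow, Complex.norm_natCast, zpow_neg]
  have : (i.c : ℝ) ^ 3 ≤ (i.c : ℝ) ^ k := by
    rw [← zpow_natCast]
    exact zpow_le_zpow_right₀ h1 (by exact_mod_cast hk)
  exact inv_anti₀ (by positivity) this

/-! ### The Eisenstein series: convergence, expansion, invariance, non-vanishing -/

theorem hasSum_eis {r s : ℤ} (h : Even (r + s)) (h3 : 3 ≤ r + s) (z : ℍ) :
    HasSum (fun q : BCosets => wt r s q.out z) (1 + ∑' p : DIdx × ℤ,
      (p.1.c : ℂ) ^ (-(r + s)) * latTerm r s (p.1.x +ᵥ z) p.2) := by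
  have hs := (summable_double_and_mem_QL (summable_c_zpow h3) DIdx.x (α := r) (β := s)
    (by omega)).1 z
  have := (BInvariant_wt h z).hasSum_coset (hs.hasSum.congr_fun fun p => wt_mat r s p z)
  rwa [wt_one] at this

theorem eis_eq {r s : ℤ} (h : Even (r + s)) (h3 : 3 ≤ r + s) (z : ℍ) :
    eis r s z = 1 + ∑' p : DIdx × ℤ,
      (p.1.c : ℂ) ^ (-(r + s)) * latTerm r s (p.1.x +ᵥ z) p.2 :=
  (hasSum_eis h h3 z).tsum_eq

theorem eis_mem_QA {r s : ℤ} (h : Even (r + s)) (h3 : 3 ≤ r + s) : eis r s ∈ QA := by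
  have := QL_le_QA (summable_double_and_mem_QL (summable_c_zpow h3) DIdx.x (α := r) (β := s)
    (by omega)).2
  convert QA.add_mem (const_mem_QA 1) this using 1
  ext z
  exact eis_eq h h3 z

theorem eis_smul {r s : ℤ} (h : Even (r + s)) (γ : SL(2, ℤ)) (z : ℍ) :
    wt r s γ z * eis r s (γ • z) = eis r s z := by
  rw [eis, eis, ← (BInvariant_wt h z).cosetSum_mul_right γ, cosetSum, cosetSum, ← tsum_mul_left]
  refine tsum_congr fun q => ?_
  rw [wt_mul, mul_comm]

theorem eis_mem_invRR {r s : ℤ} (h : Even (r + s)) (h3 : 3 ≤ r + s) : eis r s ∈ invRR r s :=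
  ⟨mem_RR_of_mem_QA (eis_mem_QA h h3), fun γ => funext fun z => eis_smul h γ z⟩

/-- As y → ∞ only the trivial coset survives and the series tends to 1. If it vanished identically,
the sum over the other cosets would be -1 at every height, against dominated convergence to 0. -/
theorem exists_eis_ne_zero {r s : ℤ} (h : Even (r + s)) (h3 : 3 ≤ r + s) :
    ∃ z : ℍ, eis r s z ≠ 0 := by
  by_contra! hzero
  set zt : ℕ → ℍ := fun n => ⟨Complex.I * (n + 1), by simp; positivity⟩ with hzt
  have him : ∀ n, (zt n).im = n + 1 := by
    intro n
    simp [hzt, ← coe_im]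
  have hs := (summable_double_and_mem_QL (summable_c_zpow h3) DIdx.x (α := r) (β := s)
    (by omega)).1 (zt 0)
  -- The terms decrease along z_n = i(n + 1), so those at z_0 = i serve as the dominating series.
  have hmono : ∀ (n : ℕ) (p : DIdx × ℤ), ‖latTerm r s (p.1.x +ᵥ zt n) p.2‖ ≤
      ‖latTerm r s (p.1.x +ᵥ zt 0) p.2‖ := by
    intro n p
    rw [norm_latTerm, norm_latTerm]
    have h0 : 0 < ‖((p.1.x +ᵥ zt 0 : ℍ) : ℂ) + p.2‖ :=
      norm_pos_iff.mpr (coe_add_int_ne_zero _ _)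
    obtain ⟨m, hm⟩ : ∃ m : ℕ, r + s = m := ⟨(r + s).toNat, by omega⟩
    rw [hm, zpow_neg, zpow_neg, zpow_natCast, zpow_natCast]
    have hle : ‖((p.1.x +ᵥ zt 0 : ℍ) : ℂ) + p.2‖ ≤ ‖((p.1.x +ᵥ zt n : ℍ) : ℂ) + p.2‖ := by
      rw [Complex.norm_def, Complex.norm_def]
      apply Real.sqrt_le_sqrt
      simp [Complex.normSq_apply, hzt]
      nlinarith [(n.cast_nonneg : (0 : ℝ) ≤ n)]
    gcongr
  have ht : ∀ p : DIdx × ℤ, Filter.Tendsto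
      (fun n => (p.1.c : ℂ) ^ (-(r + s)) * latTerm r s (p.1.x +ᵥ zt n) p.2) Filter.atTop
      (nhds 0) := by
    intro p
    rw [← mul_zero ((p.1.c : ℂ) ^ (-(r + s)))]
    refine Filter.Tendsto.const_mul _ ?_
    have hbd : ∀ n, ‖latTerm r s (p.1.x +ᵥ zt n) p.2‖ ≤ ((n : ℝ) + 1)⁻¹ := by
      intro n
      rw [norm_latTerm]
      obtain ⟨m, hm⟩ : ∃ m : ℕ, r + s = m + 1 := ⟨(r + s - 1).toNat, by omega⟩
      have hle : (n : ℝ) + 1 ≤ ‖((p.1.x +ᵥ zt n : ℍ) : ℂ) + p.2‖ := by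
        have := Complex.abs_im_le_norm (((p.1.x +ᵥ zt n : ℍ) : ℂ) + p.2)
        refine le_trans (le_trans (le_of_eq ?_) (le_abs_self _)) this
        simp [hzt]
      have h1 : 1 ≤ ‖((p.1.x +ᵥ zt n : ℍ) : ℂ) + p.2‖ :=
        le_trans (by linarith [(n.cast_nonneg : (0 : ℝ) ≤ n)]) hle
      rw [hm, zpow_neg]
      refine inv_anti₀ (by positivity) (hle.trans ?_)
      have : ((m : ℤ) + 1) = ((m + 1 : ℕ) : ℤ) := by push_cast; ring
      rw [this, zpow_natCast]
      exact le_self_pow₀ h1 (by omega)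
    refine squeeze_zero_norm hbd ?_
    exact tendsto_one_div_add_atTop_nhds_zero_nat.congr fun n => by rw [one_div]
  have hlim := tendsto_tsum_of_dominated_convergence
    (bound := fun p : DIdx × ℤ => ‖(p.1.c : ℂ) ^ (-(r + s)) * latTerm r s (p.1.x +ᵥ zt 0) p.2‖)
    hs.norm ht (Filter.Eventually.of_forall fun n p => by
      rw [norm_mul, norm_mul]
      exact mul_le_mul_of_nonneg_left (hmono n p) (norm_nonneg _))
  have hconst : ∀ n, ∑' p : DIdx × ℤ,
      (p.1.c : ℂ) ^ (-(r + s)) * latTerm r s (p.1.x +ᵥ zt n) p.2 = -1 := by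
    intro n
    have := eis_eq h h3 (zt n)
    rw [hzero] at this
    linear_combination -this
  simp only [hconst, tsum_zero] at hlim
  have := tendsto_nhds_unique hlim tendsto_const_nhds
  norm_num at this

/-! ### Homogeneous evaluation of polynomials -/

/-- The binary form `∑_n p_n U^n V^{K-n}` attached to `P = ∑_n p_n X^n`. -/
def homEval (K : ℕ) (P : ℂ[X]) (U V : ℂ) : ℂ :=
  ∑ n ∈ Finset.range (K + 1), P.coeff n * U ^ n * V ^ (K - n)

theorem homEval_C_mul (K : ℕ) (c : ℂ) (P : ℂ[X]) (U V : ℂ) :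
    homEval K (C c * P) U V = c * homEval K P U V := by
  simp only [homEval, coeff_C_mul, mul_assoc, Finset.mul_sum]

theorem homEval_one_right {K : ℕ} {P : ℂ[X]} (hP : P.natDegree ≤ K) (U : ℂ) :
    homEval K P U 1 = P.eval U := by
  rw [eval_eq_sum_range' (Nat.lt_succ_of_le hP)]
  simp [homEval]

theorem homEval_mul_mul (K : ℕ) (P : ℂ[X]) (c U V : ℂ) :
    homEval K P (c * U) (c * V) = c ^ K * homEval K P U V := by
  simp only [homEval, Finset.mul_sum]
  refine Finset.sum_congr rfl fun n hn => ?_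
  have hn' : n ≤ K := Nat.lt_succ_iff.mp (Finset.mem_range.mp hn)
  rw [mul_pow, mul_pow]
  have : c ^ K = c ^ n * c ^ (K - n) := by rw [← pow_add]; congr 1; omega
  rw [this]
  ring

theorem homEval_eq {K : ℕ} {P : ℂ[X]} (hP : P.natDegree ≤ K) (U : ℂ) {V : ℂ} (hV : V ≠ 0) :
    homEval K P U V = V ^ K * P.eval (U / V) := by
  rw [← homEval_one_right hP, ← homEval_mul_mul, mul_one, mul_div_cancel₀ _ hV]

theorem eval_polyAct (K : ℕ) (γ : SL(2, ℤ)) (P : ℂ[X]) (x : ℂ) :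
    (polyAct K γ P).eval x = homEval K P ((γ 0 0 : ℂ) * x + (γ 0 1 : ℂ)) (jfac γ x) := by
  simp [polyAct, homEval, jfac, eval_finsetSum]

/-- Testing on the upper half-plane is enough for polynomials, and there the denominators j(γ, x)
and 1 - u of the later identities do not vanish. -/
theorem polynomial_ext_of_upperHalfPlane {P Q : ℂ[X]} (h : ∀ z : ℍ, P.eval (z : ℂ) = Q.eval ↑z) :
    P = Q := by
  refine eq_of_infinite_eval_eq _ _ (Set.infinite_of_injective_forall_mem
    (f := fun n : ℕ => ((n : ℂ) + Complex.I)) (fun a b hab => by simpa using hab) fun n => ?_)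
  exact h ⟨n + Complex.I, by simp⟩

theorem natDegree_polyAct_le (K : ℕ) (γ : SL(2, ℤ)) (P : ℂ[X]) :
    (polyAct K γ P).natDegree ≤ K := by
  refine natDegree_sum_le_of_forall_le _ _ fun n hn => ?_
  have hn' : n ≤ K := Nat.lt_succ_iff.mp (Finset.mem_range.mp hn)
  have h1 : ((C (γ 0 0 : ℂ) * X + C (γ 0 1 : ℂ) : ℂ[X]) ^ n).natDegree ≤ n := by
    refine (natDegree_pow_le_of_le n (m := 1) ?_).trans (by simp)
    compute_degree
  have h2 : ((C (γ 1 0 : ℂ) * X + C (γ 1 1 : ℂ) : ℂ[X]) ^ (K - n)).natDegree ≤ K - n := by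
    refine (natDegree_pow_le_of_le (K - n) (m := 1) ?_).trans (by simp)
    compute_degree
  calc _ ≤ (0 + n) + (K - n) := by
        refine natDegree_mul_le_of_le (natDegree_mul_le_of_le ?_ h1) h2
        simp
    _ = K := by omega

theorem polyAct_mul {K : ℕ} (γ' γ : SL(2, ℤ)) (P : ℂ[X]) :
    polyAct K γ (polyAct K γ' P) = polyAct K (γ' * γ) P := by
  refine polynomial_ext_of_upperHalfPlane fun z => ?_
  have hj := jfac_ne_zero γ z
  rw [eval_polyAct, eval_polyAct, homEval_eq (natDegree_polyAct_le _ _ _) _ hj, eval_polyAct,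
    ← homEval_mul_mul]
  congr 1
  · simp only [Matrix.SpecialLinearGroup.coe_mul, Matrix.mul_apply, Fin.sum_univ_two, jfac] at *
    push_cast
    field_simp
    ring
  · simp only [Matrix.SpecialLinearGroup.coe_mul, Matrix.mul_apply, Fin.sum_univ_two, jfac] at *
    push_cast
    field_simp
    ring

theorem polyAct_map_conj (K : ℕ) (γ : SL(2, ℤ)) (P : ℂ[X]) :
    polyAct K γ (P.map (starRingEnd ℂ)) = (polyAct K γ P).map (starRingEnd ℂ) := by
  simp [polyAct, Polynomial.map_sum]

theorem Sgn.act_polyAct (ε : Sgn) (K : ℕ) (γ : SL(2, ℤ)) (P : ℂ[X]) :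
    polyAct K γ (ε.act P) = ε.act (polyAct K γ P) := by
  cases ε
  · rfl
  · exact polyAct_map_conj K γ P

theorem Sgn.act_add (ε : Sgn) (P Q : ℂ[X]) : ε.act (P + Q) = ε.act P + ε.act Q := by
  cases ε
  · rfl
  · exact Polynomial.map_add _

/-- The identity or complex conjugation. -/
def Sgn.onC : Sgn → ℂ →+* ℂ
  | .plus => RingHom.id ℂ
  | .minus => starRingEnd ℂ

theorem Sgn.act_eq_map (ε : Sgn) (P : ℂ[X]) : ε.act P = P.map ε.onC := by
  cases ε
  · exact (Polynomial.map_id).symm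
  · rfl

theorem Sgn.norm_onC (ε : Sgn) (w : ℂ) : ‖ε.onC w‖ = ‖w‖ := by
  cases ε
  · rfl
  · exact RCLike.norm_conj w

theorem Sgn.natDegree_act_le (ε : Sgn) {P : ℂ[X]} {K : ℕ} (h : P.natDegree ≤ K) :
    (ε.act P).natDegree ≤ K := by
  rw [ε.act_eq_map]
  exact (natDegree_map_le).trans h

theorem polyAct_C_mul (K : ℕ) (γ : SL(2, ℤ)) (c : ℂ) (P : ℂ[X]) :
    polyAct K γ (C c * P) = C c * polyAct K γ P := by
  rw [← smul_eq_C_mul, ← smul_eq_C_mul, polyAct_smul]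

theorem slashPoly_apply (r s : ℤ) (K : ℕ) (γ : SL(2, ℤ)) (F : ℍ → ℂ[X]) (z : ℍ) :
    slashPoly r s K γ F z = C (wt r s γ z) * polyAct K γ (F (γ • z)) := rfl

theorem slashPoly_mul (r s : ℤ) (K : ℕ) (γ' γ : SL(2, ℤ)) (F : ℍ → ℂ[X]) :
    slashPoly r s K γ (slashPoly r s K γ' F) = slashPoly r s K (γ' * γ) F := by
  ext1 z
  simp only [slashPoly_apply, polyAct_C_mul, polyAct_mul, wt_mul, C_mul, mul_smul]
  ring

/-! ### The coefficients in the adapted basis -/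

theorem eval_biPoly {K : ℕ} {P : ℂ[X]} (z : ℍ) (u : ℂ) :
    (biPoly K P z).eval u = homEval K P (z - conj (z : ℂ) * u) (1 - u) := by
  simp [biPoly, homEval, eval_finsetSum]

/-- The substitution X = (z - z̄u)/(1 - u), inverse to u = (X - z)/(X - z̄), turns X - p into ((z -
p) - (z̄ - p)u)/(1 - u). -/
theorem biPoly_X_sub_C_pow {K m : ℕ} (hm : m ≤ K) (p : ℂ) (z : ℍ) :
    biPoly K ((X - C p) ^ m) z =
      (C ((z : ℂ) - p) - C (conj (z : ℂ) - p) * X) ^ m * (1 - X) ^ (K - m) := by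
  refine polynomial_ext_of_upperHalfPlane fun u => ?_
  have hu : (1 : ℂ) - u ≠ 0 := by
    intro h
    have := congrArg Complex.im h
    simp at this
    exact u.im_ne_zero this
  have hdeg : ((X - C p) ^ m : ℂ[X]).natDegree ≤ K :=
    (natDegree_pow_le_of_le m (natDegree_X_sub_C_le p)).trans (by simpa using hm)
  rw [eval_biPoly, homEval_eq hdeg _ hu]
  simp only [eval_pow, eval_mul, eval_sub, eval_X, eval_C, eval_one]
  have hK : (1 - (u : ℂ)) ^ K = (1 - (u : ℂ)) ^ m * (1 - (u : ℂ)) ^ (K - m) := by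
    rw [← pow_add]; congr 1; omega
  rw [hK, mul_right_comm, ← mul_pow]
  congr 2
  field_simp
  ring

theorem biCoeff_add (K : ℕ) (P Q : ℂ[X]) (i : ℕ) (z : ℍ) :
    biCoeff K (P + Q) i z = biCoeff K P i z + biCoeff K Q i z := by
  simp only [biCoeff, biPoly, coeff_add, C_add, add_mul, Finset.sum_add_distrib, add_div]

theorem biCoeff_C_mul (K : ℕ) (c : ℂ) (P : ℂ[X]) (i : ℕ) (z : ℍ) :
    biCoeff K (C c * P) i z = c * biCoeff K P i z := by
  simp only [biCoeff, biPoly, coeff_C_mul, C_mul, mul_assoc, ← Finset.mul_sum, mul_div_assoc]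

theorem biCoeff_sum {ι : Type*} (K : ℕ) (t : Finset ι) (P : ι → ℂ[X]) (i : ℕ) (z : ℍ) :
    biCoeff K (∑ j ∈ t, P j) i z = ∑ j ∈ t, biCoeff K (P j) i z := by
  classical
  induction t using Finset.induction_on with
  | empty => simp [biCoeff, biPoly]
  | insert a t ha ih => rw [Finset.sum_insert ha, biCoeff_add, ih, Finset.sum_insert ha]

theorem biCoeff_eq_sum (K : ℕ) (P : ℂ[X]) (i : ℕ) (z : ℍ) :
    biCoeff K P i z = ∑ n ∈ Finset.range (K + 1), P.coeff n *
      (((C (z : ℂ) - C (conj (z : ℂ)) * X) ^ n * (1 - X) ^ (K - n)).coeff i /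
        ((z : ℂ) - conj (z : ℂ)) ^ K) := by
  simp only [biCoeff, biPoly, finsetSum_coeff, mul_assoc, coeff_C_mul, Finset.sum_div,
    mul_div_assoc]

/-- The binomial theorem separates the dependence on A and D from universal constants. It is applied
with A = z - p and D = z̄ - p. -/
theorem coeff_biPoly_X_sub_C_pow (K m i : ℕ) (A D : ℂ) :
    ((C A - C D * X) ^ m * (1 - X) ^ (K - m) : ℂ[X]).coeff i =
      ∑ a ∈ Finset.range (m + 1), A ^ (m - a) * D ^ a *
        ((-1) ^ a * (m.choose a : ℂ) * ((X ^ a * (1 - X) ^ (K - m) : ℂ[X]).coeff i)) := by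
  have : (C A - C D * X : ℂ[X]) ^ m = ∑ a ∈ Finset.range (m + 1),
      C (A ^ (m - a) * D ^ a * ((-1) ^ a * (m.choose a : ℂ))) * X ^ a := by
    rw [sub_eq_add_neg, add_comm, add_pow]
    refine Finset.sum_congr rfl fun a _ => ?_
    simp only [C_mul, C_pow, C_neg, C_1, map_natCast]
    rw [neg_pow, mul_pow]
    ring
  rw [this, Finset.sum_mul, finsetSum_coeff]
  refine Finset.sum_congr rfl fun a _ => ?_
  rw [mul_assoc, coeff_C_mul]
  ring

/-! ### Moment polynomials -/

/-- `∫_0^∞ f(t) (p + i t - X)^K i dt`, coefficient by coefficient. -/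
def momPoly (K : ℕ) (p : ℂ) (f : ℝ → ℂ) : ℂ[X] :=
  ∑ n ∈ Finset.range (K + 1), monomial n (∫ t : ℝ in Set.Ioi 0,
    f t * ((C (p + Complex.I * t) - X : ℂ[X]) ^ K).coeff n * Complex.I)

theorem natDegree_momPoly_le (K : ℕ) (p : ℂ) (f : ℝ → ℂ) : (momPoly K p f).natDegree ≤ K :=
  natDegree_sum_le_of_forall_le _ _ fun _ hn =>
    (natDegree_monomial_le _).trans (Nat.lt_succ_iff.mp (Finset.mem_range.mp hn))

/-- The moments `∫_0^∞ f(t) t^l dt`, with the factor `binom(K, l) i^{l+1}`. -/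
def moment (K : ℕ) (f : ℝ → ℂ) (l : ℕ) : ℂ :=
  (K.choose l : ℂ) * Complex.I ^ (l + 1) * ∫ t : ℝ in Set.Ioi 0, f t * (t : ℂ) ^ l

theorem coeff_sum_monomial (K : ℕ) (a : ℕ → ℂ) (n : ℕ) :
    (∑ m ∈ Finset.range (K + 1), monomial m (a m) : ℂ[X]).coeff n = if n ≤ K then a n else 0 := by
  simp only [finsetSum_coeff, coeff_monomial, Finset.sum_ite_eq', Finset.mem_range,
    Nat.lt_succ_iff]

theorem momPoly_eq (K : ℕ) (p : ℂ) {f : ℝ → ℂ} (hf : ∀ l ≤ K, MeasureTheory.IntegrableOn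
    (fun t : ℝ => f t * (t : ℂ) ^ l) (Set.Ioi 0)) :
    momPoly K p f = ∑ l ∈ Finset.range (K + 1), C (moment K f l * (-1) ^ (K - l)) *
      (X - C p) ^ (K - l) := by
  have hneg : ∀ l : ℕ, (C p - X : ℂ[X]) ^ l = C ((-1) ^ l) * (X - C p) ^ l := by
    intro l
    rw [C_pow, ← mul_pow]
    simp
  ext n
  rw [momPoly, coeff_sum_monomial]
  split_ifs with hn
  · have e : ∀ t : ℝ, f t * ((C (p + Complex.I * t) - X : ℂ[X]) ^ K).coeff n * Complex.I =
        ∑ l ∈ Finset.range (K + 1), (f t * (t : ℂ) ^ l) * ((K.choose l : ℂ) *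
          Complex.I ^ (l + 1) * ((C p - X : ℂ[X]) ^ (K - l)).coeff n) := by
      intro t
      have : (C (p + Complex.I * t) - X : ℂ[X]) = C (Complex.I * t) + (C p - X) := by
        rw [C_add]; ring
      rw [this, add_pow, finsetSum_coeff, Finset.mul_sum, Finset.sum_mul]
      refine Finset.sum_congr rfl fun l _ => ?_
      rw [← C_pow, ← C_eq_natCast, coeff_mul_C, coeff_C_mul]
      ring
    simp only [e]
    rw [MeasureTheory.integral_finsetSum _ fun l hl => (hf l
      (Nat.lt_succ_iff.mp (Finset.mem_range.mp hl))).mul_const _, finsetSum_coeff]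
    refine Finset.sum_congr rfl fun l _ => ?_
    rw [MeasureTheory.integral_mul_const, C_mul, mul_assoc (C _), ← hneg, coeff_C_mul, moment]
    ring
  · rw [coeff_eq_zero_of_natDegree_lt]
    refine lt_of_le_of_lt ?_ (not_le.mp hn)
    refine natDegree_sum_le_of_forall_le _ _ fun l _ => ?_
    refine (natDegree_C_mul_le _ _).trans ?_
    exact (natDegree_pow_le_of_le _ (natDegree_X_sub_C_le p)).trans (by omega)

theorem homEval_momPoly (K : ℕ) (p : ℂ) {f : ℝ → ℂ} (hf : ∀ l ≤ K, MeasureTheory.IntegrableOn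
    (fun t : ℝ => f t * (t : ℂ) ^ l) (Set.Ioi 0)) (U : ℂ) {V : ℂ} (hV : V ≠ 0) :
    homEval K (momPoly K p f) U V =
      ∑ l ∈ Finset.range (K + 1), moment K f l * (p * V - U) ^ (K - l) * V ^ l := by
  rw [homEval_eq (natDegree_momPoly_le K p f) _ hV, momPoly_eq K p hf, eval_finsetSum,
    Finset.mul_sum]
  refine Finset.sum_congr rfl fun l hl => ?_
  have hl' : l ≤ K := Nat.lt_succ_iff.mp (Finset.mem_range.mp hl)
  have hK : V ^ K = V ^ (K - l) * V ^ l := by rw [← pow_add]; congr 1; omega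
  simp only [eval_mul, eval_C, eval_pow, eval_sub, eval_X]
  rw [hK]
  have e : (p * V - U) ^ (K - l) = V ^ (K - l) * ((-1) ^ (K - l) * (U / V - p) ^ (K - l)) := by
    rw [← mul_pow, ← mul_pow]
    congr 1
    field_simp
    ring
  rw [e]
  ring

/-! ### Holomorphic functions of `q` that vanish at the cusp and their Eichler primitives -/

/-- Holomorphic functions on the unit disc that vanish at the origin. -/
def DiscCusp (g : ℂ → ℂ) : Prop := DiscHol g ∧ g 0 = 0

/-- The quotient g(q)/q extends holomorphically over the origin and is bounded on smaller discs. -/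
theorem DiscCusp.exists_bound {g : ℂ → ℂ} (hg : DiscCusp g) {ρ : ℝ} (hρ : ρ < 1) :
    ∃ M : ℝ, 0 ≤ M ∧ ∀ q : ℂ, ‖q‖ ≤ ρ → ‖g q‖ ≤ M * ‖q‖ := by
  have h1 : DiscHol (dslope g 0) :=
    (Complex.differentiableOn_dslope (Metric.ball_mem_nhds 0 one_pos)).mpr hg.1
  obtain ⟨M, hM, h⟩ := h1.exists_bound hρ
  refine ⟨M, hM, fun q hq => ?_⟩
  have e : g q = dslope g 0 q * q := by
    have := sub_smul_dslope g 0 q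
    rw [hg.2, sub_zero, sub_zero, smul_eq_mul] at this
    rw [← this, mul_comm]
  rw [e, norm_mul]
  exact mul_le_mul_of_nonneg_right (h q hq) (norm_nonneg q)

theorem exists_primitive {g : ℂ → ℂ} (hg : DiscCusp g) :
    ∃ G : ℂ → ℂ, DiscCusp G ∧ ∀ q : ℂ, ‖q‖ < 1 → deriv G q * q = g q := by
  have h1 : DiscHol (dslope g 0) :=
    (Complex.differentiableOn_dslope (Metric.ball_mem_nhds 0 one_pos)).mpr hg.1
  obtain ⟨G, h0, hG⟩ := (h1.isExactOn_ball).with_val_at 0 0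
  refine ⟨G, ⟨fun q hq => (hG q hq).differentiableAt.differentiableWithinAt, h0⟩, fun q hq => ?_⟩
  rw [(hG q (by simpa using hq)).deriv]
  have := sub_smul_dslope g 0 q
  rw [hg.2, sub_zero, sub_zero, smul_eq_mul] at this
  rw [← this, mul_comm]

open Classical in
/-- The primitive of `g(q) dq / q` that vanishes at the origin. -/
def qPrim (g : ℂ → ℂ) : ℂ → ℂ :=
  if hg : DiscCusp g then (exists_primitive hg).choose else 0

theorem DiscCusp.qPrim {g : ℂ → ℂ} (hg : DiscCusp g) : DiscCusp (qPrim g) := by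
  rw [RAIter.qPrim, dif_pos hg]
  exact (exists_primitive hg).choose_spec.1

theorem DiscCusp.deriv_qPrim {g : ℂ → ℂ} (hg : DiscCusp g) {q : ℂ} (hq : ‖q‖ < 1) :
    deriv (RAIter.qPrim g) q * q = g q := by
  rw [RAIter.qPrim, dif_pos hg]
  exact (exists_primitive hg).choose_spec.2 q hq

/-- The iterated primitives `g_0 = g`, `q g_{l+1}' = g_l`. -/
def iterPrim (g : ℂ → ℂ) : ℕ → ℂ → ℂ
  | 0 => g
  | l + 1 => qPrim (iterPrim g l)

theorem DiscCusp.iterPrim {g : ℂ → ℂ} (hg : DiscCusp g) (l : ℕ) : DiscCusp (iterPrim g l) := by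
  induction l with
  | zero => exact hg
  | succ l ih => exact ih.qPrim

/-- The integrand `t ↦ g(q e^{-2πt})`. -/
def ray (g : ℂ → ℂ) (q : ℂ) (t : ℝ) : ℂ := g (q * Complex.exp (-2 * Real.pi * t))

theorem norm_ray_point (q : ℂ) (t : ℝ) :
    ‖q * Complex.exp (-2 * Real.pi * t)‖ = ‖q‖ * Real.exp (-2 * Real.pi * t) := by
  rw [norm_mul, Complex.norm_exp]
  congr 2
  simp

theorem norm_ray_point_le (q : ℂ) {t : ℝ} (ht : 0 ≤ t) :
    ‖q * Complex.exp (-2 * Real.pi * t)‖ ≤ ‖q‖ := by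
  rw [norm_ray_point]
  refine mul_le_of_le_one_right (norm_nonneg q) (Real.exp_le_one_iff.mpr ?_)
  have := Real.pi_pos
  nlinarith

theorem hasDerivAt_ray_qPrim {g : ℂ → ℂ} (hg : DiscCusp g) {q : ℂ} (hq : ‖q‖ < 1) {t : ℝ}
    (ht : 0 ≤ t) : HasDerivAt (ray (qPrim g) q) (-2 * Real.pi * ray g q t) t := by
  have hlt := (norm_ray_point_le q ht).trans_lt hq
  have h1 : HasDerivAt (fun t : ℝ => q * Complex.exp (-2 * Real.pi * (t : ℂ)))
      (q * (Complex.exp (-2 * Real.pi * t) * (-2 * Real.pi * 1))) t :=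
    (((hasDerivAt_id (t : ℂ)).comp_ofReal.const_mul (-2 * Real.pi : ℂ)).cexp).const_mul q
  have h2 := (hg.qPrim.1.differentiableAt hlt).hasDerivAt.comp t h1
  refine h2.congr_deriv ?_
  rw [ray, ← hg.deriv_qPrim hlt]
  ring

theorem continuousOn_ray {g : ℂ → ℂ} (hg : DiscHol g) {q : ℂ} (hq : ‖q‖ < 1) :
    ContinuousOn (ray g q) (Set.Ici 0) := by
  refine hg.continuousOn.comp (by fun_prop) fun t ht => ?_
  simpa using (norm_ray_point_le q ht).trans_lt hq

theorem integrableOn_pow_mul_exp (l : ℕ) :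
    MeasureTheory.IntegrableOn (fun t : ℝ => t ^ l * Real.exp (-2 * Real.pi * t)) (Set.Ioi 0) := by
  have h := Real.GammaIntegral_convergent (s := l + 1) (by positivity)
  refine MeasureTheory.Integrable.mono' h (by fun_prop) ?_
  filter_upwards [MeasureTheory.ae_restrict_mem measurableSet_Ioi] with t ht
  have ht' : (0 : ℝ) < t := ht
  rw [Real.norm_of_nonneg (by positivity), add_sub_cancel_right, Real.rpow_natCast, mul_comm]
  refine mul_le_mul_of_nonneg_right (Real.exp_le_exp.mpr ?_) (by positivity)
  have := Real.pi_gt_three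
  nlinarith

theorem exists_bound_ray {g : ℂ → ℂ} (hg : DiscCusp g) {q : ℂ} (hq : ‖q‖ < 1) :
    ∃ M : ℝ, 0 ≤ M ∧ ∀ t : ℝ, 0 ≤ t → ‖ray g q t‖ ≤ M * Real.exp (-2 * Real.pi * t) := by
  obtain ⟨M, hM, h⟩ := hg.exists_bound hq
  refine ⟨M * ‖q‖, by positivity, fun t ht => ?_⟩
  refine (h _ (norm_ray_point_le q ht)).trans (le_of_eq ?_)
  rw [norm_ray_point]
  ring

theorem integrableOn_ray {g : ℂ → ℂ} (hg : DiscCusp g) {q : ℂ} (hq : ‖q‖ < 1) (l : ℕ) :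
    MeasureTheory.IntegrableOn (fun t : ℝ => ray g q t * (t : ℂ) ^ l) (Set.Ioi 0) := by
  obtain ⟨M, hM, h⟩ := exists_bound_ray hg hq
  refine MeasureTheory.Integrable.mono' ((integrableOn_pow_mul_exp l).const_mul M) ?_ ?_
  · refine ContinuousOn.aestronglyMeasurable ?_ measurableSet_Ioi
    exact ((continuousOn_ray hg.1 hq).mono Set.Ioi_subset_Ici_self).mul (by fun_prop)
  · filter_upwards [MeasureTheory.ae_restrict_mem measurableSet_Ioi] with t ht
    have ht' : (0 : ℝ) < t := ht
    rw [norm_mul, norm_pow, Complex.norm_real, Real.norm_of_nonneg ht'.le]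
    have := mul_le_mul_of_nonneg_right (h t ht'.le) (show (0 : ℝ) ≤ t ^ l by positivity)
    linarith

theorem tendsto_ray {g : ℂ → ℂ} (hg : DiscCusp g) {q : ℂ} (hq : ‖q‖ < 1) (l : ℕ) :
    Filter.Tendsto (fun t : ℝ => ray g q t * (t : ℂ) ^ l) Filter.atTop (nhds 0) := by
  obtain ⟨M, hM, h⟩ := exists_bound_ray hg hq
  have h1 := (Real.tendsto_pow_mul_exp_neg_atTop_nhds_zero l).const_mul M
  rw [mul_zero] at h1
  refine squeeze_zero_norm' ?_ h1
  filter_upwards [Filter.eventually_ge_atTop 0] with t ht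
  rw [norm_mul, norm_pow, Complex.norm_real, Real.norm_of_nonneg ht]
  have hexp : Real.exp (-2 * Real.pi * t) ≤ Real.exp (-t) := by
    refine Real.exp_le_exp.mpr ?_
    have := Real.pi_gt_three
    nlinarith
  calc _ ≤ M * Real.exp (-t) * t ^ l := by gcongr; exact (h t ht).trans (by gcongr)
    _ = _ := by ring

/-- Integration by parts: the total derivative of t^m G(q e^{-2πt}), with G the primitive of g dq/q,
is integrated over the half-line. The boundary term at 0 is present only for m = 0, which the factor
0^m records; in that case the truncated exponent m - 1 is multiplied by 0. -/
theorem integral_ray_succ {g : ℂ → ℂ} (hg : DiscCusp g) {q : ℂ} (hq : ‖q‖ < 1) (m : ℕ) :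
    -2 * Real.pi * (∫ t : ℝ in Set.Ioi 0, ray g q t * (t : ℂ) ^ m) +
      m * (∫ t : ℝ in Set.Ioi 0, ray (qPrim g) q t * (t : ℂ) ^ (m - 1)) =
      -(qPrim g q * (0 : ℂ) ^ m) := by
  have h0 : ray (qPrim g) q 0 = qPrim g q := by simp [ray]
  have hder : ∀ t ∈ Set.Ici (0 : ℝ), HasDerivAt (fun t : ℝ => ray (qPrim g) q t * (t : ℂ) ^ m)
      (-2 * Real.pi * (ray g q t * (t : ℂ) ^ m) +
        m * (ray (qPrim g) q t * (t : ℂ) ^ (m - 1))) t := by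
    intro t ht
    have hpow : HasDerivAt (fun t : ℝ => (t : ℂ) ^ m) ((m : ℂ) * (t : ℂ) ^ (m - 1)) t :=
      (hasDerivAt_pow m (t : ℂ)).comp_ofReal
    refine ((hasDerivAt_ray_qPrim hg hq ht).mul hpow).congr_deriv ?_
    ring
  have i1 := (integrableOn_ray hg hq m).const_mul (-2 * Real.pi : ℂ)
  have i2 := (integrableOn_ray hg.qPrim hq (m - 1)).const_mul (m : ℂ)
  have := MeasureTheory.integral_Ioi_of_hasDerivAt_of_tendsto' hder (i1.add i2)
    (tendsto_ray hg.qPrim hq m)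
  rw [MeasureTheory.integral_add i1 i2, MeasureTheory.integral_const_mul,
    MeasureTheory.integral_const_mul, h0, zero_sub] at this
  simpa using this

theorem iterPrim_qPrim (g : ℂ → ℂ) (m : ℕ) : iterPrim (qPrim g) m = iterPrim g (m + 1) := by
  induction m with
  | zero => rfl
  | succ m ih => rw [iterPrim, ih]; rfl

theorem integral_ray {g : ℂ → ℂ} (hg : DiscCusp g) {q : ℂ} (hq : ‖q‖ < 1) (l : ℕ) :
    ∫ t : ℝ in Set.Ioi 0, ray g q t * (t : ℂ) ^ l =
      (l.factorial : ℂ) / (2 * Real.pi) ^ (l + 1) * iterPrim g (l + 1) q := by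
  have hpi : (Real.pi : ℂ) ≠ 0 := by exact_mod_cast Real.pi_ne_zero
  induction l generalizing g with
  | zero =>
    have := integral_ray_succ hg hq 0
    simp only [Nat.cast_zero, zero_mul, add_zero, pow_zero, mul_one] at this
    simp only [pow_zero, mul_one, Nat.factorial_zero, Nat.cast_one, zero_add, pow_one, iterPrim]
    field_simp
    linear_combination -this
  | succ l ih =>
    have := integral_ray_succ hg hq (l + 1)
    rw [Nat.add_sub_cancel, zero_pow (Nat.succ_ne_zero l), mul_zero, neg_zero, ih hg.qPrim,
      iterPrim_qPrim] at this
    rw [Nat.factorial_succ, pow_succ _ (l + 1)]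
    push_cast at this ⊢
    field_simp at this ⊢
    linear_combination -this

/-! ### Cusp forms as functions of `q`, and their Eichler integrals -/

section CuspForm

variable {k : ℤ} (h : CuspForm 𝒮ℒ k)

/-- A cusp form as a function of `q`. -/
def cuspQ : ℂ → ℂ := cuspFunction 1 h

theorem discCusp_cuspQ : DiscCusp (cuspQ h) :=
  ⟨fun q hq => (ModularFormClass.differentiableAt_cuspFunction h one_pos one_mem_strictPeriods_SL
    (by simpa using hq)).differentiableWithinAt,
    CuspFormClass.cuspFunction_apply_zero h one_pos one_mem_strictPeriods_SL⟩

theorem cuspForm_eq (z : ℍ) : h z = cuspQ h (qpar z) := by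
  have := SlashInvariantFormClass.eq_cuspFunction h z one_mem_strictPeriods_SL one_ne_zero
  rw [← this, cuspQ, qpar, Function.Periodic.qParam]
  simp

theorem cuspForm_smul (γ : SL(2, ℤ)) (z : ℍ) : h (γ • z) = jfac γ z ^ k * h z := by
  have := SlashInvariantForm.slash_action_eqn' h
    (show Matrix.SpecialLinearGroup.mapGL ℝ γ ∈ 𝒮ℒ from ⟨γ, rfl⟩) z
  simpa [jfac] using! this

/-- The iterated primitives of a cusp form. -/
def cuspPrim (l : ℕ) (z : ℍ) : ℂ := iterPrim (cuspQ h) l (qpar z)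

theorem cuspPrim_zero (z : ℍ) : cuspPrim h 0 z = h z := (cuspForm_eq h z).symm

theorem hasDerivAt_cuspPrim (l : ℕ) (z : ℍ) :
    HasDerivAt (fun w => cuspPrim h (l + 1) (ofComplex w))
      (2 * Real.pi * Complex.I * cuspPrim h l z) z := by
  have hc := (discCusp_cuspQ h).iterPrim l
  have h1 := hasDerivAt_comp_qpar hc.qPrim.1 z
  refine (h1.congr_deriv ?_).congr_of_eventuallyEq ?_
  · rw [cuspPrim, ← hc.deriv_qPrim (norm_qpar_lt_one z)]
    ring
  · filter_upwards [eventually_ofComplex z] with w hw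
    rw [cuspPrim, iterPrim, qpar, hw]

theorem ray_cuspQ (z : ℍ) {t : ℝ} (ht : 0 ≤ t) :
    h (ofComplex ((z : ℂ) + Complex.I * t)) = ray (cuspQ h) (qpar z) t := by
  have him : 0 < ((z : ℂ) + Complex.I * t).im := by
    have := z.im_pos
    simp
    positivity
  rw [ofComplex_apply_of_im_pos him, cuspForm_eq, ray, qpar, qpar, ← Complex.exp_add]
  congr 2
  show 2 * Real.pi * Complex.I * ((z : ℂ) + Complex.I * t) = _
  linear_combination (2 * Real.pi * t : ℂ) * Complex.I_mul_I

theorem eichler_eq_momPoly (K : ℕ) (z : ℍ) :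
    eichler K h z = -momPoly K z (ray (cuspQ h) (qpar z)) := by
  rw [eichler, momPoly, ← Finset.sum_neg_distrib]
  refine Finset.sum_congr rfl fun n _ => ?_
  rw [← LinearMap.map_neg]
  congr 2
  refine MeasureTheory.setIntegral_congr_fun measurableSet_Ioi fun t ht => ?_
  simp only [ray_cuspQ h z (le_of_lt (show (0 : ℝ) < t from ht))]

theorem integrableOn_ray_cuspQ (z : ℍ) (l : ℕ) : MeasureTheory.IntegrableOn
    (fun t : ℝ => ray (cuspQ h) (qpar z) t * (t : ℂ) ^ l) (Set.Ioi 0) :=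
  integrableOn_ray (discCusp_cuspQ h) (norm_qpar_lt_one z) l

theorem natDegree_eichler_le (K : ℕ) (z : ℍ) : (eichler K h z).natDegree ≤ K := by
  rw [eichler_eq_momPoly, natDegree_neg]
  exact natDegree_momPoly_le _ _ _

/-- The constants `binom(K, l) i^{l+1} l! (2π)^{-l-1}`. -/
def eichlerConst (K l : ℕ) : ℂ :=
  (K.choose l : ℂ) * Complex.I ^ (l + 1) * ((l.factorial : ℂ) / (2 * Real.pi) ^ (l + 1))

theorem moment_cuspQ (K l : ℕ) (z : ℍ) :
    moment K (ray (cuspQ h) (qpar z)) l = eichlerConst K l * cuspPrim h (l + 1) z := by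
  rw [moment, integral_ray (discCusp_cuspQ h) (norm_qpar_lt_one z), eichlerConst, cuspPrim]
  ring

theorem eichler_eq (K : ℕ) (z : ℍ) : eichler K h z = ∑ l ∈ Finset.range (K + 1),
    C (-(eichlerConst K l * cuspPrim h (l + 1) z * (-1) ^ (K - l))) * (X - C (z : ℂ)) ^ (K - l) := by
  rw [eichler_eq_momPoly, momPoly_eq K _ fun l _ => integrableOn_ray_cuspQ h z l,
    ← Finset.sum_neg_distrib]
  refine Finset.sum_congr rfl fun l _ => ?_
  rw [moment_cuspQ, C_neg, neg_mul]

theorem homEval_neg (K : ℕ) (P : ℂ[X]) (U V : ℂ) : homEval K (-P) U V = -homEval K P U V := by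
  simpa using homEval_C_mul K (-1) P U V

theorem homEval_eichler (K : ℕ) (z : ℍ) (U : ℂ) {V : ℂ} (hV : V ≠ 0) :
    homEval K (eichler K h z) U V = -∑ l ∈ Finset.range (K + 1),
      eichlerConst K l * cuspPrim h (l + 1) z * (z * V - U) ^ (K - l) * V ^ l := by
  rw [eichler_eq_momPoly, homEval_neg,
    homEval_momPoly K _ (fun l _ => integrableOn_ray_cuspQ h z l) U hV]
  simp only [moment_cuspQ]

/-- This ratio of consecutive constants makes the derivative of the Eichler integral telescope. -/
theorem eichlerConst_succ (K l : ℕ) :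
    eichlerConst K (l + 1) * (2 * Real.pi * Complex.I) = -eichlerConst K l * (K - l : ℕ) := by
  have hpi : (Real.pi : ℂ) ≠ 0 := by exact_mod_cast Real.pi_ne_zero
  have hch : (K.choose (l + 1) : ℂ) * (l + 1) = K.choose l * (K - l : ℕ) := by
    exact_mod_cast Nat.choose_succ_right_eq K l
  rw [eichlerConst, eichlerConst, Nat.factorial_succ, pow_succ _ (l + 1), pow_succ _ (l + 1)]
  push_cast
  field_simp
  linear_combination (-(l.factorial : ℂ)) * hch +
    (K.choose (l + 1) : ℂ) * (l + 1) * (l.factorial : ℂ) * Complex.I_sq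

theorem eichlerConst_zero (K : ℕ) : eichlerConst K 0 * (2 * Real.pi * Complex.I) = -1 := by
  have hpi : (Real.pi : ℂ) ≠ 0 := by exact_mod_cast Real.pi_ne_zero
  simp only [eichlerConst, Nat.choose_zero_right, Nat.factorial_zero,
    Nat.cast_one, zero_add, pow_one]
  field_simp
  exact Complex.I_sq

/-- In the derivative of ∑ const_l E_{l+1} A^{K-l} V^l, the term that differentiates A at l cancels
the one that differentiates E at l + 1. Only the derivative of E_1 survives. -/
theorem eichlerConst_telescope (K : ℕ) (E : ℕ → ℂ) (A V : ℂ) :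
    ∑ l ∈ Finset.range (K + 1), (eichlerConst K l * (2 * Real.pi * Complex.I * E l) * A ^ (K - l) +
      eichlerConst K l * E (l + 1) * (((K - l : ℕ) : ℂ) * A ^ (K - l - 1) * V)) * V ^ l =
    -(E 0 * A ^ K) := by
  simp only [add_mul, Finset.sum_add_distrib]
  rw [Finset.sum_range_succ', Finset.sum_range_succ _ K]
  have : ∀ l ∈ Finset.range K, eichlerConst K (l + 1) *
      (2 * Real.pi * Complex.I * E (l + 1)) * A ^ (K - (l + 1)) * V ^ (l + 1) =
      -(eichlerConst K l * E (l + 1) * (((K - l : ℕ) : ℂ) * A ^ (K - l - 1) * V) * V ^ l) := by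
    intro l _
    rw [← mul_assoc, eichlerConst_succ, Nat.sub_sub]
    ring
  rw [Finset.sum_congr rfl this, Finset.sum_neg_distrib, Nat.sub_self]
  simp only [Nat.sub_zero, pow_zero, mul_one, Nat.cast_zero, zero_mul, mul_zero, add_zero]
  linear_combination E 0 * A ^ K * eichlerConst_zero K

theorem hasDerivAt_homEval_eichler (K : ℕ) (z : ℍ) (U : ℂ) {V : ℂ} (hV : V ≠ 0) :
    HasDerivAt (fun w => homEval K (eichler K h (ofComplex w)) U V)
      (h z * (z * V - U) ^ K) z := by
  have hpow : ∀ m : ℕ, HasDerivAt (fun w : ℂ => (w * V - U) ^ m)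
      ((m : ℂ) * ((z : ℂ) * V - U) ^ (m - 1) * V) z := by
    intro m
    have h1 : HasDerivAt (fun w : ℂ => w * V - U) V z := by
      simpa using ((hasDerivAt_id (z : ℂ)).mul_const V).sub_const U
    exact h1.fun_pow m
  have h1 : HasDerivAt (fun w : ℂ => -∑ l ∈ Finset.range (K + 1),
      eichlerConst K l * cuspPrim h (l + 1) (ofComplex w) * (w * V - U) ^ (K - l) * V ^ l)
      (-∑ l ∈ Finset.range (K + 1), (eichlerConst K l * (2 * Real.pi * Complex.I * cuspPrim h l z) *
        (z * V - U) ^ (K - l) + eichlerConst K l * cuspPrim h (l + 1) z *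
        (((K - l : ℕ) : ℂ) * ((z : ℂ) * V - U) ^ (K - l - 1) * V)) * V ^ l) z := by
    refine (HasDerivAt.fun_sum fun l _ => ?_).fun_neg
    have := (((hasDerivAt_cuspPrim h l z).const_mul (eichlerConst K l)).fun_mul
      (hpow (K - l))).mul_const (V ^ l)
    simpa only [ofComplex_apply] using this
  refine (h1.congr_deriv ?_).congr_of_eventuallyEq ?_
  · rw [eichlerConst_telescope K (fun l => cuspPrim h l z), cuspPrim_zero, neg_neg]
  · filter_upwards [eventually_ofComplex z] with w hw
    rw [homEval_eichler h K _ U hV, hw]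

end CuspForm

/-! ### Bounds for period integrals -/

section Period

variable {k : ℤ} {K : ℕ}

theorem exists_bound_cuspForm_of_one_le (h : CuspForm 𝒮ℒ k) :
    ∃ M : ℝ, 0 ≤ M ∧ ∀ z : ℍ, 1 ≤ z.im → ‖h z‖ ≤ M * Real.exp (-2 * Real.pi * z.im) := by
  obtain ⟨M, hM, hb⟩ := (discCusp_cuspQ h).exists_bound (exp_neg_two_pi_mul_lt_one one_pos)
  refine ⟨M, hM, fun z hz => ?_⟩
  rw [cuspForm_eq, ← norm_qpar]
  exact hb _ (norm_qpar_le_of_one_le hz)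

/-- For y ≥ 1 this is exponential decay; for y ≤ 1 it follows from the boundedness of y^{k/2} |h|
and from k/2 ≥ 1/2. The factor √y becomes t^{-1/2} under inversion, which is integrable at 0. -/
theorem exists_bound_cuspForm (hk : k = K + 2) (h : CuspForm 𝒮ℒ k) :
    ∃ M : ℝ, 0 ≤ M ∧ ∀ z : ℍ, ‖h z‖ * z.im ^ (K + 2) ≤ M * √z.im := by
  obtain ⟨M₁, hM₁, hb₁⟩ := exists_bound_cuspForm_of_one_le h
  obtain ⟨M₂, hb₂⟩ := CuspFormClass.exists_bound h
  refine ⟨max (M₁ * (K + 2).factorial) |M₂|, le_max_of_le_right (abs_nonneg _), fun z => ?_⟩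
  have hz := z.im_pos
  rcases le_total 1 z.im with h1 | h1
  · have e1 : z.im ^ (K + 2) / (K + 2).factorial ≤ Real.exp z.im :=
      Real.pow_div_factorial_le_exp _ hz.le _
    have e2 : Real.exp (-2 * Real.pi * z.im) * Real.exp z.im ≤ 1 := by
      rw [← Real.exp_add]
      refine Real.exp_le_one_iff.mpr ?_
      have := Real.pi_gt_three
      nlinarith
    rw [div_le_iff₀ (by positivity)] at e1
    have e3 : 1 ≤ √z.im := Real.one_le_sqrt.mpr h1
    calc ‖h z‖ * z.im ^ (K + 2)
        ≤ M₁ * Real.exp (-2 * Real.pi * z.im) * (Real.exp z.im * (K + 2).factorial) := by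
          gcongr
          exact hb₁ z h1
      _ = M₁ * (K + 2).factorial * (Real.exp (-2 * Real.pi * z.im) * Real.exp z.im) := by ring
      _ ≤ M₁ * (K + 2).factorial * √z.im := by
          gcongr
          exact e2.trans e3
      _ ≤ _ := by gcongr; exact le_max_left _ _
  · have e1 : z.im ^ (K + 2) = z.im ^ (k / 2 : ℝ) * z.im ^ (k / 2 : ℝ) := by
      rw [← Real.rpow_add hz, ← Real.rpow_natCast]
      congr 1
      rw [hk]
      push_cast
      ring
    have e2 : z.im ^ (k / 2 : ℝ) ≤ √z.im := by
      rw [Real.sqrt_eq_rpow]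
      refine Real.rpow_le_rpow_of_exponent_ge hz h1 ?_
      rw [hk]
      push_cast
      linarith [(Nat.cast_nonneg K : (0 : ℝ) ≤ K)]
    have e3 := hb₂ z
    rw [le_div_iff₀ (by positivity)] at e3
    calc ‖h z‖ * z.im ^ (K + 2) = ‖h z‖ * z.im ^ (k / 2 : ℝ) * z.im ^ (k / 2 : ℝ) := by
          rw [e1, mul_assoc]
      _ ≤ |M₂| * √z.im := by
          gcongr
          exact e3.trans (le_abs_self _)
      _ ≤ _ := by gcongr; exact le_max_right _ _

/-- The point `γ⁻¹ i∞ = -d / c`. -/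
def cuspPt (γ : SL(2, ℤ)) : ℂ := -(γ 1 1 : ℂ) / (γ 1 0 : ℂ)

theorem im_cuspPt (γ : SL(2, ℤ)) : (cuspPt γ).im = 0 := by
  have : cuspPt γ = ((-(γ 1 1 : ℝ) / (γ 1 0 : ℝ) : ℝ) : ℂ) := by
    rw [cuspPt]; push_cast; rfl
  rw [this, Complex.ofReal_im]

theorem coe_ofComplex_cuspPt (γ : SL(2, ℤ)) {t : ℝ} (ht : 0 < t) :
    ((ofComplex (cuspPt γ + Complex.I * t) : ℍ) : ℂ) = cuspPt γ + Complex.I * t := by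
  have him : 0 < (cuspPt γ + Complex.I * t).im := by simpa [im_cuspPt] using ht
  rw [ofComplex_apply_of_im_pos him]

theorem im_ofComplex_cuspPt (γ : SL(2, ℤ)) {t : ℝ} (ht : 0 < t) :
    (ofComplex (cuspPt γ + Complex.I * t) : ℍ).im = t := by
  rw [← coe_im, coe_ofComplex_cuspPt γ ht]
  simp [im_cuspPt]

theorem jfac_cuspPt {γ : SL(2, ℤ)} (hc : γ 1 0 ≠ 0) {t : ℝ} (ht : 0 < t) :
    jfac γ (ofComplex (cuspPt γ + Complex.I * t) : ℍ) = γ 1 0 * Complex.I * t := by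
  have hc' : (γ 1 0 : ℂ) ≠ 0 := by exact_mod_cast hc
  rw [coe_ofComplex_cuspPt γ ht, jfac, cuspPt]
  field_simp
  ring

theorem coe_smul_cuspPt {γ : SL(2, ℤ)} (hc : γ 1 0 ≠ 0) {t : ℝ} (ht : 0 < t) :
    ((γ • (ofComplex (cuspPt γ + Complex.I * t) : ℍ) : ℍ) : ℂ) =
      (γ 0 0 : ℂ) / γ 1 0 + Complex.I * (1 / ((γ 1 0 : ℝ) ^ 2 * t) : ℝ) := by
  have hc' : (γ 1 0 : ℂ) ≠ 0 := by exact_mod_cast hc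
  have ht' : (t : ℂ) ≠ 0 := by exact_mod_cast ht.ne'
  have hdet := det_eq_one γ
  rw [coe_smul_eq, jfac_cuspPt hc ht, coe_ofComplex_cuspPt γ ht, cuspPt]
  have hI := Complex.I_ne_zero
  push_cast
  field_simp
  linear_combination -hdet - Complex.I_sq

theorem im_smul_cuspPt {γ : SL(2, ℤ)} (hc : γ 1 0 ≠ 0) {t : ℝ} (ht : 0 < t) :
    (γ • (ofComplex (cuspPt γ + Complex.I * t) : ℍ) : ℍ).im = 1 / ((γ 1 0 : ℝ) ^ 2 * t) := by
  have e : (γ 0 0 : ℂ) / γ 1 0 + Complex.I * (1 / ((γ 1 0 : ℝ) ^ 2 * t) : ℝ) =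
      ((γ 0 0 / γ 1 0 : ℝ) : ℂ) + Complex.I * (1 / ((γ 1 0 : ℝ) ^ 2 * t) : ℝ) := by
    push_cast; rfl
  rw [← coe_im, coe_smul_cuspPt hc ht, e, Complex.add_im, Complex.ofReal_im, Complex.I_mul_im,
    Complex.ofReal_re, zero_add]

/-- The values of a cusp form on the vertical line above `γ⁻¹ i∞`. -/
def cuspLine (h : CuspForm 𝒮ℒ k) (γ : SL(2, ℤ)) (t : ℝ) : ℂ :=
  h (ofComplex (cuspPt γ + Complex.I * t))

/-- For t ≥ 1 the cusp form decays exponentially. For t ≤ 1 the point w of height t above -d/c is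
moved by γ to height 1/(c²t), with |j(γ, w)| = |c| t; the bound y^k |h| ≤ M√y there gives |h(w)| ≤ M
|c|^{K+1} t^{-1/2}. -/
theorem exists_bound_cuspLine (hk : k = K + 2) (h : CuspForm 𝒮ℒ k) :
    ∃ M : ℝ, 0 ≤ M ∧ ∀ γ : SL(2, ℤ), γ 1 0 ≠ 0 → ∀ t : ℝ, 0 < t →
      ‖cuspLine h γ t‖ ≤ M * |(γ 1 0 : ℝ)| ^ (K + 1) * (Real.exp (-t) / √t) := by
  obtain ⟨M₁, hM₁, hb₁⟩ := exists_bound_cuspForm_of_one_le h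
  obtain ⟨M₂, hM₂, hb₂⟩ := exists_bound_cuspForm hk h
  refine ⟨max M₁ (M₂ * Real.exp 1), le_max_of_le_left hM₁, fun γ hc t ht => ?_⟩
  have hc0 : 0 < |(γ 1 0 : ℝ)| := abs_pos.mpr (by exact_mod_cast hc)
  have hc1 : 1 ≤ |(γ 1 0 : ℝ)| := by exact_mod_cast Int.one_le_abs hc
  have hst : 0 < √t := Real.sqrt_pos.mpr ht
  rcases le_total 1 t with h1 | h1
  · have e1 := hb₁ (ofComplex (cuspPt γ + Complex.I * t))
    rw [im_ofComplex_cuspPt γ ht] at e1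
    have e2 : Real.exp (-2 * Real.pi * t) ≤ Real.exp (-t) / √t := by
      rw [le_div_iff₀ hst]
      have e3 : √t ≤ Real.exp t := by
        have : √t ≤ t := Real.sqrt_le_iff.mpr ⟨ht.le, by nlinarith⟩
        exact this.trans ((by linarith : t ≤ t + 1).trans (Real.add_one_le_exp t))
      calc Real.exp (-2 * Real.pi * t) * √t ≤ Real.exp (-2 * t) * Real.exp t := by
            gcongr
            nlinarith [Real.pi_gt_three]
        _ = Real.exp (-t) := by rw [← Real.exp_add]; ring_nf
    calc ‖cuspLine h γ t‖ ≤ M₁ * 1 * (Real.exp (-t) / √t) := by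
          rw [mul_one]
          exact (e1 h1).trans (by gcongr)
      _ ≤ _ := by
          gcongr
          · exact le_max_left _ _
          · exact one_le_pow₀ hc1
  · have e1 := hb₂ (γ • ofComplex (cuspPt γ + Complex.I * t))
    rw [cuspForm_smul, im_smul_cuspPt hc ht, jfac_cuspPt hc ht, norm_mul] at e1
    have e2 : ‖((γ 1 0 : ℂ) * Complex.I * t) ^ k‖ = (|(γ 1 0 : ℝ)| * t) ^ (K + 2) := by
      rw [show k = ((K + 2 : ℕ) : ℤ) by push_cast; exact hk, zpow_natCast, norm_pow, norm_mul,
        norm_mul, Complex.norm_I, Complex.norm_real, Real.norm_of_nonneg ht.le, mul_one]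
      congr 2
      exact Complex.norm_intCast _
    rw [e2, ← sq_abs] at e1
    have e3 : √(1 / (|(γ 1 0 : ℝ)| ^ 2 * t)) = 1 / (|(γ 1 0 : ℝ)| * √t) := by
      rw [Real.sqrt_div zero_le_one, Real.sqrt_one, Real.sqrt_mul (by positivity),
        Real.sqrt_sq hc0.le]
    rw [e3] at e1
    have e4 : (|(γ 1 0 : ℝ)| * t) ^ (K + 2) * (1 / (|(γ 1 0 : ℝ)| ^ 2 * t)) ^ (K + 2) =
        1 / |(γ 1 0 : ℝ)| ^ (K + 2) := by
      rw [← mul_pow, ← one_div_pow]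
      congr 1
      field_simp
    have e5 : ‖cuspLine h γ t‖ ≤ M₂ * |(γ 1 0 : ℝ)| ^ (K + 1) * (1 / √t) := by
      have e6 : ‖cuspLine h γ t‖ * (1 / |(γ 1 0 : ℝ)| ^ (K + 2)) ≤
          M₂ * (1 / (|(γ 1 0 : ℝ)| * √t)) := by
        rw [← e4]
        calc _ = _ := by rw [cuspLine]; ring
          _ ≤ _ := e1
      rw [mul_one_div, div_le_iff₀ (by positivity)] at e6
      refine e6.trans (le_of_eq ?_)
      field_simp
      ring
    -- For t ≤ 1 a factor e · e^{-t} ≥ 1 is inserted so that both ranges are dominated by one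
    -- kernel.
    have e7 : 1 ≤ Real.exp 1 * Real.exp (-t) := by
      rw [← Real.exp_add]
      exact Real.one_le_exp (by linarith)
    calc ‖cuspLine h γ t‖ ≤ M₂ * |(γ 1 0 : ℝ)| ^ (K + 1) * (1 / √t) := e5
      _ ≤ M₂ * |(γ 1 0 : ℝ)| ^ (K + 1) * ((Real.exp 1 * Real.exp (-t)) / √t) := by gcongr
      _ = M₂ * Real.exp 1 * |(γ 1 0 : ℝ)| ^ (K + 1) * (Real.exp (-t) / √t) := by ring
      _ ≤ _ := by gcongr; exact le_max_right _ _

/-- This is the integrand of Γ(l + 1/2). -/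
theorem integrableOn_gammaKernel (l : ℕ) : MeasureTheory.IntegrableOn
    (fun t : ℝ => Real.exp (-t) / √t * t ^ l) (Set.Ioi 0) := by
  refine (Real.GammaIntegral_convergent (s := l + 1 / 2) (by positivity)).congr_fun
    (fun t ht => ?_) measurableSet_Ioi
  have ht' : (0 : ℝ) < t := ht
  simp only
  rw [show (l : ℝ) + 1 / 2 - 1 = l - 1 / 2 by ring, Real.rpow_sub ht', Real.rpow_natCast,
    ← Real.sqrt_eq_rpow]
  ring

theorem continuousOn_cuspLine (h : CuspForm 𝒮ℒ k) (γ : SL(2, ℤ)) :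
    ContinuousOn (cuspLine h γ) (Set.Ioi 0) := by
  have e : Set.EqOn (cuspLine h γ) (fun t : ℝ => cuspQ h (Complex.exp (2 * Real.pi * Complex.I *
      (cuspPt γ + Complex.I * t)))) (Set.Ioi 0) := by
    intro t ht
    rw [cuspLine, cuspForm_eq, qpar, coe_ofComplex_cuspPt γ ht]
  refine ContinuousOn.congr ?_ e
  refine (discCusp_cuspQ h).1.continuousOn.comp (by fun_prop) fun t ht => ?_
  have := norm_qpar_lt_one (ofComplex (cuspPt γ + Complex.I * t))
  rw [qpar, coe_ofComplex_cuspPt γ ht] at this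
  simpa using this

theorem integrableOn_cuspLine (hk : k = K + 2) (h : CuspForm 𝒮ℒ k) {γ : SL(2, ℤ)}
    (hc : γ 1 0 ≠ 0) (l : ℕ) : MeasureTheory.IntegrableOn
      (fun t : ℝ => cuspLine h γ t * (t : ℂ) ^ l) (Set.Ioi 0) := by
  obtain ⟨M, hM, hb⟩ := exists_bound_cuspLine hk h
  refine MeasureTheory.Integrable.mono' ((integrableOn_gammaKernel l).const_mul
    (M * |(γ 1 0 : ℝ)| ^ (K + 1))) ?_ ?_
  · exact ((continuousOn_cuspLine h γ).mul (by fun_prop)).aestronglyMeasurable measurableSet_Ioi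
  · filter_upwards [MeasureTheory.ae_restrict_mem measurableSet_Ioi] with t ht
    have ht' : (0 : ℝ) < t := ht
    rw [norm_mul, norm_pow, Complex.norm_real, Real.norm_of_nonneg ht'.le, ← mul_assoc]
    gcongr
    exact hb γ hc t ht

theorem exists_bound_moment_cuspLine (hk : k = K + 2) (h : CuspForm 𝒮ℒ k) (l : ℕ) :
    ∃ M : ℝ, ∀ γ : SL(2, ℤ), γ 1 0 ≠ 0 →
      ‖moment K (cuspLine h γ) l‖ ≤ M * |(γ 1 0 : ℝ)| ^ (K + 1) := by
  obtain ⟨M, hM, hb⟩ := exists_bound_cuspLine hk h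
  refine ⟨(K.choose l : ℝ) * (M * ∫ t : ℝ in Set.Ioi 0, Real.exp (-t) / √t * t ^ l),
    fun γ hc => ?_⟩
  have e : ‖∫ t : ℝ in Set.Ioi 0, cuspLine h γ t * (t : ℂ) ^ l‖ ≤
      ∫ t : ℝ in Set.Ioi 0, M * |(γ 1 0 : ℝ)| ^ (K + 1) * (Real.exp (-t) / √t * t ^ l) := by
    refine MeasureTheory.norm_integral_le_of_norm_le ((integrableOn_gammaKernel l).const_mul _) ?_
    filter_upwards [MeasureTheory.ae_restrict_mem measurableSet_Ioi] with t ht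
    have ht' : (0 : ℝ) < t := ht
    rw [norm_mul, norm_pow, Complex.norm_real, Real.norm_of_nonneg ht'.le, ← mul_assoc]
    gcongr
    exact hb γ hc t ht
  rw [MeasureTheory.integral_const_mul] at e
  rw [moment, norm_mul, norm_mul, norm_pow, Complex.norm_I, one_pow, mul_one, Complex.norm_natCast]
  calc _ ≤ (K.choose l : ℝ) * _ := mul_le_mul_of_nonneg_left e (by positivity)
    _ = _ := by ring

end Period

/-! ### The cocycle relation between Eichler integrals and periods -/

section Cocycle

variable {k : ℤ} {K : ℕ}

theorem eval_momPoly (K : ℕ) (p : ℂ) {f : ℝ → ℂ} (hf : ∀ l ≤ K, MeasureTheory.IntegrableOn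
    (fun t : ℝ => f t * (t : ℂ) ^ l) (Set.Ioi 0)) (x : ℂ) :
    MeasureTheory.IntegrableOn (fun t : ℝ => Complex.I * (f t * (p + Complex.I * t - x) ^ K))
      (Set.Ioi 0) ∧
    (momPoly K p f).eval x =
      ∫ t : ℝ in Set.Ioi 0, Complex.I * (f t * (p + Complex.I * t - x) ^ K) := by
  have e : ∀ t : ℝ, Complex.I * (f t * (p + Complex.I * t - x) ^ K) =
      ∑ l ∈ Finset.range (K + 1), (K.choose l : ℂ) * Complex.I ^ (l + 1) * (p - x) ^ (K - l) *
        (f t * (t : ℂ) ^ l) := by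
    intro t
    rw [show p + Complex.I * t - x = Complex.I * t + (p - x) by ring, add_pow, Finset.mul_sum,
      Finset.mul_sum]
    refine Finset.sum_congr rfl fun l _ => ?_
    ring
  have hi : ∀ l ∈ Finset.range (K + 1), MeasureTheory.IntegrableOn (fun t : ℝ =>
      (K.choose l : ℂ) * Complex.I ^ (l + 1) * (p - x) ^ (K - l) * (f t * (t : ℂ) ^ l))
      (Set.Ioi 0) := fun l hl => (hf l (Nat.lt_succ_iff.mp (Finset.mem_range.mp hl))).const_mul _
  simp only [e]
  refine ⟨MeasureTheory.integrable_finsetSum _ hi, ?_⟩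
  rw [MeasureTheory.integral_finsetSum _ hi, ← homEval_one_right (natDegree_momPoly_le K p f),
    homEval_momPoly K p hf x one_ne_zero]
  refine Finset.sum_congr rfl fun l _ => ?_
  rw [MeasureTheory.integral_const_mul, moment]
  ring

theorem period_of_c_ne_zero (h : CuspForm 𝒮ℒ k) {γ : SL(2, ℤ)} (hc : γ 1 0 ≠ 0) :
    period K h γ = momPoly K (cuspPt γ) (cuspLine h γ) := by
  rw [period, if_neg hc]
  rfl

theorem period_of_c_eq_zero (h : CuspForm 𝒮ℒ k) {γ : SL(2, ℤ)} (hc : γ 1 0 = 0) :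
    period K h γ = 0 := if_pos hc

theorem natDegree_period_le (h : CuspForm 𝒮ℒ k) (γ : SL(2, ℤ)) : (period K h γ).natDegree ≤ K := by
  by_cases hc : γ 1 0 = 0
  · simp [period_of_c_eq_zero h hc]
  · rw [period_of_c_ne_zero h hc]
    exact natDegree_momPoly_le _ _ _

theorem tendsto_homEval_eichler (h : CuspForm 𝒮ℒ k) (z : ℍ) (U : ℂ) {V : ℂ} (hV : V ≠ 0) :
    Filter.Tendsto (fun t : ℝ => homEval K (eichler K h (ofComplex ((z : ℂ) + Complex.I * t))) U V)
      Filter.atTop (nhds 0) := by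
  have hE : ∀ l j : ℕ, Filter.Tendsto (fun t : ℝ =>
      ray (iterPrim (cuspQ h) (l + 1)) (qpar z) t * (t : ℂ) ^ j) Filter.atTop (nhds 0) :=
    fun l j => tendsto_ray ((discCusp_cuspQ h).iterPrim _) (norm_qpar_lt_one z) j
  have hE' : ∀ l m : ℕ, Filter.Tendsto (fun t : ℝ =>
      ray (iterPrim (cuspQ h) (l + 1)) (qpar z) t * ((z + Complex.I * t) * V - U) ^ m)
      Filter.atTop (nhds 0) := by
    intro l m
    have e : ∀ t : ℝ, ray (iterPrim (cuspQ h) (l + 1)) (qpar z) t *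
        ((z + Complex.I * t) * V - U) ^ m = ∑ j ∈ Finset.range (m + 1),
          (ray (iterPrim (cuspQ h) (l + 1)) (qpar z) t * (t : ℂ) ^ j) *
            ((m.choose j : ℂ) * (Complex.I * V) ^ j * (z * V - U) ^ (m - j)) := by
      intro t
      rw [show ((z : ℂ) + Complex.I * t) * V - U = Complex.I * V * t + (z * V - U) by ring, add_pow,
        Finset.mul_sum]
      refine Finset.sum_congr rfl fun j _ => ?_
      ring
    simp only [e]
    have := tendsto_finsetSum (Finset.range (m + 1)) fun j _ => (hE l j).mul_const
      ((m.choose j : ℂ) * (Complex.I * V) ^ j * ((z : ℂ) * V - U) ^ (m - j))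
    simpa using this
  have hsum := (tendsto_finsetSum (Finset.range (K + 1)) fun l _ =>
    ((hE' l (K - l)).const_mul (eichlerConst K l)).mul_const (V ^ l)).neg
  simp only [mul_zero, zero_mul, Finset.sum_const_zero, neg_zero] at hsum
  refine hsum.congr' ?_
  filter_upwards [Filter.eventually_ge_atTop 0] with t ht
  have him : 0 < ((z : ℂ) + Complex.I * t).im := by
    have := z.im_pos
    simp
    positivity
  have hco : ((ofComplex ((z : ℂ) + Complex.I * t) : ℍ) : ℂ) = (z : ℂ) + Complex.I * t := by
    rw [ofComplex_apply_of_im_pos him]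
  rw [homEval_eichler h K _ U hV, hco]
  congr 1
  refine Finset.sum_congr rfl fun l _ => ?_
  have e : cuspPrim h (l + 1) (ofComplex ((z : ℂ) + Complex.I * t)) =
      ray (iterPrim (cuspQ h) (l + 1)) (qpar z) t := by
    rw [ray, cuspPrim, qpar, qpar, hco, ← Complex.exp_add]
    congr 2
    linear_combination (2 * Real.pi * t : ℂ) * Complex.I_mul_I
  rw [e]
  ring

/-- The difference of the two Eichler integrals in the cocycle relation, evaluated at `x`. -/
def eichlerDiff (K : ℕ) (h : CuspForm 𝒮ℒ k) (γ : SL(2, ℤ)) (x : ℂ) (z : ℍ) : ℂ :=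
  homEval K (eichler K h (γ • z)) ((γ 0 0 : ℂ) * x + (γ 0 1 : ℂ)) (jfac γ x) -
    homEval K (eichler K h z) x 1

/-- The derivative of the first integral contains h(γz) j(γ,z)^{-2} = j(γ,z)^{k-2} h(z), and
j(γ,z)^K turns (γz - γx)^K j(γ,x)^K into (z - x)^K. This uses exactly k = K + 2. -/
theorem hasDerivAt_eichlerDiff (hk : k = K + 2) (h : CuspForm 𝒮ℒ k) (γ : SL(2, ℤ)) (x z : ℍ) :
    HasDerivAt (fun w => eichlerDiff K h γ x (ofComplex w)) 0 z := by
  have hj := jfac_ne_zero γ z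
  have hV := jfac_ne_zero γ x
  have h1 := (hasDerivAt_homEval_eichler h K (γ • z) ((γ 0 0 : ℂ) * x + (γ 0 1 : ℂ)) hV)
  have hm := hasDerivAt_moebius γ z
  rw [coe_smul_eq] at h1
  have h2 := h1.comp (z : ℂ) hm
  have h3 := hasDerivAt_homEval_eichler h K z (x : ℂ) one_ne_zero
  have h4 := h2.sub h3
  rw [← coe_smul_eq] at h4
  refine (h4.congr_deriv ?_).congr_of_eventuallyEq ?_
  · rw [cuspForm_smul, mul_one, ← smul_sub_eq γ z x, mul_pow]
    have e : jfac γ z ^ k * jfac γ z ^ (-2 : ℤ) = jfac γ z ^ K := by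
      rw [← zpow_add₀ hj, hk, add_neg_cancel_right, zpow_natCast]
    linear_combination h z * (((γ • z : ℍ) : ℂ) * jfac γ x -
      ((γ 0 0 : ℂ) * x + (γ 0 1 : ℂ))) ^ K * e
  · filter_upwards [eventually_coe_smul_ofComplex γ z] with w hw
    simp only [eichlerDiff, Pi.sub_apply, Function.comp]
    rw [← hw, ofComplex_apply]

theorem eichlerDiff_eq (hk : k = K + 2) (h : CuspForm 𝒮ℒ k) (γ : SL(2, ℤ)) (x z w : ℍ) :
    eichlerDiff K h γ x z = eichlerDiff K h γ x w := by
  have hd : ∀ u ∈ {u : ℂ | 0 < u.im}, HasDerivAt (fun w => eichlerDiff K h γ x (ofComplex w)) 0 u :=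
    fun u hu => hasDerivAt_eichlerDiff hk h γ x ⟨u, hu⟩
  have := isOpen_upperHalfPlaneSet.is_const_of_deriv_eq_zero
    (convex_halfSpace_im_gt 0).isPreconnected
    (fun u hu => (hd u hu).differentiableAt.differentiableWithinAt)
    (fun u hu => (hd u hu).deriv) z.im_pos w.im_pos
  simpa using this

/-- The difference is constant in z, so it can be evaluated by moving z towards a cusp. If c = 0,
both integrals tend to 0 at i∞. Otherwise z runs along the vertical line above -d/c = γ⁻¹ i∞. -/
theorem eichlerDiff_eq_period (hk : k = K + 2) (h : CuspForm 𝒮ℒ k) (γ : SL(2, ℤ)) (x z : ℍ) :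
    eichlerDiff K h γ x z = (period K h γ).eval (x : ℂ) := by
  have hV := jfac_ne_zero γ x
  by_cases hc : γ 1 0 = 0
  · rw [period_of_c_eq_zero h hc, eval_zero]
    have hdet := det_eq_one γ
    have hd : γ 1 1 ≠ 0 := by
      intro hd
      simp [hc, hd] at hdet
    have hd' : (γ 1 1 : ℂ) ≠ 0 := by exact_mod_cast hd
    have had : γ 0 0 = γ 1 1 := by
      have : γ 0 0 * γ 1 1 = 1 := by
        rw [hc] at hdet
        exact_mod_cast (by simpa using hdet : (γ 0 0 : ℂ) * γ 1 1 = 1)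
      rcases Int.mul_eq_one_iff_eq_one_or_neg_one.mp this with h1 | h1 <;> rw [h1.1, h1.2]
    have h1 := tendsto_homEval_eichler (K := K) h (γ • z) ((γ 0 0 : ℂ) * x + (γ 0 1 : ℂ)) hV
    have h2 := tendsto_homEval_eichler (K := K) h z (x : ℂ) one_ne_zero
    have h3 := h1.sub h2
    rw [sub_zero] at h3
    refine tendsto_nhds_unique (tendsto_const_nhds.congr' ?_) h3
    filter_upwards [Filter.eventually_ge_atTop 0] with t ht
    have him : 0 < ((z : ℂ) + Complex.I * t).im := by
      have := z.im_pos
      simp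
      positivity
    have hco : ((ofComplex ((z : ℂ) + Complex.I * t) : ℍ) : ℂ) = (z : ℂ) + Complex.I * t := by
      rw [ofComplex_apply_of_im_pos him]
    rw [eichlerDiff_eq hk h γ x z (ofComplex ((z : ℂ) + Complex.I * t)), eichlerDiff]
    have e : ((γ • z : ℍ) : ℂ) + Complex.I * t =
        ((γ • (ofComplex ((z : ℂ) + Complex.I * t) : ℍ) : ℍ) : ℂ) := by
      rw [coe_smul_eq, coe_smul_eq, hco, jfac, jfac, hc, had]
      simp only [Int.cast_zero, zero_mul, zero_add]
      field_simp
      ring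
    rw [e, ofComplex_apply]
  · have hc' : (γ 1 0 : ℂ) ≠ 0 := by exact_mod_cast hc
    set κ := eichlerDiff K h γ x z with hκ
    set f : ℝ → ℂ := fun t => homEval K (eichler K h (ofComplex (cuspPt γ + Complex.I * t))) x 1
      with hf
    have hint := eval_momPoly K (cuspPt γ) (fun l _ => integrableOn_cuspLine hk h hc l) (x : ℂ)
    rw [period_of_c_ne_zero h hc, hint.2]
    -- At t = 0 the point is real and f has no meaning there, so its value is replaced by the limit
    -- -κ. The fundamental theorem of calculus then gives the integral 0 - (-κ) = κ.
    have hder : ∀ t ∈ Set.Ioi (0 : ℝ), HasDerivAt (Function.update f 0 (-κ))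
        (Complex.I * (cuspLine h γ t * (cuspPt γ + Complex.I * t - x) ^ K)) t := by
      intro t ht
      have ht' : (0 : ℝ) < t := ht
      have h1 := hasDerivAt_homEval_eichler h K (ofComplex (cuspPt γ + Complex.I * t)) (x : ℂ)
        one_ne_zero
      rw [coe_ofComplex_cuspPt γ ht'] at h1
      have h2 : HasDerivAt (fun t : ℝ => cuspPt γ + Complex.I * t) Complex.I t := by
        simpa using ((hasDerivAt_id (t : ℂ)).comp_ofReal.const_mul Complex.I).const_add (cuspPt γ)
      refine ((h1.comp t h2).congr_deriv ?_).congr_of_eventuallyEq ?_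
      · rw [mul_one, mul_comm, cuspLine]
      · filter_upwards [eventually_ne_nhds ht'.ne'] with u hu
        rw [Function.update_of_ne hu]
        rfl
    have hcont : ContinuousWithinAt (Function.update f 0 (-κ)) (Set.Ici 0) 0 := by
      rw [continuousWithinAt_update_same]
      have h0 : Set.Ici (0 : ℝ) \ {0} = Set.Ioi 0 := by ext t; simp [lt_iff_le_and_ne, eq_comm]
      rw [h0]
      let z₁ : ℍ := ofComplex ((γ 0 0 : ℂ) / γ 1 0 + Complex.I)
      have hz₁ : (z₁ : ℂ) = (γ 0 0 : ℂ) / γ 1 0 + Complex.I := by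
        refine congrArg _ (ofComplex_apply_of_im_pos ?_)
        have : (γ 0 0 : ℂ) / γ 1 0 = ((γ 0 0 / γ 1 0 : ℝ) : ℂ) := by push_cast; rfl
        rw [this]
        simp
      -- The image under γ of the point at height t lies above a/c at height 1/(c²t), that is, at
      -- distance 1/(c²t) - 1 above z₁. As t → 0 it tends to i∞, and the first integral of the
      -- difference tends to 0.
      have ht : Filter.Tendsto (fun t : ℝ => 1 / ((γ 1 0 : ℝ) ^ 2 * t) - 1)
          (nhdsWithin 0 (Set.Ioi 0)) Filter.atTop := by
        refine Filter.tendsto_atTop_add_const_right _ _ ?_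
        have hc2 : 0 < 1 / (γ 1 0 : ℝ) ^ 2 := by
          have : (γ 1 0 : ℝ) ≠ 0 := by exact_mod_cast hc
          positivity
        refine (Filter.Tendsto.const_mul_atTop hc2 tendsto_inv_nhdsGT_zero).congr fun t => ?_
        rw [one_div, one_div, mul_inv]
      have h1 := ((tendsto_homEval_eichler (K := K) h z₁ ((γ 0 0 : ℂ) * x + (γ 0 1 : ℂ)) hV).comp
        ht).sub_const κ
      rw [zero_sub] at h1
      refine h1.congr' ?_
      filter_upwards [self_mem_nhdsWithin] with t ht
      have ht' : (0 : ℝ) < t := ht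
      have e := coe_smul_cuspPt hc ht'
      have e2 : (z₁ : ℂ) + Complex.I * ((1 / ((γ 1 0 : ℝ) ^ 2 * t) - 1 : ℝ) : ℂ) =
          ((γ • (ofComplex (cuspPt γ + Complex.I * t) : ℍ) : ℍ) : ℂ) := by
        rw [e, hz₁]
        push_cast
        ring
      rw [Function.comp, e2, ofComplex_apply, hκ,
        eichlerDiff_eq hk h γ x z (ofComplex (cuspPt γ + Complex.I * t)), eichlerDiff]
      ring
    have hinf : Filter.Tendsto (Function.update f 0 (-κ)) Filter.atTop (nhds 0) := by
      let z₁ : ℍ := ofComplex (cuspPt γ + Complex.I * (1 : ℝ))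
      have h1 := (tendsto_homEval_eichler (K := K) h z₁ (x : ℂ) one_ne_zero).comp
        (Filter.tendsto_atTop_add_const_right Filter.atTop (-1 : ℝ) Filter.tendsto_id)
      refine h1.congr' ?_
      filter_upwards [Filter.eventually_gt_atTop 0] with t ht
      rw [Function.update_of_ne ht.ne', Function.comp, coe_ofComplex_cuspPt γ one_pos, hf]
      have e : cuspPt γ + Complex.I * ((1 : ℝ) : ℂ) + Complex.I * ((id t + -1 : ℝ) : ℂ) =
          cuspPt γ + Complex.I * t := by
        simp only [id]
        push_cast
        ring
      rw [e]
    have := MeasureTheory.integral_Ioi_of_hasDerivAt_of_tendsto hcont hder hint.1 hinf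
    rw [this, Function.update_self]
    ring

theorem polyAct_eichler (hk : k = K + 2) (h : CuspForm 𝒮ℒ k) (γ : SL(2, ℤ)) (z : ℍ) :
    polyAct K γ (eichler K h (γ • z)) = eichler K h z + period K h γ := by
  refine polynomial_ext_of_upperHalfPlane fun x => ?_
  have := eichlerDiff_eq_period hk h γ x z
  rw [eichlerDiff, homEval_one_right (natDegree_eichler_le h K z), sub_eq_iff_eq_add] at this
  rw [eval_polyAct, this, eval_add, add_comm]

theorem polyAct_eichlerPM (hk : k = K + 2) (ε : Sgn) (h : CuspForm 𝒮ℒ k) (γ : SL(2, ℤ)) (z : ℍ) :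
    polyAct K γ (eichlerPM K ε h (γ • z)) = eichlerPM K ε h z + ε.act (period K h γ) := by
  rw [eichlerPM, ε.act_polyAct, polyAct_eichler hk, ε.act_add, eichlerPM]

end Cocycle

/-! ### The terms of the series `ψ` and `φ` -/

section Terms

variable {k : ℤ} {K : ℕ}

/-- The period polynomials are the differences of the translates of one function, so they form a
cocycle; the relation is read off at the single point i. -/
theorem period_mul (hk : k = K + 2) (h : CuspForm 𝒮ℒ k) (γ' γ : SL(2, ℤ)) :
    period K h (γ' * γ) = polyAct K γ (period K h γ') + period K h γ := by
  have h1 := polyAct_eichler hk h (γ' * γ) I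
  rw [mul_smul, ← polyAct_mul, polyAct_eichler hk, polyAct_add, polyAct_eichler hk,
    add_assoc, add_right_inj] at h1
  rw [← h1, add_comm]

theorem period_of_mem_B (h : CuspForm 𝒮ℒ k) {β : SL(2, ℤ)} (hβ : β ∈ B) : period K h β = 0 :=
  period_of_c_eq_zero h (mem_B_iff.mp hβ)

theorem polyAct_zero (K : ℕ) (γ : SL(2, ℤ)) : polyAct K γ 0 = 0 := by
  simp [polyAct]

theorem period_mul_left (hk : k = K + 2) (h : CuspForm 𝒮ℒ k) {β : SL(2, ℤ)} (hβ : β ∈ B)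
    (γ : SL(2, ℤ)) : period K h (β * γ) = period K h γ := by
  rw [period_mul hk, period_of_mem_B h hβ, polyAct_zero, zero_add]

theorem phiTerm_eq (hk : k = K + 2) (r s : ℤ) (ε : Sgn) (h : CuspForm 𝒮ℒ k) (z : ℍ)
    (γ : SL(2, ℤ)) : phiTerm r s K ε h z γ =
      psiTerm r s K ε h z γ + C (wt r s γ z) * eichlerPM K ε h z := by
  rw [phiTerm, slashPoly_apply, polyAct_eichlerPM hk, psiTerm, mul_add, add_comm]

theorem psiTerm_mul_left (hk : k = K + 2) {r s : ℤ} (hrs : Even (r + s)) (ε : Sgn)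
    (h : CuspForm 𝒮ℒ k) (z : ℍ) {β : SL(2, ℤ)} (hβ : β ∈ B) (γ : SL(2, ℤ)) :
    psiTerm r s K ε h z (β * γ) = psiTerm r s K ε h z γ := by
  have := BInvariant_wt hrs z β hβ γ
  simp only at this
  rw [psiTerm, psiTerm, period_mul_left hk h hβ, this]

theorem phiTerm_mul_left (hk : k = K + 2) {r s : ℤ} (hrs : Even (r + s)) (ε : Sgn)
    (h : CuspForm 𝒮ℒ k) (z : ℍ) {β : SL(2, ℤ)} (hβ : β ∈ B) (γ : SL(2, ℤ)) :
    phiTerm r s K ε h z (β * γ) = phiTerm r s K ε h z γ := by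
  have := BInvariant_wt hrs z β hβ γ
  simp only at this
  rw [phiTerm_eq hk, phiTerm_eq hk, psiTerm_mul_left hk hrs ε h z hβ, this]

theorem BInvariant.coeff_psiTerm (hk : k = K + 2) {r s : ℤ} (hrs : Even (r + s)) (ε : Sgn)
    (h : CuspForm 𝒮ℒ k) (z : ℍ) (n : ℕ) :
    BInvariant fun γ => (psiTerm r s K ε h z γ).coeff n := fun β hβ γ => by
  simp only [psiTerm_mul_left hk hrs ε h z hβ]

theorem natDegree_psiTerm_le (r s : ℤ) (ε : Sgn) (h : CuspForm 𝒮ℒ k) (z : ℍ) (γ : SL(2, ℤ)) :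
    (psiTerm r s K ε h z γ).natDegree ≤ K :=
  (natDegree_C_mul_le _ _).trans (ε.natDegree_act_le (natDegree_period_le h γ))

theorem natDegree_eichlerPM_le (ε : Sgn) (h : CuspForm 𝒮ℒ k) (z : ℍ) :
    (eichlerPM K ε h z).natDegree ≤ K := ε.natDegree_act_le (natDegree_eichler_le h K z)

theorem psiTerm_one (r s : ℤ) (ε : Sgn) (h : CuspForm 𝒮ℒ k) (z : ℍ) :
    psiTerm r s K ε h z 1 = 0 := by
  rw [psiTerm, period_of_mem_B h B.one_mem, ε.act_eq_map, Polynomial.map_zero, mul_zero]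

/-! ### Absolute convergence and `q`-expansions of the series `ψ` -/

theorem cuspPt_mat (p : DIdx × ℤ) : cuspPt (DIdx.mat p) = -(p.1.x + p.2 : ℝ) := by
  have := p.1.c_ne_zero
  rw [cuspPt, DIdx.mat_c, DIdx.mat_d, DIdx.x]
  push_cast
  field_simp

theorem cuspLine_eq (h : CuspForm 𝒮ℒ k) (γ : SL(2, ℤ)) {t : ℝ} (ht : 0 < t) :
    cuspLine h γ t = cuspQ h (Complex.exp (2 * Real.pi * Complex.I *
      (cuspPt γ + Complex.I * t))) := by
  rw [cuspLine, cuspForm_eq, qpar, coe_ofComplex_cuspPt γ ht]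

/-- Replacing d by d + nc moves the cusp by an integer, and cusp forms have period 1. -/
theorem moment_cuspLine_mat (h : CuspForm 𝒮ℒ k) (p : DIdx × ℤ) (l : ℕ) :
    moment K (cuspLine h (DIdx.mat p)) l = moment K (cuspLine h (DIdx.mat (p.1, 0))) l := by
  rw [moment, moment]
  congr 1
  refine MeasureTheory.setIntegral_congr_fun measurableSet_Ioi fun t ht => ?_
  rw [cuspLine_eq h _ ht, cuspLine_eq h _ ht, cuspPt_mat, cuspPt_mat]
  congr 2
  refine Complex.exp_eq_exp_iff_exists_int.mpr ⟨-p.2, ?_⟩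
  push_cast
  ring

/-- The coefficients of the period polynomials in the powers of `X + x + n`. -/
def periodCoeff (K : ℕ) (ε : Sgn) (h : CuspForm 𝒮ℒ k) (l : ℕ) (i : DIdx) : ℂ :=
  ε.onC (moment K (cuspLine h (DIdx.mat (i, 0))) l * (-1) ^ (K - l))

theorem c_mat_ne_zero (p : DIdx × ℤ) : DIdx.mat p 1 0 ≠ 0 := by
  rw [DIdx.mat_c]
  exact_mod_cast p.1.c_pos.ne'

/-- The expansion point -(x + n) is real, so conjugation affects only the coefficients and both
signs are treated alike. -/
theorem act_period_mat (hk : k = K + 2) (ε : Sgn) (h : CuspForm 𝒮ℒ k) (p : DIdx × ℤ) :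
    ε.act (period K h (DIdx.mat p)) = ∑ l ∈ Finset.range (K + 1),
      C (periodCoeff K ε h l p.1) * (X - C (-(p.1.x + p.2 : ℝ) : ℂ)) ^ (K - l) := by
  have hx : ε.onC (-(p.1.x + p.2 : ℝ) : ℂ) = (-(p.1.x + p.2 : ℝ) : ℂ) := by
    cases ε
    · rfl
    · simp only [Sgn.onC, map_neg, Complex.conj_ofReal]
  rw [period_of_c_ne_zero h (c_mat_ne_zero p),
    momPoly_eq K _ fun l _ => integrableOn_cuspLine hk h (c_mat_ne_zero p) l, ε.act_eq_map,
    Polynomial.map_sum]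
  refine Finset.sum_congr rfl fun l _ => ?_
  rw [Polynomial.map_mul, Polynomial.map_pow, Polynomial.map_sub, map_C, map_C, map_X,
    cuspPt_mat, hx, moment_cuspLine_mat, periodCoeff]

/-- The moments are O(c^{K+1}), which leaves the exponent m - K - 1 ≥ 3; this is where the bound K +
4 on the total weight originates. -/
theorem summable_periodCoeff (hk : k = K + 2) {m : ℤ} (hm : K + 4 ≤ m) (ε : Sgn)
    (h : CuspForm 𝒮ℒ k) (l : ℕ) :
    Summable fun i : DIdx => ‖(i.c : ℂ) ^ (-m) * periodCoeff K ε h l i‖ := by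
  obtain ⟨M, hM⟩ := exists_bound_moment_cuspLine hk h l
  refine Summable.of_nonneg_of_le (fun _ => norm_nonneg _) (fun i => ?_)
    ((summable_c_zpow (k := m - (K + 1)) (by omega)).mul_left M)
  have hi := hM (DIdx.mat (i, 0)) (c_mat_ne_zero _)
  have hc : |((DIdx.mat (i, 0) 1 0 : ℤ) : ℝ)| = i.c := by
    rw [DIdx.mat_c]
    simp
  have hc0 : (i.c : ℝ) ≠ 0 := by exact_mod_cast i.c_pos.ne'
  rw [hc] at hi
  rw [norm_mul, norm_zpow, norm_zpow, Complex.norm_natCast, periodCoeff, ε.norm_onC, norm_mul,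
    norm_pow, norm_neg, norm_one, one_pow, mul_one, show -(m - ((K : ℤ) + 1)) = -m + ((K + 1 : ℕ) : ℤ)
      by push_cast; ring, zpow_add₀ hc0, zpow_natCast]
  calc _ ≤ (i.c : ℝ) ^ (-m) * (M * (i.c : ℝ) ^ (K + 1)) := by gcongr
    _ = _ := by ring

/-- The universal constants in the adapted coefficients of `(X - p)^m`. -/
def biConst (K m i a : ℕ) : ℂ :=
  (-1) ^ a * (m.choose a : ℂ) * ((X ^ a * (1 - X) ^ (K - m) : ℂ[X]).coeff i)

theorem biCoeff_X_sub_C_pow {m : ℕ} (hm : m ≤ K) (p : ℂ) (i : ℕ) (z : ℍ) :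
    biCoeff K ((X - C p) ^ m) i z = ∑ a ∈ Finset.range (m + 1),
      biConst K m i a / ((z : ℂ) - conj (z : ℂ)) ^ K *
        (((z : ℂ) - p) ^ (m - a) * (conj (z : ℂ) - p) ^ a) := by
  rw [biCoeff, biPoly_X_sub_C_pow hm, coeff_biPoly_X_sub_C_pow, Finset.sum_div]
  refine Finset.sum_congr rfl fun a _ => ?_
  rw [biConst]
  ring

theorem inv_sub_conj_pow_mem_QA (K : ℕ) : (fun z : ℍ => (((z : ℂ) - conj (z : ℂ)) ^ K)⁻¹) ∈ QA := by
  convert QA.mul_mem (const_mem_QA (((2 * Complex.I) ^ K)⁻¹)) (im_zpow_mem_QA (-(K : ℤ))) using 1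
  ext z
  rw [Pi.mul_apply, sub_conj_eq, mul_pow, mul_inv, zpow_neg, zpow_natCast]

/-- A power of X + x + n contributes, in the adapted basis, products of powers of z + x + n and z̄ +
x + n. They are absorbed by the weight factor, whose exponents become r - (K - l - a) and s - a. -/
theorem biCoeff_psiTerm_mat (hk : k = K + 2) (r s : ℤ) (ε : Sgn) (h : CuspForm 𝒮ℒ k) (i : ℕ)
    (z : ℍ) (p : DIdx × ℤ) : biCoeff K (psiTerm r s K ε h z (DIdx.mat p)) i z =
      ∑ l ∈ Finset.range (K + 1), ∑ a ∈ Finset.range (K - l + 1),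
        biConst K (K - l) i a * (((z : ℂ) - conj (z : ℂ)) ^ K)⁻¹ *
          ((p.1.c : ℂ) ^ (-(r + s)) * periodCoeff K ε h l p.1 *
            latTerm (r - (K - l - a : ℕ)) (s - a) (p.1.x +ᵥ z) p.2) := by
  rw [psiTerm, biCoeff_C_mul, act_period_mat hk, biCoeff_sum, Finset.mul_sum]
  refine Finset.sum_congr rfl fun l _ => ?_
  rw [biCoeff_C_mul, biCoeff_X_sub_C_pow (Nat.sub_le K l), Finset.mul_sum, Finset.mul_sum]
  refine Finset.sum_congr rfl fun a _ => ?_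
  have h1 := coe_add_int_ne_zero (p.1.x +ᵥ z) p.2
  have h2 := conj_add_int_ne_zero (p.1.x +ᵥ z) p.2
  have e1 : (z : ℂ) - -((p.1.x + p.2 : ℝ) : ℂ) = ((p.1.x +ᵥ z : ℍ) : ℂ) + p.2 := by
    rw [coe_vadd]
    push_cast
    ring
  have e2 : conj (z : ℂ) - -((p.1.x + p.2 : ℝ) : ℂ) = conj ((p.1.x +ᵥ z : ℍ) : ℂ) + p.2 := by
    rw [coe_vadd, map_add, Complex.conj_ofReal]
    push_cast
    ring
  rw [e1, e2, wt_mat, latTerm, latTerm, neg_sub, neg_sub, sub_eq_neg_add _ r, sub_eq_neg_add _ s,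
    zpow_add₀ h1, zpow_add₀ h2, zpow_natCast, zpow_natCast]
  ring

theorem summable_biCoeff_psiTerm (hk : k = K + 2) {r s : ℤ} (hrs : K + 4 ≤ r + s) (ε : Sgn)
    (h : CuspForm 𝒮ℒ k) (i : ℕ) :
    (∀ z : ℍ, Summable fun p : DIdx × ℤ => biCoeff K (psiTerm r s K ε h z (DIdx.mat p)) i z) ∧
      (fun z : ℍ => ∑' p : DIdx × ℤ, biCoeff K (psiTerm r s K ε h z (DIdx.mat p)) i z) ∈ QA := by
  -- The exponents add up to r + s - (K - l) ≥ 4, which is within the range of convergence.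
  have hsum : ∀ l ∈ Finset.range (K + 1), ∀ a ∈ Finset.range (K - l + 1), _ :=
    fun l hl a ha => summable_double_and_mem_QL (summable_periodCoeff hk hrs ε h l) DIdx.x
      (α := r - (K - l - a : ℕ)) (β := s - a) (by
        simp only [Finset.mem_range] at hl ha
        omega)
  simp only [biCoeff_psiTerm_mat hk]
  have hs : ∀ (z : ℍ), ∀ l ∈ Finset.range (K + 1), ∀ a ∈ Finset.range (K - l + 1),
      Summable fun p : DIdx × ℤ => biConst K (K - l) i a * (((z : ℂ) - conj (z : ℂ)) ^ K)⁻¹ *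
          ((p.1.c : ℂ) ^ (-(r + s)) * periodCoeff K ε h l p.1 *
            latTerm (r - (K - l - a : ℕ)) (s - a) (p.1.x +ᵥ z) p.2) :=
    fun z l hl a ha => ((hsum l hl a ha).1 z).mul_left _
  refine ⟨fun z => summable_sum fun l hl => summable_sum fun a ha => hs z l hl a ha, ?_⟩
  have e : (fun z : ℍ => ∑' p : DIdx × ℤ, ∑ l ∈ Finset.range (K + 1),
      ∑ a ∈ Finset.range (K - l + 1),
        biConst K (K - l) i a * (((z : ℂ) - conj (z : ℂ)) ^ K)⁻¹ *
          ((p.1.c : ℂ) ^ (-(r + s)) * periodCoeff K ε h l p.1 *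
            latTerm (r - (K - l - a : ℕ)) (s - a) (p.1.x +ᵥ z) p.2)) =
      fun z : ℍ => ∑ l ∈ Finset.range (K + 1), ∑ a ∈ Finset.range (K - l + 1),
        biConst K (K - l) i a * (((z : ℂ) - conj (z : ℂ)) ^ K)⁻¹ *
          ∑' p : DIdx × ℤ, ((p.1.c : ℂ) ^ (-(r + s)) * periodCoeff K ε h l p.1 *
            latTerm (r - (K - l - a : ℕ)) (s - a) (p.1.x +ᵥ z) p.2) := by
    ext z
    rw [Summable.tsum_finsetSum fun l hl => summable_sum fun a ha => hs z l hl a ha]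
    refine Finset.sum_congr rfl fun l hl => ?_
    rw [Summable.tsum_finsetSum fun a ha => hs z l hl a ha]
    refine Finset.sum_congr rfl fun a _ => ?_
    rw [tsum_mul_left]
  rw [e]
  refine sum_mem_QA _ fun l hl => sum_mem_QA _ fun a ha => ?_
  exact QA.mul_mem (QA.mul_mem (const_mem_QA _) (inv_sub_conj_pow_mem_QA K))
    (QL_le_QA (hsum l hl a ha).2)

theorem coeff_eq_sum_biCoeff {P : ℂ[X]} (hP : P.natDegree ≤ K) (z : ℍ) (n : ℕ) :
    P.coeff n = ∑ i ∈ Finset.range (K + 1), biCoeff K P i z *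
      ((X - C (z : ℂ)) ^ i * (X - C (conj (z : ℂ))) ^ (K - i)).coeff n := by
  conv_lhs => rw [biCoeff_expansion K P hP z]
  rw [finsetSum_coeff]
  refine Finset.sum_congr rfl fun i _ => ?_
  rw [mul_assoc, coeff_C_mul]

theorem summable_psiTerm (hk : k = K + 2) {r s : ℤ} (hev : Even (r + s)) (hrs : K + 4 ≤ r + s)
    (ε : Sgn) (h : CuspForm 𝒮ℒ k) (z : ℍ) (n : ℕ) :
    Summable fun q : BCosets => (psiTerm r s K ε h z q.out).coeff n := by
  have h1 : Summable fun p : DIdx × ℤ => (psiTerm r s K ε h z (DIdx.mat p)).coeff n := by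
    simp only [coeff_eq_sum_biCoeff (natDegree_psiTerm_le r s ε h z _) z n]
    exact summable_sum fun i _ => ((summable_biCoeff_psiTerm hk hrs ε h i).1 z).mul_right _
  exact ((BInvariant.coeff_psiTerm hk hev ε h z n).hasSum_coset h1.hasSum).summable

theorem summable_wt {r s : ℤ} (hev : Even (r + s)) (h3 : 3 ≤ r + s) (z : ℍ) :
    Summable fun q : BCosets => wt r s q.out z := (hasSum_eis hev h3 z).summable

theorem summable_phiTerm (hk : k = K + 2) {r s : ℤ} (hev : Even (r + s)) (hrs : K + 4 ≤ r + s)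
    (ε : Sgn) (h : CuspForm 𝒮ℒ k) (z : ℍ) (n : ℕ) :
    Summable fun q : BCosets => (phiTerm r s K ε h z q.out).coeff n := by
  simp only [phiTerm_eq hk, coeff_add, coeff_C_mul]
  exact (summable_psiTerm hk hev hrs ε h z n).add
    ((summable_wt hev (by omega) z).mul_right _)

/-! ### The sums of the series -/

theorem natDegree_cosetSumPoly_le (K : ℕ) (t : SL(2, ℤ) → ℂ[X]) :
    (cosetSumPoly K t).natDegree ≤ K :=
  natDegree_sum_le_of_forall_le _ _ fun _ hn =>
    (natDegree_monomial_le _).trans (Nat.lt_succ_iff.mp (Finset.mem_range.mp hn))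

theorem coeff_cosetSumPoly (K : ℕ) (t : SL(2, ℤ) → ℂ[X]) (n : ℕ) :
    (cosetSumPoly K t).coeff n = if n ≤ K then cosetSum fun γ => (t γ).coeff n else 0 :=
  coeff_sum_monomial _ _ _

/-- Adapted coefficients and coefficients of `polyAct` are finite linear functionals of the monomial
coefficients, so they may be taken inside the coset sum. -/
theorem sum_coeff_cosetSumPoly {t : SL(2, ℤ) → ℂ[X]}
    (ht : ∀ n, Summable fun q : BCosets => (t q.out).coeff n) (κ : ℕ → ℂ) :
    ∑ n ∈ Finset.range (K + 1), (cosetSumPoly K t).coeff n * κ n =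
      cosetSum fun γ => ∑ n ∈ Finset.range (K + 1), (t γ).coeff n * κ n := by
  rw [cosetSum, Summable.tsum_finsetSum fun n _ => (ht n).mul_right (κ n)]
  refine Finset.sum_congr rfl fun n hn => ?_
  rw [coeff_cosetSumPoly, if_pos (Nat.lt_succ_iff.mp (Finset.mem_range.mp hn)), cosetSum,
    tsum_mul_right]

theorem biCoeff_cosetSumPoly {t : SL(2, ℤ) → ℂ[X]}
    (ht : ∀ n, Summable fun q : BCosets => (t q.out).coeff n) (i : ℕ) (z : ℍ) :
    biCoeff K (cosetSumPoly K t) i z = cosetSum fun γ => biCoeff K (t γ) i z := by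
  simp only [biCoeff_eq_sum]
  exact sum_coeff_cosetSumPoly ht _

theorem coeff_polyAct (K : ℕ) (γ : SL(2, ℤ)) (P : ℂ[X]) (m : ℕ) :
    (polyAct K γ P).coeff m = ∑ n ∈ Finset.range (K + 1), P.coeff n *
      ((C (γ 0 0 : ℂ) * X + C (γ 0 1 : ℂ)) ^ n *
        (C (γ 1 0 : ℂ) * X + C (γ 1 1 : ℂ)) ^ (K - n)).coeff m := by
  rw [polyAct, finsetSum_coeff]
  simp only [mul_assoc, coeff_C_mul]

theorem biCoeff_psi_mem_QA (hk : k = K + 2) {r s : ℤ} (hev : Even (r + s)) (hrs : K + 4 ≤ r + s)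
    (ε : Sgn) (h : CuspForm 𝒮ℒ k) (i : ℕ) :
    (fun z => biCoeff K (psi r s K ε h z) i z) ∈ QA := by
  obtain ⟨h1, h2⟩ := summable_biCoeff_psiTerm hk hrs ε h i
  convert h2 using 1
  ext z
  rw [psi, biCoeff_cosetSumPoly (fun n => summable_psiTerm hk hev hrs ε h z n)]
  have hB : BInvariant fun γ => biCoeff K (psiTerm r s K ε h z γ) i z := fun β hβ γ => by
    simp only [psiTerm_mul_left hk hev ε h z hβ]
  have := (hB.hasSum_coset (h1 z).hasSum).tsum_eq
  rw [cosetSum, this, psiTerm_one]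
  simp [biCoeff, biPoly]

theorem phi_eq (hk : k = K + 2) {r s : ℤ} (hev : Even (r + s)) (hrs : K + 4 ≤ r + s)
    (ε : Sgn) (h : CuspForm 𝒮ℒ k) (z : ℍ) :
    phi r s K ε h z = psi r s K ε h z + C (eis r s z) * eichlerPM K ε h z := by
  ext n
  rw [phi, psi, coeff_add, coeff_C_mul, coeff_cosetSumPoly, coeff_cosetSumPoly]
  split_ifs with hn
  · simp only [phiTerm_eq hk, coeff_add, coeff_C_mul, cosetSum, eis]
    rw [(summable_psiTerm hk hev hrs ε h z n).tsum_add
      ((summable_wt hev (by omega) z).mul_right _), tsum_mul_right]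
  · rw [coeff_eq_zero_of_natDegree_lt (lt_of_le_of_lt (natDegree_eichlerPM_le ε h z)
      (not_le.mp hn)), mul_zero, add_zero]

/-- Slashing by γ replaces the term of δ by the term of δγ, and right multiplication permutes B \ Γ.
-/
theorem slashPoly_phi (hk : k = K + 2) {r s : ℤ} (hev : Even (r + s)) (hrs : K + 4 ≤ r + s)
    (ε : Sgn) (h : CuspForm 𝒮ℒ k) (γ : SL(2, ℤ)) :
    slashPoly r s K γ (phi r s K ε h) = phi r s K ε h := by
  ext z n
  rw [slashPoly_apply, coeff_C_mul, coeff_polyAct, phi,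
    sum_coeff_cosetSumPoly (fun n => summable_phiTerm hk hev hrs ε h _ n)]
  simp only [← coeff_polyAct]
  have hB : BInvariant fun γ => (phiTerm r s K ε h z γ).coeff n := fun β hβ γ => by
    simp only [phiTerm_mul_left hk hev ε h z hβ]
  have e : ∀ δ, wt r s γ z * (polyAct K γ (phiTerm r s K ε h (γ • z) δ)).coeff n =
      (phiTerm r s K ε h z (δ * γ)).coeff n := by
    intro δ
    rw [phiTerm, phiTerm, ← slashPoly_mul, slashPoly_apply r s K γ, coeff_C_mul]
  rw [phi, coeff_cosetSumPoly]
  split_ifs with hn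
  · rw [← hB.cosetSum_mul_right γ, cosetSum, cosetSum, ← tsum_mul_left]
    exact tsum_congr fun q => e q.out
  -- For n > K both sides vanish, since every term has degree at most K.
  · rw [cosetSum, ← tsum_mul_left]
    simp only [e]
    have : ∀ δ, (phiTerm r s K ε h z δ).coeff n = 0 := fun δ => by
      rw [phiTerm, slashPoly_apply, coeff_C_mul, coeff_eq_zero_of_natDegree_lt
        (lt_of_le_of_lt (natDegree_polyAct_le K δ _) (not_le.mp hn)), mul_zero]
    simp [this]

end Terms

/-! ### The coefficients of `φ` are modular forms -/

section Coefficients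

variable {k : ℤ} {K : ℕ}

theorem sub_conj_mem_QA : (fun z : ℍ => (z : ℂ) - conj (z : ℂ)) ∈ QA := by
  convert QA.mul_mem (const_mem_QA (2 * Complex.I)) im_mem_QA using 1
  ext z
  exact sub_conj_eq z

theorem Sgn.comp_qpar_mem_QA (ε : Sgn) {g : ℂ → ℂ} (hg : DiscHol g) :
    (fun z => ε.onC (g (qpar z))) ∈ QA := by
  cases ε
  · exact RAIter.comp_qpar_mem_QA hg
  · exact conj_comp_qpar_mem_QA hg

theorem Sgn.sub_mem_QA (ε : Sgn) : (fun z : ℍ => (z : ℂ) - ε.onC z) ∈ QA ∧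
    (fun z : ℍ => conj (z : ℂ) - ε.onC z) ∈ QA := by
  cases ε
  · refine ⟨?_, ?_⟩
    · simpa [Sgn.onC] using const_mem_QA 0
    · convert QA.neg_mem sub_conj_mem_QA using 1
      ext z
      simp [Sgn.onC]
  · refine ⟨sub_conj_mem_QA, ?_⟩
    simpa [Sgn.onC] using const_mem_QA 0

/-- The Eichler integral is expanded about X = z for the sign + and about X = z̄ for the sign -. In
both cases the differences z - p and z̄ - p are 0 or ±2iy, so the bare variable z disappears. -/
theorem biCoeff_eichlerPM_mem_QA (ε : Sgn) (h : CuspForm 𝒮ℒ k) (i : ℕ) :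
    (fun z => biCoeff K (eichlerPM K ε h z) i z) ∈ QA := by
  have e : (fun z => biCoeff K (eichlerPM K ε h z) i z) = fun z => ∑ l ∈ Finset.range (K + 1),
      ∑ a ∈ Finset.range (K - l + 1), ε.onC (-(eichlerConst K l * (-1) ^ (K - l))) *
        ε.onC (iterPrim (cuspQ h) (l + 1) (qpar z)) *
        (biConst K (K - l) i a * (((z : ℂ) - conj (z : ℂ)) ^ K)⁻¹ *
        (((z : ℂ) - ε.onC z) ^ (K - l - a) * (conj (z : ℂ) - ε.onC z) ^ a)) := by
    ext z
    rw [eichlerPM, eichler_eq, ε.act_eq_map, Polynomial.map_sum, biCoeff_sum]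
    refine Finset.sum_congr rfl fun l _ => ?_
    rw [Polynomial.map_mul, Polynomial.map_pow, Polynomial.map_sub, map_C, map_C, map_X,
      biCoeff_C_mul, biCoeff_X_sub_C_pow (Nat.sub_le K l), Finset.mul_sum]
    refine Finset.sum_congr rfl fun a _ => ?_
    rw [← map_mul, cuspPrim, div_eq_mul_inv]
    congr 2
    ring
  rw [e]
  refine sum_mem_QA _ fun l _ => sum_mem_QA _ fun a _ => ?_
  have hc := (discCusp_cuspQ h).iterPrim (l + 1)
  exact QA.mul_mem (QA.mul_mem (const_mem_QA _) (ε.comp_qpar_mem_QA hc.1))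
    (QA.mul_mem (QA.mul_mem (const_mem_QA _) (inv_sub_conj_pow_mem_QA K))
      (QA.mul_mem (QA.pow_mem ε.sub_mem_QA.1 _) (QA.pow_mem ε.sub_mem_QA.2 _)))

theorem homEval_polyAct (K : ℕ) (γ : SL(2, ℤ)) (P : ℂ[X]) (U : ℂ) {V : ℂ} (hV : V ≠ 0) :
    homEval K (polyAct K γ P) U V =
      homEval K P ((γ 0 0 : ℂ) * U + (γ 0 1 : ℂ) * V) ((γ 1 0 : ℂ) * U + (γ 1 1 : ℂ) * V) := by
  rw [homEval_eq (natDegree_polyAct_le K γ P) U hV, eval_polyAct, ← homEval_mul_mul, jfac]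
  congr 1
  · field_simp
  · field_simp

/-- The ratio (γX - γz)/(γX - γz̄) is j(γ,z̄)/j(γ,z) times (X - z)/(X - z̄): in the coordinate u the
action of γ is a scaling, which makes the adapted basis diagonal. -/
theorem biPoly_polyAct (γ : SL(2, ℤ)) (P : ℂ[X]) (z : ℍ) :
    biPoly K (polyAct K γ P) z = C (jfac γ z ^ K) *
      (biPoly K P (γ • z)).comp (C (jfac γ (conj (z : ℂ)) / jfac γ z) * X) := by
  have hj := jfac_ne_zero γ z
  refine polynomial_ext_of_upperHalfPlane fun u => ?_
  have hu : (1 : ℂ) - u ≠ 0 := by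
    intro h
    have := congrArg Complex.im h
    simp at this
    exact u.im_ne_zero this
  have h1 := coe_smul_mul_jfac γ z
  have h2 : conj ((γ • z : ℍ) : ℂ) * jfac γ (conj (z : ℂ)) =
      (γ 0 0 : ℂ) * conj (z : ℂ) + (γ 0 1 : ℂ) := by
    rw [jfac_conj, ← map_mul, h1]
    simp
  rw [eval_biPoly, homEval_polyAct K γ P _ hu, eval_mul, eval_C, eval_comp, eval_biPoly,
    ← homEval_mul_mul]
  simp only [eval_mul, eval_C, eval_X]
  congr 1
  · field_simp
    linear_combination (u : ℂ) * h2 - h1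
  · simp only [jfac] at *
    field_simp
    ring

theorem biCoeff_polyAct (γ : SL(2, ℤ)) (P : ℂ[X]) (i : ℕ) (z : ℍ) :
    biCoeff K (polyAct K γ P) i z = wt i (K - i) γ z * biCoeff K P i (γ • z) := by
  have hj := jfac_ne_zero γ z
  have hj' := jfac_conj_ne_zero γ z
  have hz := sub_conj_ne_zero z
  have e : ((γ • z : ℍ) : ℂ) - conj ((γ • z : ℍ) : ℂ) =
      ((z : ℂ) - conj (z : ℂ)) / (jfac γ z * jfac γ (conj (z : ℂ))) := by
    rw [sub_conj_eq, sub_conj_eq, coe_im_smul, mul_div_assoc]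
  rw [biCoeff, biCoeff, biPoly_polyAct, coeff_C_mul, comp_C_mul_X_coeff, e, wt, neg_sub,
    zpow_neg, zpow_natCast, zpow_sub₀ hj', zpow_natCast, zpow_natCast,
    div_pow, div_pow, mul_pow]
  field_simp

theorem biCoeff_phi_mem_QAForms (hk : k = K + 2) {r s : ℤ} (hev : Even (r + s))
    (hrs : K + 4 ≤ r + s) (ε : Sgn) (h : CuspForm 𝒮ℒ k) (i : ℕ) :
    (fun z => biCoeff K (phi r s K ε h z) i z) ∈ QAForms (r + i) (s + K - i) := by
  have hQA : (fun z => biCoeff K (phi r s K ε h z) i z) ∈ QA := by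
    have e : (fun z => biCoeff K (phi r s K ε h z) i z) = fun z =>
        biCoeff K (psi r s K ε h z) i z + eis r s z * biCoeff K (eichlerPM K ε h z) i z := by
      ext z
      rw [phi_eq hk hev hrs, biCoeff_add, biCoeff_C_mul]
    rw [e]
    exact QA.add_mem (biCoeff_psi_mem_QA hk hev hrs ε h i)
      (QA.mul_mem (eis_mem_QA hev (by omega)) (biCoeff_eichlerPM_mem_QA ε h i))
  refine ⟨hQA, mem_RR_of_mem_QA hQA, fun γ => ?_⟩
  ext z
  have h1 := congrFun (slashPoly_phi hk hev hrs ε h γ) z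
  have hj := jfac_ne_zero γ z
  have hj' := jfac_conj_ne_zero γ z
  rw [slashRS]
  conv_rhs => rw [← h1]
  rw [slashPoly_apply, biCoeff_C_mul, biCoeff_polyAct γ _ i, ← mul_assoc]
  congr 1
  simp only [wt]
  rw [mul_mul_mul_comm, ← zpow_add₀ hj, ← zpow_add₀ hj']
  congr 2 <;> ring

theorem single_biCoeff_phi_mem_MI2' (hk : k = K + 2) {r s : ℤ} (hev : Even (r + s))
    (hrs : K + 4 ≤ r + s) (ε : Sgn) (h : CuspForm 𝒮ℒ k) (i : ℕ) :
    Finsupp.single (r + (i : ℤ), s + K - (i : ℤ)) (fun z => biCoeff K (phi r s K ε h z) i z) ∈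
      MI2' := single_mem_MI2' (biCoeff_phi_mem_QAForms hk hev hrs ε h i)

/-! ### The series `ψ` are second-order invariants -/

theorem PolyGrowth.mul {f g : ℍ → ℂ} (hf : PolyGrowth f) (hg : PolyGrowth g) :
    PolyGrowth (f * g) := by
  obtain ⟨C, hC, hf⟩ := hf
  obtain ⟨C', hC', hg⟩ := hg
  refine ⟨C + C', by positivity, fun b => ?_⟩
  obtain ⟨A, D, h⟩ := hf b
  obtain ⟨A', D', h'⟩ := hg b
  refine ⟨max A A', D * D', fun z hz hy => ?_⟩
  have e := h z hz ((le_max_left _ _).trans hy)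
  have e' := h' z hz ((le_max_right _ _).trans hy)
  rw [Pi.mul_apply, norm_mul, Real.rpow_add z.im_pos]
  calc _ ≤ (D * z.im ^ C) * (D' * z.im ^ C') :=
        mul_le_mul e e' (norm_nonneg _) ((norm_nonneg _).trans e)
    _ = _ := by ring

/-- The algebra of real analytic functions of polynomial growth at `i∞`. -/
def RRalg : Subalgebra ℂ (ℍ → ℂ) where
  carrier := {f | f ∈ RR}
  mul_mem' := fun hf hg => ⟨fun w hw => (hf.1 w hw).mul (hg.1 w hw), hf.2.mul hg.2⟩
  add_mem' := RR.add_mem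
  algebraMap_mem' := fun c => mem_RR_of_mem_QA (const_mem_QA c)

theorem coe_mem_RRalg : (fun z : ℍ => (z : ℂ)) ∈ RRalg := by
  refine ⟨isRealAnalytic_of_analyticAt fun z => ?_, 1, one_pos, fun b => ⟨1, |b| + 1, ?_⟩⟩
  · exact analyticAt_id.congr ((eventually_ofComplex z).mono fun w hw => hw.symm)
  · intro z hz h1
    rw [Real.rpow_one]
    have h2 := Complex.norm_le_abs_re_add_abs_im (z : ℂ)
    rw [coe_re, coe_im, abs_of_pos z.im_pos] at h2
    have h3 : |z.re| ≤ |b| := hz.trans (le_abs_self b)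
    nlinarith [abs_nonneg b]

theorem conj_coe_mem_RRalg : (fun z : ℍ => conj (z : ℂ)) ∈ RRalg := by
  convert RRalg.sub_mem coe_mem_RRalg (mem_RR_of_mem_QA sub_conj_mem_QA) using 1
  ext z
  simp

/-- Polynomial-valued functions with coefficients in an algebra of functions. -/
theorem coeff_mul_mem {A : Subalgebra ℂ (ℍ → ℂ)} {F G : ℍ → ℂ[X]}
    (hF : ∀ n, (fun z => (F z).coeff n) ∈ A) (hG : ∀ n, (fun z => (G z).coeff n) ∈ A) (n : ℕ) :
    (fun z => (F z * G z).coeff n) ∈ A := by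
  have e : (fun z => (F z * G z).coeff n) = ∑ x ∈ Finset.HasAntidiagonal.antidiagonal n,
      (fun z => (F z).coeff x.1) * (fun z => (G z).coeff x.2) := by
    ext z
    simp [coeff_mul]
  rw [e]
  exact A.sum_mem fun x _ => A.mul_mem (hF _) (hG _)

theorem coeff_pow_mem {A : Subalgebra ℂ (ℍ → ℂ)} {F : ℍ → ℂ[X]}
    (hF : ∀ n, (fun z => (F z).coeff n) ∈ A) (m n : ℕ) : (fun z => (F z ^ m).coeff n) ∈ A := by
  induction m generalizing n with
  | zero =>
    simp only [pow_zero]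
    exact A.algebraMap_mem ((1 : ℂ[X]).coeff n)
  | succ m ih =>
    simp only [pow_succ]
    exact coeff_mul_mem ih hF n

theorem coeff_X_sub_C_mem {A : Subalgebra ℂ (ℍ → ℂ)} {f : ℍ → ℂ} (hf : f ∈ A) (n : ℕ) :
    (fun z => (X - C (f z) : ℂ[X]).coeff n) ∈ A := by
  simp only [coeff_sub, coeff_C]
  refine A.sub_mem (A.algebraMap_mem ((X : ℂ[X]).coeff n)) ?_
  split_ifs
  · exact hf
  · exact A.zero_mem

theorem natDegree_psi_le (r s : ℤ) (ε : Sgn) (h : CuspForm 𝒮ℒ k) (z : ℍ) :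
    (psi r s K ε h z).natDegree ≤ K := natDegree_cosetSumPoly_le K _

theorem mem_degreeLE_of_natDegree_le {P : ℂ[X]} (hP : P.natDegree ≤ K) : P ∈ degreeLE ℂ K :=
  mem_degreeLE.mpr (natDegree_le_iff_degree_le.mp hP)

/-- Returning from the adapted basis to monomials introduces powers of z and z̄, which are not
functions of y and q; the larger algebra `RRalg` contains them. -/
theorem psi_mem_tensorPoly (hk : k = K + 2) {r s : ℤ} (hev : Even (r + s))
    (hrs : K + 4 ≤ r + s) (ε : Sgn) (h : CuspForm 𝒮ℒ k) : psi r s K ε h ∈ tensorPoly RR K := by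
  refine ⟨fun z => mem_degreeLE_of_natDegree_le (natDegree_psi_le r s ε h z), fun n => ?_⟩
  have e : (fun z => (psi r s K ε h z).coeff n) = ∑ i ∈ Finset.range (K + 1),
      (fun z => biCoeff K (psi r s K ε h z) i z) * (fun z : ℍ =>
        ((X - C (z : ℂ)) ^ i * (X - C (conj (z : ℂ))) ^ (K - i)).coeff n) := by
    ext z
    rw [coeff_eq_sum_biCoeff (natDegree_psi_le r s ε h z) z n]
    simp
  rw [e]
  exact RRalg.sum_mem fun i _ => RRalg.mul_mem
    (mem_RR_of_mem_QA (biCoeff_psi_mem_QA hk hev hrs ε h i))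
    (coeff_mul_mem (coeff_pow_mem (coeff_X_sub_C_mem coe_mem_RRalg) i)
      (coeff_pow_mem (coeff_X_sub_C_mem conj_coe_mem_RRalg) (K - i)) n)

/-- Since φ = ψ + F𝓔 is invariant, the defect of ψ is minus that of F𝓔, which the cocycle relation
and the invariance of 𝓔 compute. -/
theorem slashPoly_psi_sub (hk : k = K + 2) {r s : ℤ} (hev : Even (r + s))
    (hrs : K + 4 ≤ r + s) (ε : Sgn) (h : CuspForm 𝒮ℒ k) (γ : SL(2, ℤ)) (z : ℍ) :
    slashPoly r s K γ (psi r s K ε h) z - psi r s K ε h z =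
      -(C (eis r s z) * ε.act (period K h γ)) := by
  have h1 := congrFun (slashPoly_phi hk hev hrs ε h γ) z
  rw [slashPoly_apply, phi_eq hk hev hrs, phi_eq hk hev hrs, polyAct_add, polyAct_C_mul,
    polyAct_eichlerPM hk, mul_add, ← mul_assoc (C (wt r s γ z)), ← C_mul, eis_smul hev] at h1
  rw [slashPoly_apply]
  linear_combination h1

theorem psi_mem_Mc2 (hk : k = K + 2) {r s : ℤ} (hev : Even (r + s))
    (hrs : K + 4 ≤ r + s) (ε : Sgn) (h : CuspForm 𝒮ℒ k) : psi r s K ε h ∈ Mc2 r s K := by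
  refine ⟨⟨psi_mem_tensorPoly hk hev hrs ε h, ?_⟩, ?_⟩
  · refine Submodule.mem_iInf _ |>.mpr fun γ => ?_
    have e : (slashPoly r s K γ - LinearMap.id : (ℍ → ℂ[X]) →ₗ[ℂ] (ℍ → ℂ[X]))
        (psi r s K ε h) =
        fun z => -(C (eis r s z) * ε.act (period K h γ)) :=
      funext fun z => slashPoly_psi_sub hk hev hrs ε h γ z
    rw [Submodule.mem_comap, e]
    refine ⟨fun z => mem_degreeLE_of_natDegree_le ?_, fun n => ?_⟩
    · rw [natDegree_neg]
      exact (natDegree_C_mul_le _ _).trans (ε.natDegree_act_le (natDegree_period_le h γ))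
    · have e : (fun z => (-(C (eis r s z) * ε.act (period K h γ))).coeff n) =
          (-(ε.act (period K h γ)).coeff n) • eis r s := by
        ext z
        simp [mul_comm]
      rw [e]
      exact (invRR r s).smul_mem _ (eis_mem_invRR hev (by omega))
  · refine Submodule.mem_iInf _ |>.mpr fun β => Submodule.mem_iInf _ |>.mpr fun hβ => ?_
    rw [LinearMap.mem_ker]
    ext1 z
    refine (slashPoly_psi_sub hk hev hrs ε h β z).trans ?_
    rw [period_of_mem_B h hβ, ε.act_eq_map]
    simp

theorem psiSpan_le_Mc2 (hk : k = K + 2) {r s : ℤ} (hev : Even (r + s)) (hrs : K + 4 ≤ r + s) :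
    psiSpan k r s K ≤ Mc2 r s K := by
  rw [psiSpan, Submodule.span_le]
  rintro _ ⟨p, rfl⟩
  exact psi_mem_Mc2 hk hev hrs p.1 p.2

end Coefficients

/-! ### The maximum principle -/

/-- If w > 0, the point would also be a local minimum, so u would be locally constant and w = 0. -/
theorem second_deriv_nonpos_of_isLocalMax {u v : ℝ → ℝ} {w : ℝ} (hmax : IsLocalMax u 0)
    (hu : ∀ᶠ t in nhds 0, HasDerivAt u (v t) t) (hv : HasDerivAt v w 0) : w ≤ 0 := by
  by_contra! hw
  have hd : deriv u =ᶠ[nhds 0] v := hu.mono fun t ht => ht.deriv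
  have h0 := hu.self_of_nhds
  have hv0 : v 0 = 0 := hmax.hasDerivAt_eq_zero h0
  have hmin : IsLocalMin u 0 := isLocalMin_of_deriv_deriv_pos
    (by rwa [hd.deriv_eq, hv.deriv]) (by rw [h0.deriv, hv0]) h0.continuousAt
  have hconst : u =ᶠ[nhds 0] fun _ => u 0 := by
    filter_upwards [hmax, hmin] with t h1 h2 using le_antisymm h1 h2
  have hv' : v =ᶠ[nhds 0] fun _ => 0 := by
    filter_upwards [hd, hconst.eventuallyEq_nhds] with t h1 h2
    rw [← h1, h2.deriv_eq, deriv_const]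
  exact hw.ne' ((hv.unique ((hasDerivAt_const (0 : ℝ) (0 : ℝ)).congr_of_eventuallyEq hv')))

theorem HasWirtinger.hasDerivAt_line {f : ℂ → ℂ} {a b z e : ℂ} {t : ℝ}
    (h : HasWirtinger f a b (z + e * t)) :
    HasDerivAt (fun t : ℝ => f (z + e * t)) (a * e + b * conj e) t := by
  have h1 : HasDerivAt (fun t : ℝ => z + e * (t : ℂ)) (e * 1) t :=
    ((Complex.ofRealCLM.hasDerivAt (x := t)).const_mul e).const_add z
  have h2 : HasFDerivAt f (a • ContinuousLinearMap.id ℝ ℂ +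
      b • (Complex.conjCLE : ℂ →L[ℝ] ℂ)) (z + e * (t : ℂ)) := h
  exact (h2.comp_hasDerivAt t h1).congr_deriv (by simp)

theorem hasDerivAt_line_of_mem_RR {f : ℍ → ℂ} (hf : f ∈ RR) (z : ℍ) (e : ℂ) :
    ∀ᶠ t : ℝ in nhds 0, HasDerivAt (fun t : ℝ => f (ofComplex (z + e * t)))
      (dz f (ofComplex (z + e * t)) * e + dzbar f (ofComplex (z + e * t)) * conj e) t := by
  have hc : Filter.Tendsto (fun t : ℝ => (z : ℂ) + e * t) (nhds 0) (nhds z) := by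
    have : Continuous fun t : ℝ => (z : ℂ) + e * t := by fun_prop
    simpa using this.tendsto 0
  filter_upwards [hc.eventually (eventually_ofComplex z)] with t ht
  refine HasWirtinger.hasDerivAt_line (f := fun w => f (ofComplex w)) ?_
  have := hasWirtinger_of_mem_RR hf (ofComplex ((z : ℂ) + e * t))
  rwa [ht] at this

theorem re_second_deriv_nonpos {f : ℍ → ℂ} (hf : f ∈ QA) {z : ℍ} (hmax : ∀ w, (f w).re ≤ (f z).re)
    (e : ℂ) : ((dz (dz f) z * e + dzbar (dz f) z * conj e) * e +
      (dz (dzbar f) z * e + dzbar (dzbar f) z * conj e) * conj e).re ≤ 0 := by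
  obtain ⟨h1, h2⟩ := dz_mem_QA_and hf
  have hre : ∀ {g : ℝ → ℂ} {g' : ℂ} {t : ℝ}, HasDerivAt g g' t →
      HasDerivAt (fun t => (g t).re) g'.re t := fun h =>
    Complex.reCLM.hasFDerivAt.comp_hasDerivAt _ h
  refine second_deriv_nonpos_of_isLocalMax (u := fun t : ℝ => (f (ofComplex (z + e * t))).re)
    (v := fun t : ℝ => (dz f (ofComplex (z + e * t)) * e +
      dzbar f (ofComplex (z + e * t)) * conj e).re) ?_ ?_ ?_
  · refine Filter.Eventually.of_forall fun t => ?_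
    simpa using hmax _
  · exact (hasDerivAt_line_of_mem_RR (mem_RR_of_mem_QA hf) z e).mono fun t ht => hre ht
  · have e1 := (hasDerivAt_line_of_mem_RR (mem_RR_of_mem_QA h1) z e).self_of_nhds
    have e2 := (hasDerivAt_line_of_mem_RR (mem_RR_of_mem_QA h2) z e).self_of_nhds
    have := hre ((e1.mul_const e).add (e2.mul_const (conj e)))
    simpa using! this

/-- The second derivatives in the directions 1 and i add up to the Laplacian 4 ∂²/∂z∂z̄. -/
theorem re_dz_dzbar_nonpos {f : ℍ → ℂ} (hf : f ∈ QA) {z : ℍ} (hmax : ∀ w, (f w).re ≤ (f z).re) :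
    (dz (dzbar f) z).re ≤ 0 := by
  have h1 := re_second_deriv_nonpos hf hmax 1
  have h2 := re_second_deriv_nonpos hf hmax Complex.I
  rw [← dz_dzbar_comm hf] at h1 h2
  have e : ((dz (dz f) z * 1 + dz (dzbar f) z * conj (1 : ℂ)) * 1 +
      (dz (dzbar f) z * 1 + dzbar (dzbar f) z * conj (1 : ℂ)) * conj (1 : ℂ)) +
      ((dz (dz f) z * Complex.I + dz (dzbar f) z * conj Complex.I) * Complex.I +
      (dz (dzbar f) z * Complex.I + dzbar (dzbar f) z * conj Complex.I) * conj Complex.I) =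
      ((4 : ℝ) : ℂ) * dz (dzbar f) z := by
    simp only [map_one, Complex.conj_I]
    push_cast
    linear_combination (dz (dz f) z - 2 * dz (dzbar f) z + dzbar (dzbar f) z) * Complex.I_sq
  have h3 := congrArg Complex.re e
  rw [Complex.add_re, Complex.re_ofReal_mul] at h3
  linarith

theorem continuous_of_mem_RR {f : ℍ → ℂ} (hf : f ∈ RR) : Continuous f := by
  refine continuous_iff_continuousAt.mpr fun z => ?_
  have h1 : ContinuousAt (fun w : ℂ => f (ofComplex w)) z :=
    (hf.1.differentiableAt z).continuousAt
  have h2 : ContinuousAt (fun w : ℍ => f (ofComplex (w : ℂ))) z :=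
    ContinuousAt.comp (f := fun w : ℍ => (w : ℂ)) h1 UpperHalfPlane.continuous_coe.continuousAt
  simpa using h2

/-- An invariant continuous function that tends to `0` at the cusp and is positive somewhere
attains its maximum. -/
theorem exists_max_of_invariant {N : ℍ → ℝ} (hc : Continuous N)
    (hinv : ∀ (γ : SL(2, ℤ)) z, N (γ • z) = N z)
    (h0 : ∀ ε > 0, ∃ Y : ℝ, ∀ z : ℍ, Y ≤ z.im → N z < ε) {z₁ : ℍ} (h1 : 0 < N z₁) :
    ∃ z₀ : ℍ, ∀ z, N z ≤ N z₀ := by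
  -- Above height Y the function is smaller than N(z₁), so the maximum over the compact truncated
  -- domain is a global one.
  obtain ⟨Y, hY⟩ := h0 _ h1
  obtain ⟨γ₁, hγ₁⟩ := ModularGroup.exists_smul_mem_fd z₁
  have hmem : γ₁ • z₁ ∈ ModularGroup.truncatedFundamentalDomain Y := by
    refine ⟨hγ₁, le_of_not_gt fun h => ?_⟩
    have := hY (γ₁ • z₁) h.le
    rw [hinv] at this
    exact lt_irrefl _ this
  obtain ⟨z₀, -, hz₀⟩ := (ModularGroup.isCompact_truncatedFundamentalDomain Y).exists_isMaxOn
    ⟨_, hmem⟩ hc.continuousOn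
  have h2 : N z₁ ≤ N z₀ := by
    rw [← hinv γ₁ z₁]
    exact hz₀ hmem
  refine ⟨z₀, fun z => ?_⟩
  obtain ⟨γ, hγ⟩ := ModularGroup.exists_smul_mem_fd z
  rw [← hinv γ z]
  rcases le_or_gt (γ • z).im Y with h | h
  · exact hz₀ ⟨hγ, h⟩
  · exact ((hY _ h.le).trans_le h2).le

/-! ### Injectivity of the Eichler–Shimura map -/

theorem HasWirtinger.sum {ι : Type*} (t : Finset ι) {f : ι → ℂ → ℂ} {a b : ι → ℂ} {z : ℂ}
    (h : ∀ i ∈ t, HasWirtinger (f i) (a i) (b i) z) :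
    HasWirtinger (fun w => ∑ i ∈ t, f i w) (∑ i ∈ t, a i) (∑ i ∈ t, b i) z := by
  classical
  induction t using Finset.induction_on with
  | empty => simpa using HasWirtinger.const 0 z
  | insert i t hi ih =>
    simp only [Finset.sum_insert hi]
    exact (h i (Finset.mem_insert_self i t)).add
      (ih fun j hj => h j (Finset.mem_insert_of_mem hj))

theorem HasWirtinger.pow {f : ℂ → ℂ} {a b z : ℂ} (h : HasWirtinger f a b z) (m : ℕ) :
    HasWirtinger (fun w => f w ^ m) (m * f z ^ (m - 1) * a) (m * f z ^ (m - 1) * b) z :=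
  HasWirtinger.comp_hasDerivAt (p := fun x => x ^ m) (hasDerivAt_pow m (f z)) h

theorem dz_mul {f g : ℍ → ℂ} (hf : f ∈ RR) (hg : g ∈ RR) (z : ℍ) :
    dz (f * g) z = dz f z * g z + f z * dz g z ∧
      dzbar (f * g) z = dzbar f z * g z + f z * dzbar g z := by
  have h := (hasWirtinger_of_mem_RR hf z).mul (hasWirtinger_of_mem_RR hg z)
  exact ⟨(HasWirtinger.dz_eq (f := f * g) h).trans (by simp),
    (HasWirtinger.dzbar_eq (f := f * g) h).trans (by simp)⟩

theorem dz_conj {f : ℍ → ℂ} (hf : f ∈ RR) (z : ℍ) :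
    dz (fun z => conj (f z)) z = conj (dzbar f z) ∧
      dzbar (fun z => conj (f z)) z = conj (dz f z) := by
  have h := (hasWirtinger_of_mem_RR hf z).conjugate
  exact ⟨HasWirtinger.dz_eq (f := fun z => conj (f z)) h,
    HasWirtinger.dzbar_eq (f := fun z => conj (f z)) h⟩

theorem dz_im_zpow (j : ℤ) (z : ℍ) :
    dz (fun z : ℍ => (z.im : ℂ) ^ j) z = j / (2 * Complex.I) * (z.im : ℂ) ^ (j - 1) ∧
      dzbar (fun z : ℍ => (z.im : ℂ) ^ j) z = -j / (2 * Complex.I) * (z.im : ℂ) ^ (j - 1) := by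
  have h := hasWirtinger_qTerm (j := j) discHol_one discHol_one z
  have e : qTerm j 1 1 = fun z : ℍ => (z.im : ℂ) ^ j := by ext z; simp [qTerm]
  rw [e] at h
  have e1 : deriv (1 : ℂ → ℂ) = 0 := by ext x; exact deriv_const x 1
  exact ⟨h.dz_eq.trans (by simp [qTerm, e1]), h.dzbar_eq.trans (by simp [qTerm, e1])⟩

theorem conj_mem_QA {f : ℍ → ℂ} (hf : f ∈ QA) : (fun z => conj (f z)) ∈ QA := by
  refine QA_induction (p := fun f => (fun z => conj (f z)) ∈ QA) ?_ ?_ ?_ hf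
  · intro j g₁ g₂ h₁ h₂
    convert qTerm_mem_QA (j := j) h₂ h₁ using 1
    ext z
    simp [qTerm]
    ring
  · intro f g hf hg
    convert QA.add_mem hf hg using 1
    ext z
    simp
  · intro c f hf
    convert QA.smul_mem hf (conj c) using 1
    ext z
    simp

section Injectivity

variable {k : ℤ} {K : ℕ}

theorem cuspForm_mem_QA (h : CuspForm 𝒮ℒ k) : (fun z => h z) ∈ QA := by
  simp only [cuspForm_eq]
  exact comp_qpar_mem_QA (discCusp_cuspQ h).1

theorem dzbar_cuspForm (h : CuspForm 𝒮ℒ k) (z : ℍ) : dzbar (fun z => h z) z = 0 := by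
  refine HasWirtinger.dzbar_eq (a := deriv (cuspQ h) (qpar z) * (2 * Real.pi * Complex.I * qpar z))
    ((HasWirtinger.of_hasDerivAt
    (hasDerivAt_comp_qpar (discCusp_cuspQ h).1 z)).congr_of_eventuallyEq ?_)
  filter_upwards [eventually_ofComplex z] with w hw
  rw [cuspForm_eq, qpar, hw]

/-- The sum of a holomorphic and an antiholomorphic Eichler integral. -/
def eichlerPair (K : ℕ) (h h' : CuspForm 𝒮ℒ k) (z : ℍ) : ℂ[X] :=
  eichlerPM K .plus h z + eichlerPM K .minus h' z

theorem natDegree_eichlerPair_le (h h' : CuspForm 𝒮ℒ k) (z : ℍ) :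
    (eichlerPair K h h' z).natDegree ≤ K :=
  natDegree_add_le_of_degree_le (natDegree_eichlerPM_le _ h z) (natDegree_eichlerPM_le _ h' z)

/-- The top coefficient of `eichlerPair` in the adapted basis, a form of weights `(-K, 0)`. -/
def topCoeff (K : ℕ) (h h' : CuspForm 𝒮ℒ k) (z : ℍ) : ℂ :=
  biCoeff K (eichlerPair K h h' z) K z

theorem topCoeff_mem_QA (h h' : CuspForm 𝒮ℒ k) : topCoeff K h h' ∈ QA := by
  have e : topCoeff K h h' = (fun z => biCoeff K (eichlerPM K .plus h z) K z) +
      fun z => biCoeff K (eichlerPM K .minus h' z) K z := by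
    ext z
    exact biCoeff_add _ _ _ _ _
  rw [e]
  exact QA.add_mem (biCoeff_eichlerPM_mem_QA _ h K) (biCoeff_eichlerPM_mem_QA _ h' K)

theorem topCoeff_smul {h h' : CuspForm 𝒮ℒ k}
    (hinv : ∀ (γ : SL(2, ℤ)) z, polyAct K γ (eichlerPair K h h' (γ • z)) = eichlerPair K h h' z)
    (γ : SL(2, ℤ)) (z : ℍ) : topCoeff K h h' (γ • z) = jfac γ z ^ K * topCoeff K h h' z := by
  have hj := jfac_ne_zero γ z
  have := biCoeff_polyAct (K := K) γ (eichlerPair K h h' (γ • z)) K z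
  rw [hinv, wt, sub_self, neg_zero, zpow_zero, mul_one, zpow_neg, zpow_natCast] at this
  rw [topCoeff, topCoeff, this, mul_inv_cancel_left₀ (pow_ne_zero K hj)]

/-- At X = z̄ every basis element except (X - z)^K vanishes. -/
theorem biCoeff_top_mul {P : ℂ[X]} (hP : P.natDegree ≤ K) (z : ℍ) :
    biCoeff K P K z * (conj (z : ℂ) - z) ^ K = P.eval (conj (z : ℂ)) := by
  conv_rhs => rw [biCoeff_expansion K P hP z]
  rw [eval_finsetSum, Finset.sum_range_succ, Finset.sum_eq_zero]
  · simp
  · intro i hi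
    have : K - i ≠ 0 := by
      have := Finset.mem_range.mp hi
      omega
    simp [this]

/-- Evaluation at X = z̄ gives F_h^+(z, z̄) and the conjugate of F_{h'}^+(z, z). In the latter only
l = K remains, so that summand is antiholomorphic. -/
theorem topCoeff_mul (h h' : CuspForm 𝒮ℒ k) (z : ℍ) :
    topCoeff K h h' z * (conj (z : ℂ) - z) ^ K =
      (∑ l ∈ Finset.range (K + 1), -(eichlerConst K l * cuspPrim h (l + 1) z *
        ((z : ℂ) - conj (z : ℂ)) ^ (K - l))) +
      conj (-(eichlerConst K K * cuspPrim h' (K + 1) z)) := by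
  rw [topCoeff, biCoeff_top_mul (natDegree_eichlerPair_le h h' z), eichlerPair, eval_add]
  congr 1
  · rw [eichlerPM, Sgn.act, ← homEval_one_right (natDegree_eichler_le h K z),
      homEval_eichler h K z _ one_ne_zero, ← Finset.sum_neg_distrib]
    simp
  · rw [eichlerPM, Sgn.act, eval_map, eval₂_hom]
    congr 1
    rw [← homEval_one_right (natDegree_eichler_le h' K z), homEval_eichler h' K z _ one_ne_zero,
      Finset.sum_range_succ, Finset.sum_eq_zero]
    · simp
    · intro l hl
      have : K - l ≠ 0 := by
        have := Finset.mem_range.mp hl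
        omega
      simp [this]

/-- In `topCoeff_mul` the antiholomorphic summand is killed by ∂/∂z, and the other one has
derivative h(z)(z - z̄)^K by telescoping. Evenness of K identifies (z - z̄)^K with (z̄ - z)^K, and
the factor (z̄ - z)^K on the left accounts for the term in y⁻¹. -/
theorem dz_topCoeff (hK : Even K) (h h' : CuspForm 𝒮ℒ k) (z : ℍ) :
    dz (topCoeff K h h') z = h z + (K * Complex.I / 2) * (z.im : ℂ)⁻¹ * topCoeff K h h' z := by
  have hD : HasWirtinger (fun w : ℂ => conj w + (-1) * w) _ _ z :=
    (HasWirtinger.id (z : ℂ)).conjugate.add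
      ((HasWirtinger.const (-1) (z : ℂ)).mul (HasWirtinger.id z))
  have h1 := (hasWirtinger_of_mem_RR (mem_RR_of_mem_QA (topCoeff_mem_QA (K := K) h h')) z).mul
    (hD.pow K)
  have hA : HasWirtinger (fun w : ℂ => w + (-1) * conj w) _ _ z :=
    (HasWirtinger.id (z : ℂ)).add
      ((HasWirtinger.const (-1) (z : ℂ)).mul (HasWirtinger.id (z : ℂ)).conjugate)
  have h2 := HasWirtinger.sum (Finset.range (K + 1)) fun l _ =>
    (HasWirtinger.const (-1) (z : ℂ)).mul (((HasWirtinger.const (eichlerConst K l) (z : ℂ)).mul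
      (HasWirtinger.of_hasDerivAt (hasDerivAt_cuspPrim h l z))).mul (hA.pow (K - l)))
  have h3 := ((HasWirtinger.const (-1) (z : ℂ)).mul ((HasWirtinger.const (eichlerConst K K)
    (z : ℂ)).mul (HasWirtinger.of_hasDerivAt (hasDerivAt_cuspPrim h' K z)))).conjugate
  have h4 := (h1.unique ((h2.add h3).congr_of_eventuallyEq ?_)).1
  · have htel := eichlerConst_telescope K (fun l => cuspPrim h l z) ((z : ℂ) - conj (z : ℂ)) 1
    rw [cuspPrim_zero] at htel
    have hy := im_ne_zero' z
    have hz := sub_conj_eq z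
    have hpow : (conj (z : ℂ) - z) ^ K = ((z : ℂ) - conj (z : ℂ)) ^ K := by
      rw [← neg_sub, hK.neg_pow]
    have hpow1 : (K : ℂ) * (conj (z : ℂ) - z) ^ (K - 1) * (conj (z : ℂ) - z) =
        K * (conj (z : ℂ) - z) ^ K := by
      rcases Nat.eq_zero_or_pos K with rfl | hpos
      · simp
      · rw [mul_assoc, ← pow_succ, Nat.sub_add_cancel hpos]
    have hz' : conj (z : ℂ) - z ≠ 0 := by
      rw [← neg_sub]
      exact neg_ne_zero.mpr (sub_conj_ne_zero z)
    simp only [map_zero, mul_zero, zero_mul, add_zero, zero_add, ofComplex_apply, neg_one_mul,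
      ← sub_eq_add_neg, mul_one, zero_sub, Finset.sum_neg_distrib] at h4
    simp only [one_pow, mul_one] at htel
    rw [htel, neg_neg] at h4
    have h5 : (dz (topCoeff K h h') z * (conj (z : ℂ) - z)) * (conj (z : ℂ) - z) ^ K =
        (h z * (conj (z : ℂ) - z) + topCoeff K h h' z * K) * (conj (z : ℂ) - z) ^ K := by
      linear_combination (conj (z : ℂ) - z) * h4 + topCoeff K h h' z * hpow1 -
        h z * (conj (z : ℂ) - z) * hpow
    have h6 := mul_right_cancel₀ (pow_ne_zero K hz') h5
    refine mul_right_cancel₀ hz' (h6.trans ?_)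
    have hD' : conj (z : ℂ) - z = -(2 * Complex.I * z.im) := by rw [← hz, neg_sub]
    rw [hD']
    field_simp
    linear_combination topCoeff K h h' z * K * Complex.I_sq
  · filter_upwards [eventually_ofComplex z] with w hw
    have := topCoeff_mul (K := K) h h' (ofComplex w)
    rw [hw] at this
    simp only [neg_one_mul, ← sub_eq_add_neg]
    rw [this]

/-- The invariant function `y^K |p|²` attached to the top coefficient `p`. -/
def topNorm (K : ℕ) (h h' : CuspForm 𝒮ℒ k) : ℍ → ℂ :=
  (fun z : ℍ => (z.im : ℂ) ^ (K : ℤ)) * (topCoeff K h h' * fun z => conj (topCoeff K h h' z))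

theorem topNorm_mem_QA (h h' : CuspForm 𝒮ℒ k) : topNorm K h h' ∈ QA :=
  QA.mul_mem (im_zpow_mem_QA K)
    (QA.mul_mem (topCoeff_mem_QA h h') (conj_mem_QA (topCoeff_mem_QA h h')))

theorem topNorm_eq (h h' : CuspForm 𝒮ℒ k) (z : ℍ) :
    topNorm K h h' z = ((z.im ^ K * ‖topCoeff K h h' z‖ ^ 2 : ℝ) : ℂ) := by
  simp only [topNorm, Pi.mul_apply, Complex.mul_conj, Complex.normSq_eq_norm_sq]
  push_cast
  rw [zpow_natCast]

theorem topNorm_smul {h h' : CuspForm 𝒮ℒ k}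
    (hinv : ∀ (γ : SL(2, ℤ)) z, polyAct K γ (eichlerPair K h h' (γ • z)) = eichlerPair K h h' z)
    (γ : SL(2, ℤ)) (z : ℍ) : topNorm K h h' (γ • z) = topNorm K h h' z := by
  have hj := jfac_ne_zero γ z
  have hj' := jfac_conj_ne_zero γ z
  simp only [topNorm, Pi.mul_apply, topCoeff_smul hinv, coe_im_smul, map_mul, map_pow, ← jfac_conj,
    zpow_natCast]
  rw [div_pow, mul_pow]
  field_simp

/-- The derivative of y^K cancels against the conjugate of the y⁻¹ term of `dz_topCoeff`. -/
theorem dzbar_topNorm (hK : Even K) (h h' : CuspForm 𝒮ℒ k) :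
    dzbar (topNorm K h h') = (fun z : ℍ => (z.im : ℂ) ^ (K : ℤ)) *
      (dzbar (topCoeff K h h') * (fun z => conj (topCoeff K h h' z)) +
        topCoeff K h h' * fun z => conj (h z)) := by
  have hp := mem_RR_of_mem_QA (topCoeff_mem_QA (K := K) h h')
  have hpc := mem_RR_of_mem_QA (conj_mem_QA (topCoeff_mem_QA (K := K) h h'))
  have hpp := mem_RR_of_mem_QA
    (QA.mul_mem (topCoeff_mem_QA (K := K) h h') (conj_mem_QA (topCoeff_mem_QA (K := K) h h')))
  ext z
  have hy := im_ne_zero' z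
  rw [topNorm, (dz_mul (mem_RR_of_mem_QA (im_zpow_mem_QA K)) hpp z).2, (dz_mul hp hpc z).2,
    (dz_conj hp z).2, (dz_im_zpow K z).2, dz_topCoeff hK, zpow_sub_one₀ hy]
  simp only [Pi.mul_apply, Pi.add_apply, map_add, map_mul, map_inv₀, map_div₀, Complex.conj_I,
    Complex.conj_ofReal, map_natCast, map_ofNat, Int.cast_natCast]
  have hI := Complex.I_ne_zero
  field_simp
  linear_combination (-(K : ℂ)) * topCoeff K h h' z * conj (topCoeff K h h' z) * Complex.I_sq

/-- The order of differentiation is exchanged; then h drops out, being holomorphic. -/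
theorem dz_dzbar_topCoeff (hK : Even K) (h h' : CuspForm 𝒮ℒ k) (z : ℍ) :
    dz (dzbar (topCoeff K h h')) z =
      (K * Complex.I / 2) * (z.im : ℂ)⁻¹ * dzbar (topCoeff K h h') z +
        (K / 4) * (z.im : ℂ)⁻¹ ^ 2 * topCoeff K h h' z := by
  have hp := mem_RR_of_mem_QA (topCoeff_mem_QA (K := K) h h')
  have hy := im_ne_zero' z
  have e : dz (topCoeff K h h') = (fun z => h z) + ((K : ℂ) * Complex.I / 2) •
      ((fun z : ℍ => (z.im : ℂ) ^ (-1 : ℤ)) * topCoeff K h h') := by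
    ext z
    rw [dz_topCoeff hK]
    simp [mul_assoc]
  have hq := mem_RR_of_mem_QA (QA.mul_mem (im_zpow_mem_QA (-1)) (topCoeff_mem_QA (K := K) h h'))
  rw [dz_dzbar_comm (topCoeff_mem_QA h h'), e,
    (dz_add (mem_RR_of_mem_QA (cuspForm_mem_QA h)) (RR.smul_mem _ hq)).2, (dz_smul _ hq).2,
    Pi.add_apply, Pi.smul_apply, (dz_mul (mem_RR_of_mem_QA (im_zpow_mem_QA (-1))) hp z).2,
    (dz_im_zpow (-1) z).2, dzbar_cuspForm, zpow_sub_one₀ hy, zpow_neg_one]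
  have hI := Complex.I_ne_zero
  simp only [smul_eq_mul, Int.cast_neg, Int.cast_one]
  field_simp
  ring

/-- The mixed terms cancel against the derivative of y^K and only squares remain. Positivity of the
first one for K > 0 is what contradicts a maximum. -/
theorem dz_dzbar_topNorm (hK : Even K) (h h' : CuspForm 𝒮ℒ k) (z : ℍ) :
    dz (dzbar (topNorm K h h')) z = ((z.im ^ K * (K / 4 * (z.im⁻¹ ^ 2 * ‖topCoeff K h h' z‖ ^ 2) +
      ‖dzbar (topCoeff K h h') z‖ ^ 2 + ‖h z‖ ^ 2) : ℝ) : ℂ) := by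
  have hpQ := topCoeff_mem_QA (K := K) h h'
  have hp := mem_RR_of_mem_QA hpQ
  have hpc := mem_RR_of_mem_QA (conj_mem_QA hpQ)
  have hm := mem_RR_of_mem_QA (dz_mem_QA_and hpQ).2
  have hh := mem_RR_of_mem_QA (cuspForm_mem_QA h)
  have hhc := mem_RR_of_mem_QA (conj_mem_QA (cuspForm_mem_QA h))
  have hA := mem_RR_of_mem_QA (QA.mul_mem (dz_mem_QA_and hpQ).2 (conj_mem_QA hpQ))
  have hB := mem_RR_of_mem_QA (QA.mul_mem hpQ (conj_mem_QA (cuspForm_mem_QA h)))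
  have hy := im_ne_zero' z
  rw [dzbar_topNorm hK, (dz_mul (mem_RR_of_mem_QA (im_zpow_mem_QA K)) (RR.add_mem hA hB) z).1,
    (dz_add hA hB).1, Pi.add_apply (dz _), (dz_mul hm hpc z).1, (dz_mul hp hhc z).1,
    (dz_conj hp z).1, (dz_conj hh z).1, (dz_im_zpow K z).1, dz_topCoeff hK, dz_dzbar_topCoeff hK,
    dzbar_cuspForm, zpow_sub_one₀ hy, zpow_natCast]
  push_cast
  rw [← Complex.mul_conj', ← Complex.mul_conj', ← Complex.mul_conj']
  simp only [Pi.mul_apply, Pi.add_apply, map_zero, mul_zero, add_zero]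
  have hI := Complex.I_ne_zero
  field_simp
  linear_combination ((K : ℂ) * z.im * 4 * (dzbar (topCoeff K h h') z * conj (topCoeff K h h' z) +
    topCoeff K h h' z * conj (h z))) * Complex.I_sq

end Injectivity

/-! ### Vanishing of invariant sums of Eichler integrals, and linearity -/

section Vanishing

variable {k : ℤ} {K : ℕ}

theorem exists_bound_cuspPrim (h : CuspForm 𝒮ℒ k) (l : ℕ) :
    ∃ M : ℝ, 0 ≤ M ∧ ∀ z : ℍ, 1 ≤ z.im → ‖cuspPrim h l z‖ ≤ M * ‖qpar z‖ := by
  obtain ⟨M, hM0, hM⟩ := ((discCusp_cuspQ h).iterPrim l).exists_bound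
    (exp_neg_two_pi_mul_lt_one one_pos)
  exact ⟨M, hM0, fun z hz => hM _ (norm_qpar_le_of_one_le hz)⟩

theorem norm_sub_conj (z : ℍ) : ‖(z : ℂ) - conj (z : ℂ)‖ = 2 * z.im := by
  rw [sub_conj_eq, norm_mul, norm_mul, Complex.norm_I, Complex.norm_real,
    Real.norm_of_nonneg z.im_pos.le]
  simp

/-- All terms of `topCoeff_mul` carry a factor O(|q|), and their powers of 2y are at most the (2y)^K
on the left, because 2y ≥ 1. -/
theorem exists_bound_topCoeff (h h' : CuspForm 𝒮ℒ k) :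
    ∃ M : ℝ, 0 ≤ M ∧ ∀ z : ℍ, 1 ≤ z.im → ‖topCoeff K h h' z‖ ≤ M * ‖qpar z‖ := by
  choose M hM0 hM using fun l => exists_bound_cuspPrim h l
  obtain ⟨M', hM0', hM'⟩ := exists_bound_cuspPrim h' (K + 1)
  refine ⟨(∑ l ∈ Finset.range (K + 1), ‖eichlerConst K l‖ * M (l + 1)) + ‖eichlerConst K K‖ * M',
    add_nonneg (Finset.sum_nonneg fun l _ => mul_nonneg (norm_nonneg _) (hM0 _)) (by positivity),
    fun z hz => ?_⟩
  have h2 : 1 ≤ 2 * z.im := by linarith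
  refine le_of_mul_le_mul_right (a := (2 * z.im) ^ K) ?_ (by positivity)
  have e : ‖topCoeff K h h' z‖ * (2 * z.im) ^ K =
      ‖topCoeff K h h' z * (conj (z : ℂ) - z) ^ K‖ := by
    rw [norm_mul, norm_pow, norm_sub_rev, norm_sub_conj]
  rw [e, topCoeff_mul, add_mul, add_mul]
  refine (norm_add_le _ _).trans (add_le_add ?_ ?_)
  · rw [Finset.sum_mul, Finset.sum_mul]
    refine norm_sum_le_of_le _ fun l hl => ?_
    rw [norm_neg, norm_mul, norm_mul, norm_pow, norm_sub_conj, mul_assoc ‖eichlerConst K l‖ (M _)]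
    gcongr
    · exact mul_nonneg (norm_nonneg _) (mul_nonneg (hM0 _) (norm_nonneg _))
    · exact hM _ z hz
    · omega
  · rw [Complex.norm_conj, norm_neg, norm_mul, mul_assoc ‖eichlerConst K K‖]
    refine (mul_le_mul_of_nonneg_left (hM' z hz) (norm_nonneg _)).trans ?_
    exact le_mul_of_one_le_right (by positivity) (one_le_pow₀ h2)

theorem topNorm_decay (h h' : CuspForm 𝒮ℒ k) :
    ∀ ε > 0, ∃ Y : ℝ, ∀ z : ℍ, Y ≤ z.im → (topNorm K h h' z).re < ε := by
  intro ε hε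
  obtain ⟨M, hM0, hM⟩ := exists_bound_topCoeff (K := K) h h'
  have h1 := (Real.tendsto_pow_mul_exp_neg_atTop_nhds_zero K).const_mul (M ^ 2)
  rw [mul_zero] at h1
  obtain ⟨Y, hY⟩ := Filter.eventually_atTop.mp (h1.eventually (gt_mem_nhds hε))
  refine ⟨max 1 Y, fun z hz => ?_⟩
  have hz1 := (le_max_left 1 Y).trans hz
  refine lt_of_le_of_lt ?_ (hY z.im ((le_max_right 1 Y).trans hz))
  have hq : ‖qpar z‖ ^ 2 ≤ Real.exp (-z.im) := by
    rw [norm_qpar, ← Real.exp_nat_mul, Real.exp_le_exp]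
    have := z.im_pos
    have hpi := Real.pi_gt_three
    push_cast
    nlinarith
  rw [topNorm_eq, Complex.ofReal_re]
  calc z.im ^ K * ‖topCoeff K h h' z‖ ^ 2 ≤ z.im ^ K * (M * ‖qpar z‖) ^ 2 := by
        have := z.im_pos
        gcongr
        exact hM z hz1
    _ = M ^ 2 * (z.im ^ K * ‖qpar z‖ ^ 2) := by ring
    _ ≤ M ^ 2 * (z.im ^ K * Real.exp (-z.im)) := by
        have := z.im_pos
        gcongr

theorem topCoeff_eq_zero (hK : Even K) (hpos : 0 < K) {h h' : CuspForm 𝒮ℒ k}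
    (hinv : ∀ (γ : SL(2, ℤ)) z, polyAct K γ (eichlerPair K h h' (γ • z)) = eichlerPair K h h' z) :
    topCoeff K h h' = 0 := by
  by_contra hne
  obtain ⟨z₁, hz₁⟩ := Function.ne_iff.mp hne
  have hQ := topNorm_mem_QA (K := K) h h'
  have hposN : ∀ z, topCoeff K h h' z ≠ 0 → 0 < (topNorm K h h' z).re := by
    intro z hz
    have := z.im_pos
    rw [topNorm_eq, Complex.ofReal_re]
    have := norm_pos_iff.mpr hz
    positivity
  obtain ⟨z₀, hz₀⟩ := exists_max_of_invariant (N := fun z => (topNorm K h h' z).re)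
    (Complex.continuous_re.comp (continuous_of_mem_RR (mem_RR_of_mem_QA hQ)))
    (fun γ z => by rw [topNorm_smul hinv]) (topNorm_decay h h') (hposN z₁ hz₁)
  have h0 : topCoeff K h h' z₀ ≠ 0 := by
    intro h0
    have := (hposN z₁ hz₁).trans_le (hz₀ z₁)
    simp [topNorm_eq, h0] at this
  have h1 := re_dz_dzbar_nonpos hQ hz₀
  rw [dz_dzbar_topNorm hK, Complex.ofReal_re] at h1
  have := z₀.im_pos
  have := norm_pos_iff.mpr h0
  have : 0 < (K : ℝ) := by exact_mod_cast hpos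
  refine absurd h1 (not_le.mpr ?_)
  positivity

theorem eichlerPair_map_conj (h h' : CuspForm 𝒮ℒ k) (z : ℍ) :
    (eichlerPair K h h' z).map (starRingEnd ℂ) = eichlerPair K h' h z := by
  simp only [eichlerPair, eichlerPM, Sgn.act, Polynomial.map_add, Polynomial.map_map]
  rw [add_comm]
  congr 1
  ext n
  simp

/-- A holomorphic and an antiholomorphic Eichler integral whose sum is invariant vanish. -/
theorem eq_zero_of_eichlerPair_invariant (hk : k = K + 2) (hK : Even K) {h h' : CuspForm 𝒮ℒ k}
    (hinv : ∀ (γ : SL(2, ℤ)) z, polyAct K γ (eichlerPair K h h' (γ • z)) = eichlerPair K h h' z) :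
    h = 0 ∧ h' = 0 := by
  rcases Nat.eq_zero_or_pos K with rfl | hpos
  -- For K = 0 the positive term with factor K/4 is missing; here the weight is 2, and there are no
  -- cusp forms of weight below 12.
  · have h0 := rank_zero_iff_forall_zero.mp
      (CuspForm.rank_eq_zero_of_weight_lt_twelve (k := k) (by omega))
    exact ⟨h0 h, h0 h'⟩
  · have key : ∀ {h h' : CuspForm 𝒮ℒ k}, (∀ (γ : SL(2, ℤ)) z,
        polyAct K γ (eichlerPair K h h' (γ • z)) = eichlerPair K h h' z) → h = 0 := by
      intro h h' hinv
      ext z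
      have h1 := dz_topCoeff hK h h' z
      rw [topCoeff_eq_zero hK hpos hinv] at h1
      simpa [dz] using h1.symm
    -- Conjugation of the coefficients exchanges h and h' and commutes with the action of Γ.
    refine ⟨key hinv, key (h' := h) fun γ z => ?_⟩
    rw [← eichlerPair_map_conj h h' (γ • z), ← eichlerPair_map_conj h h' z, polyAct_map_conj, hinv]

theorem eichler_add (h h' : CuspForm 𝒮ℒ k) (z : ℍ) :
    eichler K (h + h') z = eichler K h z + eichler K h' z := by
  simp only [eichler_eq_momPoly,
    momPoly_eq K _ fun l _ => integrableOn_ray_cuspQ _ z l]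
  rw [← neg_add, ← Finset.sum_add_distrib]
  congr 1
  refine Finset.sum_congr rfl fun l _ => ?_
  have e : moment K (ray (cuspQ (h + h')) (qpar z)) l =
      moment K (ray (cuspQ h) (qpar z)) l + moment K (ray (cuspQ h') (qpar z)) l := by
    rw [moment, moment, moment, ← mul_add, ← MeasureTheory.integral_add
      (integrableOn_ray_cuspQ h z l) (integrableOn_ray_cuspQ h' z l)]
    congr 1
    refine MeasureTheory.setIntegral_congr_fun measurableSet_Ioi fun t ht => ?_
    have ht' : (0 : ℝ) ≤ t := le_of_lt (show (0 : ℝ) < t from ht)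
    simp only [← ray_cuspQ _ z ht', add_apply, add_mul]
  rw [e, add_mul, C_add, add_mul]

theorem eichler_smul (c : ℂ) (h : CuspForm 𝒮ℒ k) (z : ℍ) :
    eichler K (c • h) z = C c * eichler K h z := by
  simp only [eichler_eq_momPoly,
    momPoly_eq K _ fun l _ => integrableOn_ray_cuspQ _ z l]
  rw [mul_neg, Finset.mul_sum]
  congr 1
  refine Finset.sum_congr rfl fun l _ => ?_
  have e : moment K (ray (cuspQ (c • h)) (qpar z)) l =
      c * moment K (ray (cuspQ h) (qpar z)) l := by
    rw [moment, moment, mul_left_comm, ← MeasureTheory.integral_const_mul c]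
    congr 1
    refine MeasureTheory.setIntegral_congr_fun measurableSet_Ioi fun t ht => ?_
    have ht' : (0 : ℝ) ≤ t := le_of_lt (show (0 : ℝ) < t from ht)
    simp only [← ray_cuspQ _ z ht', smul_apply, smul_eq_mul, mul_assoc]
  rw [e, mul_assoc c, C_mul, mul_assoc]

/-- Linear combinations of the Eichler integrals are of the form `eichlerPair`. -/
theorem exists_eichlerPair_eq (x : (Sgn × CuspForm 𝒮ℒ k) →₀ ℂ) :
    ∃ h h' : CuspForm 𝒮ℒ k, ∀ z : ℍ,
      x.sum (fun p c => C c * eichlerPM K p.1 p.2 z) = eichlerPair K h h' z := by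
  have hz : ∀ z : ℍ, eichler K (0 : CuspForm 𝒮ℒ k) z = 0 := fun z => by
    simpa using eichler_smul (K := K) 0 (0 : CuspForm 𝒮ℒ k) z
  induction x using Finsupp.induction_linear with
  | zero => exact ⟨0, 0, fun z => by simp [eichlerPair, eichlerPM, Sgn.act, hz]⟩
  | add x y hx hy =>
    obtain ⟨h₁, h₁', e₁⟩ := hx
    obtain ⟨h₂, h₂', e₂⟩ := hy
    refine ⟨h₁ + h₂, h₁' + h₂', fun z => ?_⟩
    rw [Finsupp.sum_add_index' (by simp) (by simp [add_mul]), e₁, e₂]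
    simp only [eichlerPair, eichlerPM, Sgn.act, eichler_add, Polynomial.map_add]
    ring
  | single p c =>
    obtain ⟨ε, h⟩ := p
    cases ε with
    | plus => exact ⟨c • h, 0, fun z => by simp [eichlerPair, eichlerPM, Sgn.act, hz, eichler_smul]⟩
    | minus =>
      -- The integral F_h^- is conjugate linear in h, so the scalar c is conjugated when it is moved
      -- into h.
      exact ⟨0, conj c • h, fun z => by simp [eichlerPair, eichlerPM, Sgn.act, hz, eichler_smul]⟩

end Vanishing

/-! ### From linear relations among the ψ to the linear map -/

section LinearMap

variable {k : ℤ} {K : ℕ} {r s : ℤ}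

theorem polyAct_sum {ι : Type*} (K : ℕ) (γ : SL(2, ℤ)) (t : Finset ι) (P : ι → ℂ[X]) :
    polyAct K γ (∑ j ∈ t, P j) = ∑ j ∈ t, polyAct K γ (P j) := by
  classical
  induction t using Finset.induction_on with
  | empty => exact polyAct_zero K γ
  | insert j t hj ih => rw [Finset.sum_insert hj, Finset.sum_insert hj, polyAct_add, ih]

/-- The operator γ - 1 turns the relation among the ψ into 𝓔 times the same relation among the
period polynomials, which are constant in z; one point with 𝓔 ≠ 0 frees them of the factor. By the
cocycle relation the combination of Eichler integrals is then invariant, hence zero by injectivity.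
-/
theorem sum_eichlerPM_eq_zero (hk : k = K + 2) (hK : Even K) (hev : Even (r + s))
    (hrs : K + 4 ≤ r + s) (x : (Sgn × CuspForm 𝒮ℒ k) →₀ ℂ)
    (hx : ∑ p ∈ x.support, x p • psi r s K p.1 p.2 = 0) (z : ℍ) :
    ∑ p ∈ x.support, C (x p) * eichlerPM K p.1 p.2 z = 0 := by
  have hper : ∀ γ : SL(2, ℤ), ∑ p ∈ x.support, C (x p) * p.1.act (period K p.2 γ) = 0 := by
    intro γ
    obtain ⟨z, hz⟩ := exists_eis_ne_zero hev (show 3 ≤ r + s by omega)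
    have h1 := congrFun (congrArg (fun F => slashPoly r s K γ F - F) hx) z
    simp only [map_sum, map_smul, ← Finset.sum_sub_distrib, ← smul_sub, map_zero,
      Finset.sum_apply, Pi.smul_apply, Pi.sub_apply, slashPoly_psi_sub hk hev hrs] at h1
    simp only [sub_zero, smul_eq_C_mul, mul_neg, Finset.sum_neg_distrib, Pi.zero_apply, neg_eq_zero,
      mul_left_comm (C (x _)), ← Finset.mul_sum, mul_eq_zero, C_eq_zero] at h1
    exact h1.resolve_left hz
  obtain ⟨h, h', e⟩ := exists_eichlerPair_eq (K := K) x
  simp only [Finsupp.sum] at e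
  have hzero := eq_zero_of_eichlerPair_invariant hk hK (h := h) (h' := h') fun γ z => by
    rw [← e, ← e, polyAct_sum]
    simp only [polyAct_C_mul, polyAct_eichlerPM hk, mul_add, Finset.sum_add_distrib, hper, add_zero]
  rw [e, hzero.1, hzero.2]
  have h0 : ∀ z : ℍ, eichler K (0 : CuspForm 𝒮ℒ k) z = 0 := fun z => by
    simpa using eichler_smul (K := K) 0 (0 : CuspForm 𝒮ℒ k) z
  simp [eichlerPair, eichlerPM, Sgn.act, h0]

theorem sum_biCoeff_phi_eq_zero (hk : k = K + 2) (hK : Even K) (hev : Even (r + s))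
    (hrs : K + 4 ≤ r + s) (x : (Sgn × CuspForm 𝒮ℒ k) →₀ ℂ)
    (hx : ∑ p ∈ x.support, x p • psi r s K p.1 p.2 = 0) (i : ℕ) :
    ∑ p ∈ x.support, x p • (fun z => biCoeff K (phi r s K p.1 p.2 z) i z) = 0 := by
  ext z
  have h1 : ∑ p ∈ x.support, C (x p) * phi r s K p.1 p.2 z = 0 := by
    have h2 := congrFun hx z
    simp only [Finset.sum_apply, Pi.smul_apply, smul_eq_C_mul, Pi.zero_apply] at h2
    simp only [phi_eq hk hev hrs, mul_add, Finset.sum_add_distrib, h2, zero_add,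
      mul_left_comm (C (x _)), ← Finset.mul_sum, sum_eichlerPM_eq_zero hk hK hev hrs x hx, mul_zero]
  have h3 := congrArg (fun P => biCoeff K P i z) h1
  simp only [biCoeff_sum, biCoeff_C_mul] at h3
  simp only [Finset.sum_apply, Pi.smul_apply, smul_eq_mul, Pi.zero_apply, h3]
  simp [biCoeff, biPoly]

/-- The coefficients of `φ` in the adapted basis, as a tuple of elements of `MI2'`. -/
def phiTuple (hk : k = K + 2) (hev : Even (r + s)) (hrs : K + 4 ≤ r + s)
    (p : Sgn × CuspForm 𝒮ℒ k) (i : Fin (K + 1)) : MI2' :=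
  ⟨_, single_biCoeff_phi_mem_MI2' hk hev hrs p.1 p.2 i⟩

/-- Both families are images of the free space on the pairs (sign, h). The map exists because every
relation among the ψ holds among the tuples; no linearity in h is involved, and for the sign - there
is none. -/
theorem exists_linearMap_psiSpan (hk : k = K + 2) (hK : Even K) (hev : Even (r + s))
    (hrs : K + 4 ≤ r + s) : ∃ Φ : psiSpan k r s K →ₗ[ℂ] (Fin (K + 1) → MI2'),
      ∀ (ε : Sgn) (h : CuspForm 𝒮ℒ k),
        Φ ⟨psi r s K ε h, psi_mem_psiSpan r s K ε h⟩ = phiTuple hk hev hrs (ε, h) := by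
  set A := Finsupp.linearCombination ℂ fun p : Sgn × CuspForm 𝒮ℒ k => psi r s K p.1 p.2 with hA
  set T := Finsupp.linearCombination ℂ (phiTuple (K := K) hk hev hrs) with hT
  have hker : LinearMap.ker A ≤ LinearMap.ker T := by
    intro x hx
    rw [LinearMap.mem_ker, hA, Finsupp.linearCombination_apply, Finsupp.sum] at hx
    rw [LinearMap.mem_ker, hT, Finsupp.linearCombination_apply, Finsupp.sum]
    ext1 i
    refine Subtype.ext ?_
    simp only [Finset.sum_apply, Pi.smul_apply, Pi.zero_apply, AddSubmonoidClass.coe_finsetSum,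
      SetLike.val_smul, phiTuple, Finsupp.smul_single, ← Finsupp.single_finsetSum,
      sum_biCoeff_phi_eq_zero hk hK hev hrs x hx, Finsupp.single_zero, ZeroMemClass.coe_zero]
  have hrange : LinearMap.range A = psiSpan k r s K := Finsupp.range_linearCombination _
  -- A linear section g of A is chosen; two lifts differ by an element of ker A, on which T
  -- vanishes.
  obtain ⟨g, hg⟩ := A.rangeRestrict.exists_rightInverse_of_surjective A.range_rangeRestrict
  refine ⟨T ∘ₗ g ∘ₗ (LinearEquiv.ofEq _ _ hrange.symm).toLinearMap, fun ε h => ?_⟩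
  set y := LinearEquiv.ofEq _ _ hrange.symm
    ⟨psi r s K ε h, psi_mem_psiSpan r s K ε h⟩ with hy
  have h1 : A (g y) = psi r s K ε h := congrArg Subtype.val (LinearMap.congr_fun hg y)
  have h2 : A (Finsupp.single (ε, h) 1) = psi r s K ε h := by simp [hA]
  have h3 : g y - Finsupp.single (ε, h) 1 ∈ LinearMap.ker T :=
    hker (by rw [LinearMap.mem_ker, map_sub, h1, h2, sub_self])
  rw [LinearMap.mem_ker, map_sub] at h3
  exact (sub_eq_zero.mp h3).trans (by simp [hT])

theorem existsUnique_linearMap_psiSpan (hk : k = K + 2) (hK : Even K) (hev : Even (r + s))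
    (hrs : K + 4 ≤ r + s) : ∃! Φ : psiSpan k r s K →ₗ[ℂ] (Fin (K + 1) → MI2'),
      ∀ (ε : Sgn) (h : CuspForm 𝒮ℒ k),
        Φ ⟨psi r s K ε h, psi_mem_psiSpan r s K ε h⟩ = phiTuple hk hev hrs (ε, h) := by
  obtain ⟨Φ, hΦ⟩ := exists_linearMap_psiSpan hk hK hev hrs
  refine ⟨Φ, hΦ, fun Ψ hΨ => ?_⟩
  refine LinearMap.ext fun ⟨F, hF⟩ => ?_
  refine Submodule.span_induction (p := fun F hF => Ψ ⟨F, hF⟩ = Φ ⟨F, hF⟩) ?_ ?_ ?_ ?_ hF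
  · rintro _ ⟨⟨ε, h⟩, rfl⟩
    exact (hΨ ε h).trans (hΦ ε h).symm
  · exact (map_zero Ψ).trans (map_zero Φ).symm
  · intro F G hF hG e₁ e₂
    have := congrArg₂ (· + ·) e₁ e₂
    simpa only [← map_add] using! this
  · intro c F hF e
    have := congrArg (c • ·) e
    simpa only [← map_smul] using! this

end LinearMap

end RAIter

end

theorem mainTheorem10 (k₁ : ℕ) (hk₂ : 2 ≤ k₁) (hk : Even k₁) (r s : ℤ) (hrs : Even (r + s))
    (hlt : (k₁ : ℤ) < r + s) :
    -- the terms of the three series depend only on the coset `B γ`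
    (∀ β ∈ RAIter.B, ∀ (γ : Matrix.SpecialLinearGroup (Fin 2) ℤ) (z : UpperHalfPlane),
      RAIter.wt r s (β * γ) z = RAIter.wt r s γ z ∧
      ∀ (ε : RAIter.Sgn) (h : CuspForm 𝒮ℒ (k₁ : ℤ)),
        RAIter.psiTerm r s (k₁ - 2) ε h z (β * γ) = RAIter.psiTerm r s (k₁ - 2) ε h z γ ∧
        RAIter.phiTerm r s (k₁ - 2) ε h z (β * γ) = RAIter.phiTerm r s (k₁ - 2) ε h z γ) ∧
    -- absolute convergence of the three series
    (∀ z : UpperHalfPlane,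
      Summable (fun q : RAIter.BCosets => RAIter.wt r s q.out z) ∧
      ∀ (ε : RAIter.Sgn) (h : CuspForm 𝒮ℒ (k₁ : ℤ)) (n : ℕ),
        Summable (fun q : RAIter.BCosets =>
          (RAIter.psiTerm r s (k₁ - 2) ε h z q.out).coeff n) ∧
        Summable (fun q : RAIter.BCosets =>
          (RAIter.phiTerm r s (k₁ - 2) ε h z q.out).coeff n)) ∧
    -- `φ = ψ + F 𝓔` is `Γ`-invariant, and its coefficients are those in the adapted basis
    (∀ (ε : RAIter.Sgn) (h : CuspForm 𝒮ℒ (k₁ : ℤ)),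
      (∀ z : UpperHalfPlane, RAIter.phi r s (k₁ - 2) ε h z =
        RAIter.psi r s (k₁ - 2) ε h z +
          Polynomial.C (RAIter.eis r s z) * RAIter.eichlerPM (k₁ - 2) ε h z) ∧
      (∀ γ : Matrix.SpecialLinearGroup (Fin 2) ℤ,
        RAIter.slashPoly r s (k₁ - 2) γ (RAIter.phi r s (k₁ - 2) ε h) =
          RAIter.phi r s (k₁ - 2) ε h) ∧
      (∀ z : UpperHalfPlane, RAIter.phi r s (k₁ - 2) ε h z =
        ∑ i ∈ Finset.range (k₁ - 1),
          Polynomial.C (RAIter.biCoeff (k₁ - 2) (RAIter.phi r s (k₁ - 2) ε h z) i z) *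
            (Polynomial.X - Polynomial.C (z : ℂ)) ^ i *
            (Polynomial.X - Polynomial.C (conj (z : ℂ))) ^ (k₁ - 2 - i))) ∧
    -- the span of the family lies in `M_c^{(2)}(𝓡)`
    RAIter.psiSpan k₁ r s (k₁ - 2) ≤ RAIter.Mc2 r s (k₁ - 2) ∧
    -- the well-defined linear map
    ∃! Φ : RAIter.psiSpan k₁ r s (k₁ - 2) →ₗ[ℂ] (Fin (k₁ - 1) → RAIter.MI2'),
      ∀ (ε : RAIter.Sgn) (h : CuspForm 𝒮ℒ (k₁ : ℤ)) (i : Fin (k₁ - 1)),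
        (Φ ⟨RAIter.psi r s (k₁ - 2) ε h, RAIter.psi_mem_psiSpan r s (k₁ - 2) ε h⟩ i :
            RAIter.Bigraded) =
          Finsupp.single (r + (i : ℤ), s + (k₁ : ℤ) - 2 - (i : ℤ))
            (fun z => RAIter.biCoeff (k₁ - 2) (RAIter.phi r s (k₁ - 2) ε h z) i z) := by
  obtain ⟨K, rfl⟩ : ∃ K, k₁ = K + 2 := ⟨k₁ - 2, by omega⟩
  have hk2 : K + 2 - 2 = K := rfl
  have hkK : ((K + 2 : ℕ) : ℤ) = K + 2 := by push_cast; ring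
  have hK : Even K := by simpa [Nat.even_add] using hk
  -- Both r + s and K are even, so r + s > K + 2 improves to r + s ≥ K + 4.
  have hrs4 : (K : ℤ) + 4 ≤ r + s := by
    obtain ⟨a, ha⟩ := hrs
    obtain ⟨b, hb⟩ := hK
    omega
  rw [hk2]
  refine ⟨fun β hβ γ z => ⟨RAIter.BInvariant_wt hrs z β hβ γ, fun ε h =>
    ⟨RAIter.psiTerm_mul_left hkK hrs ε h z hβ γ, RAIter.phiTerm_mul_left hkK hrs ε h z hβ γ⟩⟩,
    fun z => ⟨RAIter.summable_wt hrs (by omega) z, fun ε h n =>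
      ⟨RAIter.summable_psiTerm hkK hrs hrs4 ε h z n,
        RAIter.summable_phiTerm hkK hrs hrs4 ε h z n⟩⟩,
    fun ε h => ⟨RAIter.phi_eq hkK hrs hrs4 ε h, RAIter.slashPoly_phi hkK hrs hrs4 ε h,
      fun z => RAIter.biCoeff_expansion K _ (RAIter.natDegree_cosetSumPoly_le K _) z⟩,
    RAIter.psiSpan_le_Mc2 hkK hrs hrs4, ?_⟩
  refine (existsUnique_congr fun Φ => forall₂_congr fun ε h => ?_).mp
    (RAIter.existsUnique_linearMap_psiSpan hkK hK hrs hrs4)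
  have e : s + ((K + 2 : ℕ) : ℤ) - 2 = s + K := by rw [hkK]; ring
  rw [e, funext_iff]
  exact forall_congr' fun i => Subtype.ext_iff
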